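/- **Theorem 2.6.** Let $G$ be a compact connected Lie group with Lie algebra $\mathfrak g$, and let $W$ be a compact smooth $G$-manifold, possibly with boundary, such that $G$ acts locally freely on some open subset of $W$ that contains $\partial W$. Let $W^s\subset W$ be the set of points whose stabilizer has positive dimension and let $W^0=W\setminus W^s$. Let $f:W\to[0,1]$ be a $G$-invariant smooth function that vanishes on a neighbourhood of $W^s$. Choose a basis $\xi_a$ of $\mathfrak g$ with dual basis $\Theta^a$ of $\mathfrak g^*$, regarded as generators of the symmetric algebra $S(\mathfrak g^*)$. For $\xi\in\mathfrak g$ let $X_\xi$ be the fundamental vector field $X_\xi(x)=\frac{d}{dt}\big|_{t=0}\exp(-t\xi)x$ on $W$, and let $\iota_a$ be the contraction with $X_{\xi_a}$. Let $G$ act on $S(\mathfrak g^*)$ by the coadjoint action and on $\Omega(W)$ by $g\cdot\alpha=(g^{-1})^*\alpha$, and let $$\Omega_G(W)=(S(\mathfrak g^*)\otimes\Omega(W))^G,\qquad D=1\otimes d-\sum_a\Theta^a\otimes\iota_a ,$$ with cohomology $H_G^*(W)$ (the Cartan model). Let $\omega$ be a connection on $W^0$, that is, a smooth $\mathfrak g$-valued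 one-form on $W^0$ with $g^*\omega=\mathrm{Ad}_g\,\omega$ for all $g\in G$ and $\omega(X_\xi)=\xi$ for all $\xi\in\mathfrak g$. Let $\omega_f=f\omega$, extended by zero to $W$, and $$\Omega_f^G=d\omega_f+\tfrac12[\omega_f,\omega_f]-(-1+f)\sum_a\xi_a\Theta^a ,$$ with components $(\Omega_f^G)^a\in S(\mathfrak g^*)\otimes\Omega(W)$ in the basis $\xi_a$. These components have even form degree, hence commute, and we let $CW_f:S(\mathfrak g^*)\to S(\mathfrak g^*)\otimes\Omega(W)$ be the homomorphism of algebras $F\mapsto F(\Omega_f^G)$, that is, $\Theta^a\mapsto(\Omega_f^G)^a$. Let $i^c:S(\mathfrak g^*)\to S(\mathfrak g^*)\otimes\Omega(W)$ be the inclusion $F\mapsto F\otimes1$. Then for every $F\in S(\mathfrak g^*)^G$ both $CW_f(F)$ and $i^c(F)$ are $D$-closed elements of $\Omega_G(W)$, and the induced maps $cw_f,\ i^c_*:S(\mathfrak g^*)^G\to H_G^*(W)$ are equal: $$cw_f=i^c_* .$$ -/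

import Mathlib

open scoped Manifold ContDiff Bundle TensorProduct

namespace DegCW

noncomputable section

/-! ### Differential forms over a Lie-Rinehart pair -/

/-- Differential forms over a pair `(A, L)`. For `A = C^∞(W)` and `L` the `C^∞(W)`-module of smooth
vector fields on a manifold `W`, a smooth `k`-form is the same thing as an alternating
`C^∞(W)`-multilinear map `L^k → C^∞(W)`. A form is the family of its homogeneous components; the
product over all degrees is the direct sum, as forms of degree above the dimension of `W` vanish. -/
structure Form (A L : Type*) [CommRing A] [AddCommGroup L] [Module A L] where
  /-- The component of degree `k`. -/
  comp : ∀ k : ℕ, L [⋀^Fin k]→ₗ[A] A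

namespace Form

section Exterior

variable {A L : Type*} [CommRing A] [AddCommGroup L] [Module A L]

instance : CoeFun (Form A L) (fun _ => ∀ k : ℕ, L [⋀^Fin k]→ₗ[A] A) := ⟨Form.comp⟩

@[ext] theorem ext {α β : Form A L} (h : ∀ k v, α k v = β k v) : α = β := by
  cases α; cases β
  exact congrArg Form.mk (funext fun k => AlternatingMap.ext (h k))

theorem comp_injective : Function.Injective (Form.comp : Form A L → _) :=
  fun α β h => ext fun k v => by rw [h]

instance : Zero (Form A L) := ⟨⟨0⟩⟩
instance : Add (Form A L) := ⟨fun α β => ⟨α.comp + β.comp⟩⟩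
instance : Neg (Form A L) := ⟨fun α => ⟨-α.comp⟩⟩
instance : Sub (Form A L) := ⟨fun α β => ⟨α.comp - β.comp⟩⟩
instance {S : Type*} [Monoid S] [DistribMulAction S A] [SMulCommClass A S A] :
    SMul S (Form A L) := ⟨fun c α => ⟨fun k => c • α k⟩⟩

instance : AddCommGroup (Form A L) :=
  comp_injective.addCommGroup Form.comp rfl (fun _ _ => rfl) (fun _ => rfl) (fun _ _ => rfl)
    (fun _ _ => rfl) (fun _ _ => rfl)

/-- `comp` as an additive map. -/
def compHom : Form A L →+ ∀ k : ℕ, L [⋀^Fin k]→ₗ[A] A where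
  toFun := Form.comp
  map_zero' := rfl
  map_add' _ _ := rfl

instance {S : Type*} [Semiring S] [Module S A] [SMulCommClass A S A] : Module S (Form A L) :=
  comp_injective.module S compHom (fun _ _ => rfl)

@[simp] theorem add_apply (α β : Form A L) (k : ℕ) (v : Fin k → L) :
    (α + β) k v = α k v + β k v := rfl
@[simp] theorem sub_apply (α β : Form A L) (k : ℕ) (v : Fin k → L) :
    (α - β) k v = α k v - β k v := rfl
@[simp] theorem neg_apply (α : Form A L) (k : ℕ) (v : Fin k → L) : (-α) k v = -(α k v) := rfl
@[simp] theorem zero_apply (k : ℕ) (v : Fin k → L) : (0 : Form A L) k v = 0 := rfl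
@[simp] theorem smul_apply {S : Type*} [Monoid S] [DistribMulAction S A] [SMulCommClass A S A]
    (c : S) (α : Form A L) (k : ℕ) (v : Fin k → L) : (c • α) k v = c • α k v := rfl

/-- The contraction `ι_X`, with `(ι_X α)(X₁, …, X_k) = α(X, X₁, …, X_k)`. -/
def contract (x : L) : Form A L →ₗ[A] Form A L where
  toFun α := ⟨fun k => (α (k + 1)).curryLeft x⟩
  map_add' _ _ := rfl
  map_smul' _ _ := rfl

@[simp] theorem contract_apply (x : L) (α : Form A L) (k : ℕ) (v : Fin k → L) :
    contract x α k v = α (k + 1) (Matrix.vecCons x v) := rfl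

/-- The grading involution: multiplication by `(-1)^k` on `k`-forms. -/
def sgn : Form A L →ₗ[A] Form A L where
  toFun α := ⟨fun k => (-1 : A) ^ k • α k⟩
  map_add' _ _ := ext fun _ _ => mul_add _ _ _
  map_smul' _ _ := ext fun _ _ => mul_left_comm _ _ _

@[simp] theorem sgn_apply (α : Form A L) (k : ℕ) (v : Fin k → L) :
    sgn α k v = (-1) ^ k * α k v := rfl

@[simp] theorem sgn_sgn (α : Form A L) : sgn (sgn α) = α := by
  ext k v
  rw [sgn_apply, sgn_apply, ← mul_assoc, ← mul_pow]; simp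

theorem contract_sgn (x : L) (α : Form A L) : contract x (sgn α) = -sgn (contract x α) := by
  ext k v; simp [pow_succ]

theorem contract_self (x : L) (α : Form A L) : contract x (contract x α) = 0 := by
  ext k v
  exact (α (k + 2)).map_eq_zero_of_eq _ (i := 0) (j := 1) (by simp) (by simp)

theorem contract_add_left (x y : L) (α : Form A L) :
    contract (x + y) α = contract x α + contract y α := by
  exact comp_injective (funext fun k => map_add (α (k + 1)).curryLeft x y)

theorem contract_smul_left (a : A) (x : L) (α : Form A L) :
    contract (a • x) α = a • contract x α := by
  exact comp_injective (funext fun k => map_smul (α (k + 1)).curryLeft a x)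

theorem contract_zero_left (α : Form A L) : contract (0 : L) α = 0 := by
  simpa using contract_smul_left (0 : A) (0 : L) α

theorem contract_neg_left (x : L) (α : Form A L) : contract (-x) α = -contract x α := by
  simpa using contract_smul_left (-1 : A) x α

theorem contract_comm (x y : L) (α : Form A L) :
    contract x (contract y α) = -contract y (contract x α) := by
  have h := contract_self (x + y) α
  simp only [contract_add_left, map_add, contract_self, zero_add, add_zero] at h
  exact eq_neg_of_add_eq_zero_right (by rwa [add_comm] at h ⊢)

theorem ext_contract {α β : Form A L} (h0 : α 0 ![] = β 0 ![])
    (h : ∀ x, contract x α = contract x β) : α = β := by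
  ext k v
  cases k with
  | zero => rw [Subsingleton.elim v ![]]; exact h0
  | succ k =>
    rw [← Matrix.cons_head_tail v]
    exact congrArg (fun γ : Form A L => γ k (Matrix.vecTail v)) (h (Matrix.vecHead v))

/-! The exterior product and the ring structure -/

/-- The component of degree `n` of `α ∧ β`, that is the sum over all `(p, q)`-shuffles `σ`, with
`p + q = n`, of `sign σ * α(v_{σ 1}, …, v_{σ p}) * β(v_{σ (p+1)}, …, v_{σ n})`. The shuffles are
enumerated by recursion: the first argument is taken either by `α`, or by `β` after moving past `α`.
No factorials: `(α ∧ β)(X, Y) = α(X) β(Y) - α(Y) β(X)` for one-forms. -/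
def wedgeFun : (n : ℕ) → Form A L → Form A L → (Fin n → L) → A
  | 0, α, β, _ => α 0 ![] * β 0 ![]
  | n + 1, α, β, v =>
      wedgeFun n (contract (v 0) α) β (fun i => v i.succ) +
        wedgeFun n (sgn α) (contract (v 0) β) (fun i => v i.succ)

theorem wedgeFun_add_left (n : ℕ) (α α' β : Form A L) (v : Fin n → L) :
    wedgeFun n (α + α') β v = wedgeFun n α β v + wedgeFun n α' β v := by
  induction n generalizing α α' β with
  | zero => simp [wedgeFun, add_mul]
  | succ n ih => simp only [wedgeFun, map_add, ih]; abel

theorem wedgeFun_add_right (n : ℕ) (α β β' : Form A L) (v : Fin n → L) :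
    wedgeFun n α (β + β') v = wedgeFun n α β v + wedgeFun n α β' v := by
  induction n generalizing α β β' with
  | zero => simp [wedgeFun, mul_add]
  | succ n ih => simp only [wedgeFun, map_add, ih]; abel

theorem wedgeFun_smul_left (n : ℕ) (a : A) (α β : Form A L) (v : Fin n → L) :
    wedgeFun n (a • α) β v = a * wedgeFun n α β v := by
  induction n generalizing α β with
  | zero => simp [wedgeFun, mul_assoc]
  | succ n ih => simp only [wedgeFun, map_smul, ih]; ring

theorem wedgeFun_smul_right (n : ℕ) (a : A) (α β : Form A L) (v : Fin n → L) :
    wedgeFun n α (a • β) v = a * wedgeFun n α β v := by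
  induction n generalizing α β with
  | zero => simp [wedgeFun, mul_left_comm]
  | succ n ih => simp only [wedgeFun, map_smul, ih]; ring

theorem wedgeFun_zero_left (n : ℕ) (β : Form A L) (v : Fin n → L) : wedgeFun n 0 β v = 0 := by
  simpa using wedgeFun_smul_left n (0 : A) 0 β v

theorem wedgeFun_zero_right (n : ℕ) (α : Form A L) (v : Fin n → L) : wedgeFun n α 0 v = 0 := by
  simpa using wedgeFun_smul_right n (0 : A) α 0 v

theorem wedgeFun_neg_left (n : ℕ) (α β : Form A L) (v : Fin n → L) :
    wedgeFun n (-α) β v = -wedgeFun n α β v := by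
  simpa using wedgeFun_smul_left n (-1 : A) α β v

theorem wedgeFun_neg_right (n : ℕ) (α β : Form A L) (v : Fin n → L) :
    wedgeFun n α (-β) v = -wedgeFun n α β v := by
  simpa using wedgeFun_smul_right n (-1 : A) α β v

theorem wedgeFun_repeat (n : ℕ) (α β : Form A L) (v : Fin n → L) (j : Fin n) :
    wedgeFun n (contract (v j) α) β v + wedgeFun n (sgn α) (contract (v j) β) v = 0 := by
  induction n generalizing α β with
  | zero => exact j.elim0
  | succ n ih =>
    induction j using Fin.cases with
    | zero =>
      simp only [wedgeFun, contract_self, wedgeFun_zero_left, wedgeFun_zero_right, contract_sgn,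
        wedgeFun_neg_left, sgn_sgn]
      abel
    | succ j =>
      have h1 := ih (contract (v 0) α) β (fun i => v i.succ) j
      have h2 := ih (sgn α) (contract (v 0) β) (fun i => v i.succ) j
      simp only [wedgeFun, contract_sgn, wedgeFun_neg_left, sgn_sgn] at h1 h2 ⊢
      simp only [contract_comm (v 0) (v j.succ), wedgeFun_neg_left, wedgeFun_neg_right] at h1 h2 ⊢
      simp only [contract_comm (v j.succ) (v 0), wedgeFun_neg_left, wedgeFun_neg_right] at h1 h2 ⊢
      linear_combination -h1 - h2

theorem wedgeFun_update_add (n : ℕ) (α β : Form A L) (v : Fin n → L) (i : Fin n) (x y : L) :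
    wedgeFun n α β (Function.update v i (x + y)) =
      wedgeFun n α β (Function.update v i x) + wedgeFun n α β (Function.update v i y) := by
  induction n generalizing α β with
  | zero => exact i.elim0
  | succ n ih =>
    induction i using Fin.cases with
    | zero =>
      simp only [wedgeFun, Function.update_self, contract_add_left, wedgeFun_add_left,
        wedgeFun_add_right, Function.update_of_ne (Fin.succ_ne_zero _)]
      abel
    | succ i =>
      have h : ∀ z, (fun k : Fin n => Function.update v i.succ z k.succ) =
          Function.update (fun k => v k.succ) i z := fun z => by
        funext k; simp [Function.update_apply]
      simp only [wedgeFun, h, ih, Function.update_of_ne (Fin.succ_ne_zero _).symm]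
      abel

theorem wedgeFun_update_smul (n : ℕ) (α β : Form A L) (v : Fin n → L) (i : Fin n) (a : A) (x : L) :
    wedgeFun n α β (Function.update v i (a • x)) =
      a * wedgeFun n α β (Function.update v i x) := by
  induction n generalizing α β with
  | zero => exact i.elim0
  | succ n ih =>
    induction i using Fin.cases with
    | zero =>
      simp only [wedgeFun, Function.update_self, contract_smul_left, wedgeFun_smul_left,
        wedgeFun_smul_right, Function.update_of_ne (Fin.succ_ne_zero _)]
      ring
    | succ i =>
      have h : ∀ z, (fun k : Fin n => Function.update v i.succ z k.succ) =
          Function.update (fun k => v k.succ) i z := fun z => by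
        funext k; simp [Function.update_apply]
      simp only [wedgeFun, h, ih, Function.update_of_ne (Fin.succ_ne_zero _).symm]
      ring

theorem wedgeFun_alternating (n : ℕ) (α β : Form A L) (v : Fin n → L) (i j : Fin n)
    (hv : v i = v j) (hij : i ≠ j) : wedgeFun n α β v = 0 := by
  induction n generalizing α β with
  | zero => exact i.elim0
  | succ n ih =>
    induction i using Fin.cases with
    | zero =>
      obtain ⟨j, rfl⟩ := Fin.exists_succ_eq.2 hij.symm
      simp only [wedgeFun, hv]
      exact wedgeFun_repeat n α β (fun k => v k.succ) j
    | succ i =>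
      induction j using Fin.cases with
      | zero =>
        simp only [wedgeFun, ← hv]
        exact wedgeFun_repeat n α β (fun k => v k.succ) i
      | succ j =>
        have hij' : i ≠ j := fun h => hij (by rw [h])
        simp only [wedgeFun, ih _ _ (fun k => v k.succ) i j hv hij', add_zero]

instance : Mul (Form A L) where
  mul α β := ⟨fun n =>
    { toFun := wedgeFun n α β
      map_update_add' := fun {inst} v i x y => by
        obtain rfl : inst = instDecidableEqFin n := Subsingleton.elim _ _
        exact wedgeFun_update_add n α β v i x y
      map_update_smul' := fun {inst} v i a x => by
        obtain rfl : inst = instDecidableEqFin n := Subsingleton.elim _ _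
        exact wedgeFun_update_smul n α β v i a x
      map_eq_zero_of_eq' := wedgeFun_alternating n α β }⟩

theorem mul_apply (α β : Form A L) (n : ℕ) (v : Fin n → L) : (α * β) n v = wedgeFun n α β v := rfl

theorem mul_zero_apply (α β : Form A L) : (α * β) 0 ![] = α 0 ![] * β 0 ![] := rfl

/-- Contraction is an antiderivation of the exterior product. -/
theorem contract_mul (x : L) (α β : Form A L) :
    contract x (α * β) = contract x α * β + sgn α * contract x β := rfl

/-- The functions `C^∞` as forms of degree zero. -/
def ofFun : A →ₗ[A] Form A L where
  toFun a := ⟨fun k =>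
    match k with
    | 0 => AlternatingMap.constOfIsEmpty A L (Fin 0) a
    | _ + 1 => 0⟩
  map_add' a b := by
    refine ext fun k v => ?_
    cases k
    · rfl
    · exact (add_zero (0 : A)).symm
  map_smul' a b := by
    refine ext fun k v => ?_
    cases k
    · rfl
    · exact (mul_zero a).symm

@[simp] theorem ofFun_zero (a : A) (v : Fin 0 → L) : (ofFun a : Form A L) 0 v = a := rfl
@[simp] theorem contract_ofFun (x : L) (a : A) : contract x (ofFun a : Form A L) = 0 := rfl
@[simp] theorem sgn_ofFun (a : A) : sgn (ofFun a : Form A L) = ofFun a :=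
  ext_contract (by simp) fun x => by simp [contract_sgn]

theorem sgn_mul (α β : Form A L) : sgn (α * β) = sgn α * sgn β := by
  have key : ∀ (n : ℕ) (α β : Form A L) (v : Fin n → L),
      sgn (α * β) n v = (sgn α * sgn β) n v := by
    intro n
    induction n with
    | zero => intro α β v; simp [mul_apply, wedgeFun]
    | succ n ih =>
      intro α β v
      have h := ih (contract (v 0) α) β (fun i => v i.succ)
      have h' := ih (sgn α) (contract (v 0) β) (fun i => v i.succ)
      simp only [sgn_apply, mul_apply, wedgeFun, contract_sgn, wedgeFun_neg_left,
        wedgeFun_neg_right, pow_succ] at h h' ⊢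
      linear_combination -h - h'
  exact ext (key · α β)

instance : One (Form A L) := ⟨ofFun 1⟩

theorem one_def : (1 : Form A L) = ofFun 1 := rfl

theorem add_mul' (α β γ : Form A L) : (α + β) * γ = α * γ + β * γ :=
  ext fun n v => wedgeFun_add_left n α β γ v

theorem mul_add' (α β γ : Form A L) : α * (β + γ) = α * β + α * γ :=
  ext fun n v => wedgeFun_add_right n α β γ v

theorem ofFun_mul (a : A) (β : Form A L) : ofFun a * β = a • β := by
  ext n v
  induction n generalizing β with
  | zero => rw [Subsingleton.elim v ![]]; simp [mul_apply, wedgeFun]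
  | succ n ih =>
    have h := ih (contract (v 0) β) (fun i => v i.succ)
    simp only [mul_apply, wedgeFun, contract_ofFun, wedgeFun_zero_left, sgn_ofFun, zero_add] at h ⊢
    rw [h]
    simp only [smul_apply, contract_apply]
    congr 2
    exact Matrix.cons_head_tail v

theorem mul_ofFun (a : A) (β : Form A L) : β * ofFun a = a • β := by
  ext n v
  induction n generalizing β with
  | zero => rw [Subsingleton.elim v ![]]; simp [mul_apply, wedgeFun, mul_comm]
  | succ n ih =>
    have h := ih (contract (v 0) β) (fun i => v i.succ)
    simp only [mul_apply, wedgeFun, contract_ofFun, wedgeFun_zero_right, add_zero] at h ⊢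
    rw [h]
    simp only [smul_apply, contract_apply]
    congr 2
    exact Matrix.cons_head_tail v

theorem mul_assoc' (α β γ : Form A L) : α * β * γ = α * (β * γ) := by
  have key : ∀ (n : ℕ) (α β γ : Form A L) (v : Fin n → L),
      (α * β * γ) n v = (α * (β * γ)) n v := by
    intro n
    induction n with
    | zero => intro α β γ v; simp [mul_apply, wedgeFun, mul_assoc]
    | succ n ih =>
      intro α β γ v
      have e : ∀ δ : Form A L, δ (n + 1) v = contract (v 0) δ n (fun i => v i.succ) :=
        fun δ => congrArg (δ (n + 1)) (Matrix.cons_head_tail v).symm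
      simp only [e, contract_mul, add_mul', mul_add', add_apply, ih, sgn_mul]
      ring
  exact ext (key · α β γ)

instance : Ring (Form A L) :=
  { (inferInstance : AddCommGroup (Form A L)) with
    mul := (· * ·)
    one := 1
    left_distrib := mul_add'
    right_distrib := add_mul'
    zero_mul := fun α => ext fun n v => wedgeFun_zero_left n α v
    mul_zero := fun α => ext fun n v => wedgeFun_zero_right n α v
    mul_assoc := mul_assoc'
    one_mul := fun α => by rw [one_def, ofFun_mul, one_smul]
    mul_one := fun α => by rw [one_def, mul_ofFun, one_smul] }

theorem smul_mul' (a : A) (α β : Form A L) : a • α * β = a • (α * β) :=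
  ext fun n v => wedgeFun_smul_left n a α β v

theorem mul_smul' (a : A) (α β : Form A L) : α * a • β = a • (α * β) :=
  ext fun n v => wedgeFun_smul_right n a α β v

/-- Graded commutativity, for `α` even or odd. -/
theorem mul_comm_of_even_odd (n : ℕ) (α β : Form A L) :
    (sgn α = α → ∀ v, (α * β) n v = (β * α) n v) ∧
      (sgn α = -α → ∀ v, (α * β) n v = (sgn β * α) n v) := by
  induction n generalizing α β with
  | zero =>
    refine ⟨fun _ v => ?_, fun _ v => ?_⟩ <;> simp [mul_apply, wedgeFun, mul_comm]
  | succ n ih =>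
    have e : ∀ (δ : Form A L) (v : Fin (n + 1) → L),
        δ (n + 1) v = contract (v 0) δ n (fun i => v i.succ) :=
      fun δ v => congrArg (δ (n + 1)) (Matrix.cons_head_tail v).symm
    refine ⟨fun hα v => ?_, fun hα v => ?_⟩
    · have h1 : sgn (contract (v 0) α) = -contract (v 0) α := by
        rw [← neg_eq_iff_eq_neg, ← contract_sgn, hα]
      rw [e, e, contract_mul, contract_mul, hα, add_apply, add_apply, (ih _ _).2 h1, (ih _ _).1 hα,
        add_comm]
    · have h1 : sgn (contract (v 0) α) = contract (v 0) α := by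
        rw [← neg_inj, ← contract_sgn, hα, map_neg]
      have h2 := (ih α (contract (v 0) β)).2 hα (fun i => v i.succ)
      rw [e, e, contract_mul, contract_mul, hα, add_apply, add_apply, (ih _ _).1 h1, sgn_sgn,
        contract_sgn, neg_mul, neg_mul, neg_apply, neg_apply, h2, add_comm]

/-- Forms of even degree are central. -/
theorem commute_of_even {α : Form A L} (hα : sgn α = α) (β : Form A L) : Commute α β :=
  ext fun n => (mul_comm_of_even_odd n α β).1 hα

/-- A `C^∞`-linear functional on vector fields as a form of degree one. -/
def ofOne (ℓ : L →ₗ[A] A) : Form A L := ⟨fun k =>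
  match k with
  | 1 => AlternatingMap.ofSubsingleton A L A (0 : Fin 1) ℓ
  | _ => 0⟩

@[simp] theorem ofOne_apply (ℓ : L →ₗ[A] A) (x : L) : (ofOne ℓ) 1 ![x] = ℓ x := rfl

theorem contract_ofOne (x : L) (ℓ : L →ₗ[A] A) : contract x (ofOne ℓ) = ofFun (ℓ x) := by
  refine ext fun k v => ?_
  rcases k with _ | k <;> rfl

theorem sgn_ofOne (ℓ : L →ₗ[A] A) : sgn (ofOne ℓ) = -ofOne ℓ := by
  refine ext_contract ?_ fun x => ?_
  · exact (mul_zero _).trans neg_zero.symm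
  · rw [contract_sgn, map_neg, contract_ofOne, sgn_ofFun]

theorem mul_apply_two (α β : Form A L) (hα : α 0 ![] = 0) (hβ : β 0 ![] = 0) (x y : L) :
    (α * β) 2 ![x, y] = α 1 ![x] * β 1 ![y] - α 1 ![y] * β 1 ![x] := by
  simp [mul_apply, wedgeFun, hα, hβ, contract_sgn]
  ring

end Exterior

section Scalars

variable {K A L : Type*} [CommRing K] [CommRing A] [Algebra K A] [AddCommGroup L] [Module A L]

theorem algebraMap_smul' (c : K) (α : Form A L) : c • α = algebraMap K A c • α :=
  ext fun k v => Algebra.smul_def c (α k v)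

instance : Algebra K (Form A L) :=
  Algebra.ofModule
    (fun c α β => by rw [algebraMap_smul' c, smul_mul', ← algebraMap_smul'])
    (fun c α β => by rw [algebraMap_smul' c, mul_smul', ← algebraMap_smul'])

instance : IsScalarTower K A (Form A L) :=
  IsScalarTower.of_algebraMap_smul fun c α => (algebraMap_smul' c α).symm

end Scalars

section Lie

variable {A L : Type*} [CommRing A] [LieRing L] [Module A L] [LieRingModule L A]
  [LieRinehartRing A L]

/-- The Lie derivative, by the recursion `ι_v L_x = L_x ι_v - ι_[x,v]`; see `lieD_apply`. -/
def lieFun (x : L) : (n : ℕ) → Form A L → (Fin n → L) → A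
  | 0, α, _ => ⁅x, α 0 ![]⁆
  | n + 1, α, v => lieFun x n (contract (v 0) α) (fun i => v i.succ) -
      contract ⁅x, v 0⁆ α n (fun i => v i.succ)

theorem lieFun_add (x : L) (n : ℕ) (α β : Form A L) (v : Fin n → L) :
    lieFun x n (α + β) v = lieFun x n α v + lieFun x n β v := by
  induction n generalizing α β with
  | zero => simp [lieFun]
  | succ n ih => simp only [lieFun, map_add, ih, add_apply]; ring

theorem lieFun_smul (x : L) (n : ℕ) (a : A) (α : Form A L) (v : Fin n → L) :
    lieFun x n (a • α) v = a * lieFun x n α v + ⁅x, a⁆ * α n v := by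
  induction n generalizing α with
  | zero => simp [lieFun, Subsingleton.elim v ![]]
  | succ n ih =>
    have e : α (n + 1) v = contract (v 0) α n (fun i => v i.succ) :=
      congrArg (α (n + 1)) (Matrix.cons_head_tail v).symm
    simp only [lieFun, map_smul, ih, smul_apply, e, smul_eq_mul]; ring

theorem lieFun_neg (x : L) (n : ℕ) (α : Form A L) (v : Fin n → L) :
    lieFun x n (-α) v = -lieFun x n α v := by
  have h := lieFun_add x n α (-α) v
  have h0 := lieFun_add x n (0 : Form A L) 0 v
  rw [add_neg_cancel] at h
  rw [add_zero] at h0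
  linear_combination -h0 - h

theorem lieFun_zero (x : L) (n : ℕ) (v : Fin n → L) : lieFun x n (0 : Form A L) v = 0 := by
  have h0 := lieFun_add x n (0 : Form A L) 0 v
  rw [add_zero] at h0
  linear_combination -h0

theorem lieFun_update_add (x : L) (n : ℕ) (α : Form A L) (v : Fin n → L) (i : Fin n) (y z : L) :
    lieFun x n α (Function.update v i (y + z)) =
      lieFun x n α (Function.update v i y) + lieFun x n α (Function.update v i z) := by
  induction n generalizing α with
  | zero => exact i.elim0
  | succ n ih =>
    induction i using Fin.cases with
    | zero =>
      simp only [lieFun, Function.update_self, lie_add, contract_add_left, lieFun_add, add_apply,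
        Function.update_of_ne (Fin.succ_ne_zero _)]
      ring
    | succ i =>
      have h : ∀ w, (fun k : Fin n => Function.update v i.succ w k.succ) =
          Function.update (fun k => v k.succ) i w := fun w => by
        funext k; simp [Function.update_apply]
      simp only [lieFun, h, ih, Function.update_of_ne (Fin.succ_ne_zero _).symm,
        AlternatingMap.map_update_add]
      ring

theorem lieFun_update_smul (x : L) (n : ℕ) (α : Form A L) (v : Fin n → L) (i : Fin n) (a : A)
    (y : L) :
    lieFun x n α (Function.update v i (a • y)) = a * lieFun x n α (Function.update v i y) := by
  induction n generalizing α with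
  | zero => exact i.elim0
  | succ n ih =>
    induction i using Fin.cases with
    | zero =>
      simp only [lieFun, Function.update_self, LieRinehartRing.leibniz_smul_right,
        contract_add_left, contract_smul_left, lieFun_smul, add_apply, smul_apply, smul_eq_mul,
        Function.update_of_ne (Fin.succ_ne_zero _)]
      ring
    | succ i =>
      have h : ∀ w, (fun k : Fin n => Function.update v i.succ w k.succ) =
          Function.update (fun k => v k.succ) i w := fun w => by
        funext k; simp [Function.update_apply]
      simp only [lieFun, h, ih, Function.update_of_ne (Fin.succ_ne_zero _).symm,
        AlternatingMap.map_update_smul, smul_eq_mul]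
      ring

theorem contract_repeat (n : ℕ) (α : Form A L) (v : Fin n → L) (j : Fin n) :
    contract (v j) α n v = 0 :=
  (α (n + 1)).map_eq_zero_of_eq _ (i := 0) (j := j.succ) (by simp) (Fin.succ_ne_zero j).symm

theorem lieFun_repeat (x : L) (n : ℕ) (α : Form A L) (v : Fin n → L) (j : Fin n) :
    lieFun x n (contract (v j) α) v = contract ⁅x, v j⁆ α n v := by
  induction n generalizing α with
  | zero => exact j.elim0
  | succ n ih =>
    have e : ∀ β : Form A L, β (n + 1) v = contract (v 0) β n (fun i => v i.succ) := fun β =>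
      congrArg (β (n + 1)) (Matrix.cons_head_tail v).symm
    induction j using Fin.cases with
    | zero =>
      rw [e, contract_comm]
      simp [lieFun, contract_self, lieFun_zero]
    | succ j =>
      have h := ih (contract (v 0) α) (fun i => v i.succ) j
      have h2 := contract_repeat n (contract ⁅x, v 0⁆ α) (fun i => v i.succ) j
      rw [e, contract_comm (v 0)]
      simp only [lieFun]
      rw [contract_comm (v 0) (v j.succ), lieFun_neg, h, contract_comm ⁅x, v 0⁆, neg_apply, neg_apply,
        h2]
      ring

theorem lieFun_alternating (x : L) (n : ℕ) (α : Form A L) (v : Fin n → L) (i j : Fin n)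
    (hv : v i = v j) (hij : i ≠ j) : lieFun x n α v = 0 := by
  induction n generalizing α with
  | zero => exact i.elim0
  | succ n ih =>
    induction i using Fin.cases with
    | zero =>
      obtain ⟨j, rfl⟩ := Fin.exists_succ_eq.2 hij.symm
      simp only [lieFun, hv]
      exact sub_eq_zero.2 (lieFun_repeat x n α (fun k => v k.succ) j)
    | succ i =>
      induction j using Fin.cases with
      | zero =>
        simp only [lieFun, ← hv]
        exact sub_eq_zero.2 (lieFun_repeat x n α (fun k => v k.succ) i)
      | succ j =>
        have hij' : i ≠ j := fun h => hij (by rw [h])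
        simp only [lieFun, ih _ (fun k => v k.succ) i j hv hij',
          AlternatingMap.map_eq_zero_of_eq _ (fun k : Fin n => v k.succ) hv hij', sub_zero]

/-- The Lie derivative `L_x` of forms along `x`; `lieD_apply` is the usual formula. -/
def lieD (x : L) : Form A L →+ Form A L where
  toFun α := ⟨fun n =>
    { toFun := lieFun x n α
      map_update_add' := fun {inst} v i y z => by
        obtain rfl : inst = instDecidableEqFin n := Subsingleton.elim _ _
        exact lieFun_update_add x n α v i y z
      map_update_smul' := fun {inst} v i a y => by
        obtain rfl : inst = instDecidableEqFin n := Subsingleton.elim _ _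
        exact lieFun_update_smul x n α v i a y
      map_eq_zero_of_eq' := lieFun_alternating x n α }⟩
  map_zero' := ext fun n v => lieFun_zero x n v
  map_add' α β := ext fun n v => lieFun_add x n α β v

theorem lieD_apply' (x : L) (α : Form A L) (n : ℕ) (v : Fin n → L) :
    lieD x α n v = lieFun x n α v := rfl

theorem lieD_apply (x : L) (α : Form A L) (n : ℕ) (v : Fin n → L) :
    lieD x α n v = ⁅x, α n v⁆ - ∑ i, α n (Function.update v i ⁅x, v i⁆) := by
  rw [lieD_apply']
  induction n generalizing α with
  | zero => simp [lieFun, Subsingleton.elim v ![]]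
  | succ n ih =>
    have e : ∀ w : Fin (n + 1) → L,
        α (n + 1) w = contract (w 0) α n (fun i => w i.succ) := fun w =>
      congrArg (α (n + 1)) (Matrix.cons_head_tail w).symm
    have h : ∀ (i : Fin n) (w : L), (fun k : Fin n => Function.update v i.succ w k.succ) =
        Function.update (fun k => v k.succ) i w := fun i w => by
      funext k; simp [Function.update_apply]
    simp only [lieFun, ih, Fin.sum_univ_succ, e, Function.update_self, h,
      Function.update_of_ne (Fin.succ_ne_zero _), Function.update_of_ne (Fin.succ_ne_zero _).symm]
    ring

/-- `[L_x, ι_y] = ι_[x,y]` -/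
theorem contract_lieD (x y : L) (α : Form A L) :
    contract y (lieD x α) = lieD x (contract y α) - contract ⁅x, y⁆ α := rfl

theorem lieD_smul (x : L) (a : A) (α : Form A L) : lieD x (a • α) = a • lieD x α + ⁅x, a⁆ • α :=
  ext fun n v => lieFun_smul x n a α v

/-- The differential `da` of a function as a one-form, `da(x) = x(a)`. -/
def dFun (a : A) : Form A L :=
  ofOne
    { toFun := fun x => ⁅x, a⁆
      map_add' := fun x y => add_lie x y a
      map_smul' := fun b x => LieRinehartRing.lie_smul_eq_mul b a x }

theorem contract_dFun (x : L) (a : A) : contract x (dFun a : Form A L) = ofFun ⁅x, a⁆ :=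
  contract_ofOne x _

theorem sgn_dFun (a : A) : sgn (dFun a : Form A L) = -dFun a := sgn_ofOne _

theorem lieD_smul_left (x : L) (a : A) (α : Form A L) :
    lieD (a • x) α = a • lieD x α + dFun a * contract x α := by
  refine ext fun n v => ?_
  induction n generalizing α with
  | zero =>
    have h0 : (dFun a : Form A L) 0 ![] = 0 := rfl
    simp [lieD_apply', lieFun, mul_apply, wedgeFun, h0]
  | succ n ih =>
    have e : ∀ β : Form A L, β (n + 1) v = contract (v 0) β n (fun i => v i.succ) := fun β =>
      congrArg (β (n + 1)) (Matrix.cons_head_tail v).symm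
    have hb : ⁅a • x, v 0⁆ = a • ⁅x, v 0⁆ - ⁅v 0, a⁆ • x := by
      rw [← lie_skew, LieRinehartRing.leibniz_smul_right, ← lie_skew x, smul_neg]; abel
    have h := ih (contract (v 0) α) (fun i => v i.succ)
    rw [e, e, map_add, map_smul, contract_lieD, contract_lieD, contract_mul, contract_dFun,
      ofFun_mul, sgn_dFun, contract_comm (v 0) x, neg_mul_neg, sub_apply, h, hb]
    simp only [sub_eq_add_neg, ← neg_smul, contract_add_left, contract_smul_left, add_apply,
      smul_apply, neg_apply, smul_eq_mul]
    ring

/-- The exterior derivative, by the recursion `ι_v d = L_v - d ι_v`, starting from `(dα)_0 = 0`;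
`extD_apply_succ` is the usual formula. -/
def extFun : (n : ℕ) → Form A L → (Fin n → L) → A
  | 0, _, _ => 0
  | n + 1, α, v => lieD (v 0) α n (fun i => v i.succ) -
      extFun n (contract (v 0) α) (fun i => v i.succ)

theorem extFun_add (n : ℕ) (α β : Form A L) (v : Fin n → L) :
    extFun n (α + β) v = extFun n α v + extFun n β v := by
  induction n generalizing α β with
  | zero => simp [extFun]
  | succ n ih => simp only [extFun, map_add, ih, add_apply]; ring

theorem extFun_smul (n : ℕ) (a : A) (α : Form A L) (v : Fin n → L) :
    extFun n (a • α) v = a * extFun n α v + (dFun a * α : Form A L) n v := by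
  induction n generalizing α with
  | zero =>
    have h0 : (dFun a : Form A L) 0 ![] = 0 := rfl
    simp [extFun, mul_apply, wedgeFun, h0]
  | succ n ih =>
    have e : ∀ β : Form A L, β (n + 1) v = contract (v 0) β n (fun i => v i.succ) := fun β =>
      congrArg (β (n + 1)) (Matrix.cons_head_tail v).symm
    rw [e, contract_mul, contract_dFun, ofFun_mul, sgn_dFun]
    simp only [extFun, map_smul, ih, lieD_smul, add_apply, smul_apply, smul_eq_mul, neg_mul,
      neg_apply]
    ring

theorem extFun_zero (n : ℕ) (v : Fin n → L) : extFun n (0 : Form A L) v = 0 := by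
  have h0 := extFun_add n (0 : Form A L) 0 v
  rw [add_zero] at h0
  linear_combination -h0

theorem extFun_neg (n : ℕ) (α : Form A L) (v : Fin n → L) :
    extFun n (-α) v = -extFun n α v := by
  have h := extFun_add n α (-α) v
  rw [add_neg_cancel, extFun_zero] at h
  linear_combination -h

theorem lieD_add_left (x y : L) (α : Form A L) : lieD (x + y) α = lieD x α + lieD y α := by
  refine ext fun n v => ?_
  induction n generalizing α with
  | zero => simp [lieD_apply', lieFun]
  | succ n ih =>
    have h := ih (contract (v 0) α) (fun i => v i.succ)
    simp only [lieD_apply', lieFun, add_apply, add_lie, contract_add_left] at h ⊢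
    rw [h]; ring

theorem extFun_update_add (n : ℕ) (α : Form A L) (v : Fin n → L) (i : Fin n) (y z : L) :
    extFun n α (Function.update v i (y + z)) =
      extFun n α (Function.update v i y) + extFun n α (Function.update v i z) := by
  induction n generalizing α with
  | zero => exact i.elim0
  | succ n ih =>
    induction i using Fin.cases with
    | zero =>
      simp only [extFun, Function.update_self, lieD_add_left, contract_add_left, extFun_add,
        add_apply, Function.update_of_ne (Fin.succ_ne_zero _)]
      ring
    | succ i =>
      have h : ∀ w, (fun k : Fin n => Function.update v i.succ w k.succ) =
          Function.update (fun k => v k.succ) i w := fun w => by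
        funext k; simp [Function.update_apply]
      simp only [extFun, h, ih, Function.update_of_ne (Fin.succ_ne_zero _).symm,
        AlternatingMap.map_update_add]
      ring

theorem extFun_update_smul (n : ℕ) (α : Form A L) (v : Fin n → L) (i : Fin n) (a : A) (y : L) :
    extFun n α (Function.update v i (a • y)) = a * extFun n α (Function.update v i y) := by
  induction n generalizing α with
  | zero => exact i.elim0
  | succ n ih =>
    induction i using Fin.cases with
    | zero =>
      simp only [extFun, Function.update_self, lieD_smul_left, contract_smul_left, extFun_smul,
        add_apply, smul_apply, smul_eq_mul, Function.update_of_ne (Fin.succ_ne_zero _)]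
      ring
    | succ i =>
      have h : ∀ w, (fun k : Fin n => Function.update v i.succ w k.succ) =
          Function.update (fun k => v k.succ) i w := fun w => by
        funext k; simp [Function.update_apply]
      simp only [extFun, h, ih, Function.update_of_ne (Fin.succ_ne_zero _).symm,
        AlternatingMap.map_update_smul, smul_eq_mul]
      ring

theorem extFun_repeat (n : ℕ) (α : Form A L) (v : Fin n → L) (j : Fin n) :
    extFun n (contract (v j) α) v = lieD (v j) α n v := by
  induction n generalizing α with
  | zero => exact j.elim0
  | succ n ih =>
    have e : ∀ β : Form A L, β (n + 1) v = contract (v 0) β n (fun i => v i.succ) := fun β =>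
      congrArg (β (n + 1)) (Matrix.cons_head_tail v).symm
    induction j using Fin.cases with
    | zero =>
      rw [e, contract_lieD]
      simp [extFun, contract_self, extFun_zero, contract_zero_left]
    | succ j =>
      have h := ih (contract (v 0) α) (fun i => v i.succ) j
      have h2 := contract_repeat n (lieD (v 0) α) (fun i => v i.succ) j
      rw [contract_lieD] at h2
      rw [e, contract_lieD, ← lie_skew, sub_apply]
      simp only [extFun]
      rw [contract_comm (v 0) (v j.succ), extFun_neg, h]
      rw [sub_apply] at h2
      rw [contract_neg_left, neg_apply]
      linear_combination h2

theorem extFun_alternating (n : ℕ) (α : Form A L) (v : Fin n → L) (i j : Fin n)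
    (hv : v i = v j) (hij : i ≠ j) : extFun n α v = 0 := by
  induction n generalizing α with
  | zero => exact i.elim0
  | succ n ih =>
    induction i using Fin.cases with
    | zero =>
      obtain ⟨j, rfl⟩ := Fin.exists_succ_eq.2 hij.symm
      simp only [extFun, hv]
      exact sub_eq_zero.2 (extFun_repeat n α (fun k => v k.succ) j).symm
    | succ i =>
      induction j using Fin.cases with
      | zero =>
        simp only [extFun, ← hv]
        exact sub_eq_zero.2 (extFun_repeat n α (fun k => v k.succ) i).symm
      | succ j =>
        have hij' : i ≠ j := fun h => hij (by rw [h])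
        simp only [extFun, ih _ (fun k => v k.succ) i j hv hij',
          AlternatingMap.map_eq_zero_of_eq _ (fun k : Fin n => v k.succ) hv hij', sub_zero]

/-- The exterior derivative as an additive map. -/
def extDAux : Form A L →+ Form A L where
  toFun α := ⟨fun n =>
    { toFun := extFun n α
      map_update_add' := fun {inst} v i y z => by
        obtain rfl : inst = instDecidableEqFin n := Subsingleton.elim _ _
        exact extFun_update_add n α v i y z
      map_update_smul' := fun {inst} v i a y => by
        obtain rfl : inst = instDecidableEqFin n := Subsingleton.elim _ _
        exact extFun_update_smul n α v i a y
      map_eq_zero_of_eq' := extFun_alternating n α }⟩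
  map_zero' := ext fun n v => extFun_zero n v
  map_add' α β := ext fun n v => extFun_add n α β v

variable (K : Type*) [CommRing K] [Algebra K A] [LieAlgebra K L] [LieRinehartAlgebra K A L]

/-- The exterior derivative `d`; see `extD_apply_succ` for the formula of Koszul. -/
def extD : Form A L →ₗ[K] Form A L :=
  { extDAux with
    map_smul' := fun c α => ext fun n v => by
      have h : (dFun (algebraMap K A c) : Form A L) = 0 := by
        refine ext_contract rfl fun x => ?_
        have : ⁅x, algebraMap K A c⁆ = 0 := by
          exact (LieRinehartAlgebra.anchor K A L x).map_algebraMap c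
        rw [contract_dFun, this, map_zero, map_zero]
      have h2 := extFun_smul n (algebraMap K A c) α v
      rw [h, zero_mul, zero_apply, add_zero, ← algebraMap_smul', ← Algebra.smul_def] at h2
      exact h2 }

/-- The formula of Cartan, `ι_x d = L_x - d ι_x`. -/
theorem contract_extD (x : L) (α : Form A L) :
    contract x (extD K α) = lieD x α - extD K (contract x α) := rfl

theorem extD_apply_zero (α : Form A L) (v : Fin 0 → L) : extD K α 0 v = 0 := rfl

theorem extD_apply_one (α : Form A L) (x : L) : extD K α 1 ![x] = ⁅x, α 0 ![]⁆ :=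
  sub_zero _

/-- The formula of Koszul: `dα(v_0, …, v_n)` is the sum of `(-1)^j v_j(α(…))` over `j`, with `v_j`
left out in `α(…)`, and of `(-1)^j α(…, [v_i, v_j], …)` over `i < j`, where `v_j` is left out and the
bracket stands in the place of `v_i`. -/
theorem extD_apply_succ (α : Form A L) (n : ℕ) (v : Fin (n + 1) → L) :
    extD K α (n + 1) v = ∑ j : Fin (n + 1), (-1) ^ (j : ℕ) *
      (⁅v j, α n (j.removeNth v)⁆ + ∑ i : Fin n with i.castSucc < j,
        α n (Function.update (j.removeNth v) i ⁅v i.castSucc, v j⁆)) := by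
  simp only [Finset.sum_filter]
  induction n generalizing α with
  | zero =>
    have hv : v = ![v 0] := by funext i; rw [Fin.fin_one_eq_zero i]; rfl
    rw [hv, extD_apply_one]
    simp [Subsingleton.elim (Fin.removeNth 0 ![v 0]) ![]]
  | succ n ih =>
    have h1 : extD K α (n + 1 + 1) v = lieD (v 0) α (n + 1) (fun i => v i.succ) -
      extD K (contract (v 0) α) (n + 1) (fun i => v i.succ) := rfl
    have hr : ∀ j : Fin (n + 1), j.succ.removeNth v =
        Matrix.vecCons (v 0) (j.removeNth fun i => v i.succ) := fun j => by
      funext k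
      induction k using Fin.cases <;> simp [Fin.removeNth]
    have hu : ∀ (j : Fin (n + 1)) (w : L), α (n + 1) (Function.update (fun i => v i.succ) j w) =
        (-1) ^ (j : ℕ) * α (n + 1) (Matrix.vecCons w (j.removeNth fun i => v i.succ)) := by
      intro j w
      have := (α (n + 1)).map_insertNth j w (j.removeNth fun i => v i.succ)
      rw [Fin.insertNth_removeNth] at this
      rw [this]
      simp
    have h0 : ∀ (x y : L) (w : Fin n → L), Function.update (Matrix.vecCons x w) 0 y =
        Matrix.vecCons y w := fun x y w => by
      funext k
      induction k using Fin.cases <;> simp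
    have hs : ∀ (x y : L) (w : Fin n → L) (i : Fin n),
        Function.update (Matrix.vecCons x w) i.succ y =
        Matrix.vecCons x (Function.update w i y) := fun x y w i => by
      funext k
      induction k using Fin.cases <;>
        simp [Function.update_apply, (Fin.succ_ne_zero _).symm]
    have hT : ∀ j : Fin (n + 1), (-1) ^ (j.succ : ℕ) *
        (⁅v j.succ, α (n + 1) (j.succ.removeNth v)⁆ + ∑ i : Fin (n + 1),
          if i.castSucc < j.succ then
            α (n + 1) (Function.update (j.succ.removeNth v) i ⁅v i.castSucc, v j.succ⁆) else 0) =
        -α (n + 1) (Function.update (fun i => v i.succ) j ⁅v 0, v j.succ⁆) - (-1) ^ (j : ℕ) *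
          (⁅v j.succ, contract (v 0) α n (j.removeNth fun i => v i.succ)⁆ + ∑ i : Fin n,
            if i.castSucc < j then contract (v 0) α n (Function.update
              (j.removeNth fun i => v i.succ) i ⁅v i.castSucc.succ, v j.succ⁆) else 0) := by
      intro j
      rw [hu, hr, Fin.sum_univ_succ, h0]
      simp only [hs, contract_apply, Fin.val_succ, pow_succ, Fin.castSucc_zero, Fin.succ_pos,
        if_true, Fin.castSucc_succ, Fin.succ_lt_succ_iff]
      ring
    rw [h1, ih, lieD_apply, Fin.sum_univ_succ (n := n + 1), Finset.sum_congr rfl fun j _ => hT j,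
      Finset.sum_sub_distrib, Finset.sum_neg_distrib]
    have hz : (Fin.removeNth 0 v : Fin (n + 1) → L) = fun i => v i.succ := by
      funext k; simp [Fin.removeNth]
    simp only [hz, Fin.not_lt_zero, if_false, Finset.sum_const_zero, Fin.val_zero, pow_zero]
    ring

theorem extD_sgn (α : Form A L) : extD K (sgn α) = -sgn (extD K α) := by
  have key : ∀ (n : ℕ) (α : Form A L) (v : Fin n → L),
      extFun n (sgn α) v = -((-1) ^ n * extFun n α v) := by
    intro n
    induction n with
    | zero => intro α v; simp [extFun]
    | succ n ih =>
      intro α v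
      have h : lieD (v 0) (sgn α) n (fun i => v i.succ) =
          (-1) ^ n * lieD (v 0) α n (fun i => v i.succ) := by
        rw [lieD_apply, lieD_apply]
        rcases neg_one_pow_eq_or A n with h | h <;> simp [h] <;> ring
      simp only [extFun, contract_sgn, extFun_neg, ih, h, pow_succ]
      ring
  exact ext (key · α)

end Lie
end Form

/-! ### Smooth functions and vector fields on a manifold -/

section VectorFields

variable {n : ℕ} {H : Type*} [TopologicalSpace H]
  (I : ModelWithCorners ℝ (EuclideanSpace ℝ (Fin n)) H)
  (W : Type*) [TopologicalSpace W] [ChartedSpace H W]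

/-- The ring `C^∞(W)` of smooth real functions. -/
abbrev Fn := C^∞⟮I, W; 𝓘(ℝ, ℝ), ℝ⟯

/-- The smooth vector fields on `W`. -/
abbrev VField [IsManifold I ∞ W] :=
  Cₛ^∞⟮I; EuclideanSpace ℝ (Fin n), (TangentSpace I : W → Type _)⟯

variable {I W} [IsManifold I ∞ W]

instance : IsManifold I (minSmoothness ℝ 3) W := by
  rw [minSmoothness_of_isRCLikeNormedField]; infer_instance

theorem two_le : minSmoothness ℝ 2 ≤ (∞ : WithTop ℕ∞) := by
  rw [minSmoothness_of_isRCLikeNormedField]; exact ENat.LEInfty.out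

namespace VField

instance : SMul (Fn I W) (VField I W) :=
  ⟨fun φ X => ⟨fun x => φ x • X x, φ.contMDiff.smul_section X.contMDiff⟩⟩

@[simp] theorem smul_apply (φ : Fn I W) (X : VField I W) (x : W) : (φ • X) x = φ x • X x := rfl

instance : Module (Fn I W) (VField I W) where
  one_smul X := ContMDiffSection.ext fun x => one_smul ℝ (X x)
  mul_smul φ ψ X := ContMDiffSection.ext fun x => mul_smul (φ x) (ψ x) (X x)
  smul_zero φ := ContMDiffSection.ext fun x => smul_zero (φ x)
  smul_add φ X Y := ContMDiffSection.ext fun x => smul_add (φ x) (X x) (Y x)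
  add_smul φ ψ X := ContMDiffSection.ext fun x => add_smul (φ x) (ψ x) (X x)
  zero_smul X := ContMDiffSection.ext fun x => zero_smul ℝ (X x)

theorem contMDiff_mlieBracket (X Y : VField I W) :
    ContMDiff I I.tangent ∞
      (fun x => (⟨x, VectorField.mlieBracket I X Y x⟩ : TangentBundle I W)) :=
  haveI : IsManifold I ((⊤ : ℕ∞) + 1) W := by
    exact inferInstanceAs (IsManifold I ∞ W)
  ContDiff.mlieBracket_vectorField (n := ⊤) (m := ⊤) X.contMDiff Y.contMDiff
    (by rw [minSmoothness_of_isRCLikeNormedField]; exact le_rfl)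

instance : Bracket (VField I W) (VField I W) :=
  ⟨fun X Y => ⟨VectorField.mlieBracket I X Y, contMDiff_mlieBracket X Y⟩⟩

theorem lie_apply (X Y : VField I W) (x : W) : ⁅X, Y⁆ x = VectorField.mlieBracket I X Y x := rfl

theorem coe_lie (X Y : VField I W) : (⇑⁅X, Y⁆ : ∀ x, TangentSpace I x) =
    VectorField.mlieBracket I X Y := rfl

instance : LieRing (VField I W) where
  add_lie X Y Z := ContMDiffSection.ext fun x =>
    VectorField.mlieBracket_add_left X.mdifferentiableAt Y.mdifferentiableAt
  lie_add X Y Z := ContMDiffSection.ext fun x =>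
    VectorField.mlieBracket_add_right Y.mdifferentiableAt Z.mdifferentiableAt
  lie_self X := ContMDiffSection.ext fun x => by
    rw [lie_apply, VectorField.mlieBracket_self]; rfl
  leibniz_lie X Y Z := ContMDiffSection.ext fun x =>
    VectorField.leibniz_identity_mlieBracket_apply
      (X.contMDiff.contMDiffAt.of_le two_le) (Y.contMDiff.contMDiffAt.of_le two_le)
      (Z.contMDiff.contMDiffAt.of_le two_le)

instance : LieAlgebra ℝ (VField I W) where
  lie_smul _ _ Y := ContMDiffSection.ext fun _ =>
    VectorField.mlieBracket_const_smul_right Y.mdifferentiableAt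

theorem contMDiff_mvfderiv (X : VField I W) (φ : Fn I W) :
    ContMDiff I 𝓘(ℝ, ℝ) ∞ (fun x => mvfderiv I φ x (X x)) :=
  (contMDiff_snd_tangentBundle_modelSpace ℝ 𝓘(ℝ, ℝ)).comp
    ((φ.contMDiff.contMDiff_tangentMap (m := ∞) le_rfl).comp X.contMDiff)

instance : Bracket (VField I W) (Fn I W) :=
  ⟨fun X φ => ⟨fun x => mvfderiv I φ x (X x), contMDiff_mvfderiv X φ⟩⟩

theorem lie_fn_apply (X : VField I W) (φ : Fn I W) (x : W) : ⁅X, φ⁆ x = mvfderiv I φ x (X x) := rfl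

theorem mdiffAt (φ : Fn I W) (x : W) : MDifferentiableAt I 𝓘(ℝ, ℝ) φ x :=
  φ.contMDiff.mdifferentiable (by simp) x

theorem lie_fn_smul (X Y : VField I W) (φ : Fn I W) :
    ⁅X, φ • Y⁆ = φ • ⁅X, Y⁆ + ⁅X, φ⁆ • Y := 
  ContMDiffSection.ext fun x => by
    have := VectorField.mlieBracket_smul_right (V := X) (mdiffAt φ x) (Y.mdifferentiableAt (x := x))
    rw [add_comm] at this
    exact this

theorem lie_fn_add (X : VField I W) (φ ψ : Fn I W) : ⁅X, φ + ψ⁆ = ⁅X, φ⁆ + ⁅X, ψ⁆ :=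
  ContMDiffMap.ext fun x => by
    have := mvfderiv_add (mdiffAt φ x) (mdiffAt ψ x)
    exact congrArg (fun A => A (X x)) this

/-- Brackets of vector fields act on functions by commutators. -/
theorem lie_fn_commutator (X Y : VField I W) (φ : Fn I W) :
    ⁅X, ⁅Y, φ⁆⁆ = ⁅⁅X, Y⁆, φ⁆ + ⁅Y, ⁅X, φ⁆⁆ := by
  have key : ∀ Z : VField I W, ⁅X, ⁅Y, φ⁆⁆ • Z = (⁅⁅X, Y⁆, φ⁆ + ⁅Y, ⁅X, φ⁆⁆) • Z := by
    intro Z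
    have h := leibniz_lie X Y (φ • Z)
    simp only [lie_fn_smul, lie_add] at h
    rw [leibniz_lie X Y Z, smul_add] at h
    rw [add_smul]
    have h' : (⁅X, ⁅Y, φ⁆⁆ • Z + φ • ⁅⁅X, Y⁆, Z⁆ + φ • ⁅Y, ⁅X, Z⁆⁆ + ⁅X, φ⁆ • ⁅Y, Z⁆ +
        ⁅Y, φ⁆ • ⁅X, Z⁆) = ⁅⁅X, Y⁆, φ⁆ • Z + ⁅Y, ⁅X, φ⁆⁆ • Z + φ • ⁅⁅X, Y⁆, Z⁆ +
        φ • ⁅Y, ⁅X, Z⁆⁆ + ⁅X, φ⁆ • ⁅Y, Z⁆ + ⁅Y, φ⁆ • ⁅X, Z⁆ := by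
      refine Eq.trans ?_ (h.trans ?_) <;> abel
    simpa only [add_left_inj] using h'
  refine ContMDiffMap.ext fun x => ?_
  by_cases hX : X x = 0
  · by_cases hY : Y x = 0
    · have hXY : ⁅X, Y⁆ x = 0 := by
        have := VectorField.mlieBracketWithin_eq_zero_of_eq_zero (I := I) (s := Set.univ) hX hY
        rwa [VectorField.mlieBracketWithin_univ] at this
      change mvfderiv I (⁅Y, φ⁆ : Fn I W) x (X x) =
        mvfderiv I φ x (⁅X, Y⁆ x) + mvfderiv I (⁅X, φ⁆ : Fn I W) x (Y x)
      rw [hX, hY, hXY, map_zero, map_zero, map_zero, add_zero]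
    · exact smul_left_injective ℝ hY (congrArg (fun Z : VField I W => Z x) (key Y))
  · exact smul_left_injective ℝ hX (congrArg (fun Z : VField I W => Z x) (key X))

instance : LieRingModule (VField I W) (Fn I W) where
  add_lie X Y φ := ContMDiffMap.ext fun x => map_add (mvfderiv I φ x) (X x) (Y x)
  lie_add := lie_fn_add
  leibniz_lie := lie_fn_commutator

instance : LieRinehartRing (Fn I W) (VField I W) where
  lie_smul_eq_mul' φ ψ X := ContMDiffMap.ext fun x => map_smul (mvfderiv I ψ x) (φ x) (X x)
  leibniz_mul_right' X φ ψ := ContMDiffMap.ext fun x => by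
    have := congrArg (fun A => A (X x)) (mvfderiv_mul (mdiffAt φ x) (mdiffAt ψ x))
    refine Eq.trans this ?_
    change φ x * _ + ψ x * _ = φ x * _ + _ * ψ x
    rw [mul_comm (ψ x)]; rfl
  leibniz_smul_right' X Y φ := lie_fn_smul X Y φ

theorem lie_fn_const_smul (X : VField I W) (c : ℝ) (φ : Fn I W) : ⁅X, c • φ⁆ = c • ⁅X, φ⁆ :=
  ContMDiffMap.ext fun x => by
    have h := congrArg (fun A => A (X x))
      (mvfderiv_mul (mdiffAt (algebraMap ℝ (Fn I W) c) x) (mdiffAt φ x))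
    have h2 : mvfderiv I (algebraMap ℝ (Fn I W) c) x = 0 := mvfderiv_const c
    rw [h2, smul_zero, add_zero] at h
    exact h

instance : LieRinehartAlgebra ℝ (Fn I W) (VField I W) where
  smul_assoc c φ X := ContMDiffSection.ext fun x => smul_assoc c (φ x) (X x)
  smul_lie c X φ := ContMDiffMap.ext fun x => map_smul (mvfderiv I φ x) c (X x)
  lie_smul c X φ := lie_fn_const_smul X c φ

end VField
end VectorFields

/-! ### Smooth actions of a Lie group -/

section Equivariant

variable {d n : ℕ} {H : Type*} [TopologicalSpace H]
  (I : ModelWithCorners ℝ (EuclideanSpace ℝ (Fin n)) H)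
  (G : Type*) [Group G] [TopologicalSpace G] [ChartedSpace (EuclideanSpace ℝ (Fin d)) G]
  [LieGroup (𝓡 d) ∞ G]
  (W : Type*) [TopologicalSpace W] [ChartedSpace H W] [IsManifold I ∞ W]
  [MulAction G W] [ContMDiffSMul (𝓡 d) I ∞ G W]

instance : LieGroup (𝓡 d) (minSmoothness ℝ 3) G := by
  rw [minSmoothness_of_isRCLikeNormedField]; infer_instance

variable {G}

/-- The adjoint representation of `G` on its Lie algebra `g = T_1 G`. -/
def Ad (g : G) : GroupLieAlgebra (𝓡 d) G →ₗ[ℝ] GroupLieAlgebra (𝓡 d) G where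
  toFun ξ := mfderiv (𝓡 d) (𝓡 d) (fun h : G => g * h * g⁻¹) 1 ξ
  map_add' ξ η := map_add (mfderiv (𝓡 d) (𝓡 d) (fun h : G => g * h * g⁻¹) 1) ξ η
  map_smul' c ξ := map_smul (mfderiv (𝓡 d) (𝓡 d) (fun h : G => g * h * g⁻¹) 1) c ξ

variable {W}

/-- The value at `x` of the fundamental vector field of `ξ`, which is the derivative at `t = 0` of
`exp(-tξ) • x`. With this sign `ξ ↦ X_ξ` is a homomorphism of Lie algebras, for the bracket of
left-invariant vector fields on `g`. Its kernel is the Lie algebra of the stabilizer of `x`. -/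
def infAction (x : W) : GroupLieAlgebra (𝓡 d) G →ₗ[ℝ] TangentSpace I x where
  toFun ξ := -(mfderiv (𝓡 d) I (fun g : G => g • x) 1 ξ)
  map_add' ξ η := by
    rw [map_add]; exact neg_add _ _
  map_smul' c ξ := by
    rw [map_smul]; exact (smul_neg c _).symm

theorem contMDiff_infAction (ξ : GroupLieAlgebra (𝓡 d) G) :
    ContMDiff I I.tangent ∞ (fun x : W => (⟨x, infAction I x ξ⟩ : TangentBundle I W)) := by
  have hs : ContMDiff ((𝓡 d).prod I) I ∞ (fun p : G × W => p.1 • p.2) := contMDiff_smul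
  let F₁ : W → TangentBundle (𝓡 d) G × TangentBundle I W := fun x =>
    (⟨1, -ξ⟩, ⟨x, 0⟩)
  have S₁ : ContMDiff I ((𝓡 d).tangent.prod I.tangent) ∞ F₁ :=
    contMDiff_const.prodMk (Bundle.contMDiff_zeroSection ℝ (TangentSpace I : W → Type _))
  have S₂ := (contMDiff_equivTangentBundleProd_symm (I := 𝓡 d) (M := G) (I' := I) (M' := W)
    (n := ∞)).comp S₁
  have S₃ := (hs.contMDiff_tangentMap (m := ∞) le_rfl).comp S₂
  convert! S₃ with x
  · simp [F₁]
  · simp only [Function.comp_apply, tangentMap, F₁]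
    rw [mfderiv_prod_eq_add_apply (hs.mdifferentiableAt (by simp))]
    have h : -(mfderiv (𝓡 d) I (fun g : G => g • x) 1 ξ) =
        mfderiv (𝓡 d) I (fun g : G => g • x) 1 (-ξ) +
          mfderiv I I (fun z : W => (1 : G) • z) x 0 := by
      rw [map_neg, map_zero]
      exact (add_zero _).symm
    exact h

/-- The fundamental vector field of `ξ`. -/
def fundField (ξ : GroupLieAlgebra (𝓡 d) G) : VField I W :=
  ⟨fun x => infAction I x ξ, contMDiff_infAction I ξ⟩

theorem isInvertible_mfderiv_smul (g : G) (x : W) :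
    (mfderiv I I (Diffeomorph.smul (𝓡 d) I (M := W) ∞ g) x).IsInvertible :=
  ⟨(Diffeomorph.smul (𝓡 d) I (M := W) ∞ g).mfderivToContinuousLinearEquiv (by simp) x, rfl⟩

variable (d) in
/-- Pullback of a vector field under the diffeomorphism `x ↦ g • x`. -/
def pullField (g : G) (X : VField I W) : VField I W :=
  ⟨VectorField.mpullback I I (fun y : W => g • y) X,
    ContMDiff.mpullback_vectorField (n := ∞) X.contMDiff
     (ContMDiffSMul.contMDiff_const_smul (I := 𝓡 d) g)
     (isInvertible_mfderiv_smul (d := d) I g) le_rfl⟩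

variable (d) in
/-- Pullback of a function under `x ↦ g • x`. -/
def pullFn (g : G) (φ : Fn I W) : Fn I W :=
  ⟨fun x => φ (g • x), φ.contMDiff.comp (ContMDiffSMul.contMDiff_const_smul (I := 𝓡 d) g)⟩

theorem pullField_add (g : G) (X Y : VField I W) :
    pullField d I g (X + Y) = pullField d I g X + pullField d I g Y :=
  ContMDiffSection.ext fun x => map_add (mfderiv I I (fun y : W => g • y) x).inverse _ _

theorem pullField_smul (g : G) (φ : Fn I W) (X : VField I W) :
    pullField d I g (φ • X) = pullFn d I g φ • pullField d I g X :=
  ContMDiffSection.ext fun x => map_smul (mfderiv I I (fun y : W => g • y) x).inverse _ _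

theorem pullFn_inv_pullFn (g : G) (φ : Fn I W) : pullFn d I g⁻¹ (pullFn d I g φ) = φ :=
  ContMDiffMap.ext fun x => congrArg φ (smul_inv_smul g x)

variable (d W) in
/-- The action of `g` on differential forms, `g • α = (g⁻¹)^* α`. -/
def formAction (g : G) : Form (Fn I W) (VField I W) →ₗ[ℝ] Form (Fn I W) (VField I W) where
  toFun α := ⟨fun k =>
    { toFun := fun v => pullFn d I g⁻¹ (α k fun i => pullField d I g (v i))
      map_update_add' := fun v i X Y => by
        have h : ∀ Z, (fun j => pullField d I g (Function.update v i Z j)) =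
            Function.update (fun j => pullField d I g (v j)) i (pullField d I g Z) := fun Z => by
          funext j; simp only [Function.update_apply]; split_ifs <;> rfl
        rw [h, h, h, pullField_add, (α k).map_update_add]
        rfl
      map_update_smul' := fun v i φ X => by
        have h : ∀ Z, (fun j => pullField d I g (Function.update v i Z j)) =
            Function.update (fun j => pullField d I g (v j)) i (pullField d I g Z) := fun Z => by
          funext j; simp only [Function.update_apply]; split_ifs <;> rfl
        rw [h, h, pullField_smul, (α k).map_update_smul]
        conv_rhs => rw [← pullFn_inv_pullFn (d := d) I g φ]
        rfl
      map_eq_zero_of_eq' := fun v i j hv hij => by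
        rw [(α k).map_eq_zero_of_eq _ (congrArg (pullField d I g) hv) hij]
        rfl }⟩
  map_add' α β := rfl
  map_smul' c α := rfl

variable (d G W)

/-! ### The Cartan model of equivariant cohomology -/

/-- The algebra `S(g*)` of polynomials on the Lie algebra `g` of `G`. -/
def SymDual := SymmetricAlgebra ℝ (Module.Dual ℝ (GroupLieAlgebra (𝓡 d) G))

instance : CommRing (SymDual d G) :=
  inferInstanceAs (CommRing (SymmetricAlgebra ℝ (Module.Dual ℝ (GroupLieAlgebra (𝓡 d) G))))

instance : Algebra ℝ (SymDual d G) :=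
  inferInstanceAs (Algebra ℝ (SymmetricAlgebra ℝ (Module.Dual ℝ (GroupLieAlgebra (𝓡 d) G))))

/-- The inclusion `g* → S(g*)`. -/
def SymDual.gen : Module.Dual ℝ (GroupLieAlgebra (𝓡 d) G) →ₗ[ℝ] SymDual d G :=
  SymmetricAlgebra.ι ℝ _

variable {d G}

/-- The extension of a linear map from `g*` to a commutative algebra to an algebra homomorphism from
`S(g*)`. -/
def SymDual.lift {R : Type*} [CommRing R] [Algebra ℝ R]
    (φ : Module.Dual ℝ (GroupLieAlgebra (𝓡 d) G) →ₗ[ℝ] R) : SymDual d G →ₐ[ℝ] R :=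
  SymmetricAlgebra.lift φ

@[simp] theorem SymDual.lift_gen {R : Type*} [CommRing R] [Algebra ℝ R]
    (φ : Module.Dual ℝ (GroupLieAlgebra (𝓡 d) G) →ₗ[ℝ] R)
    (l : Module.Dual ℝ (GroupLieAlgebra (𝓡 d) G)) : SymDual.lift φ (SymDual.gen d G l) = φ l :=
  SymmetricAlgebra.lift_ι_apply _ l

variable (d G)

/-- The algebra `Ω(W)` of smooth differential forms on `W`. -/
def DiffForm (I : ModelWithCorners ℝ (EuclideanSpace ℝ (Fin n)) H) (W : Type*)
    [TopologicalSpace W] [ChartedSpace H W] [IsManifold I ∞ W] := Form (Fn I W) (VField I W)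

instance : Ring (DiffForm I W) := inferInstanceAs (Ring (Form (Fn I W) (VField I W)))

instance : Algebra ℝ (DiffForm I W) := inferInstanceAs (Algebra ℝ (Form (Fn I W) (VField I W)))

/-- The algebra `S(g*) ⊗ Ω(W)`. -/
abbrev SymForms := SymDual d G ⊗[ℝ] DiffForm I W

variable {d G}

/-- The element `s ⊗ α` of `S(g*) ⊗ Ω(W)`. -/
abbrev elem (s : SymDual d G) (α : DiffForm I W) : SymForms d I G W := s ⊗ₜ[ℝ] α

/-- The coadjoint action of `g` on `S(g*)`, which is `l ↦ l ∘ Ad g⁻¹` on `g*`. -/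
def coAd (g : G) : SymDual d G →ₐ[ℝ] SymDual d G :=
  SymDual.lift (SymDual.gen d G ∘ₗ (Ad g⁻¹).dualMap)

/-- The action of `g` on `S(g*) ⊗ Ω(W)`. -/
def symFormsAction (g : G) : SymForms d I G W →ₗ[ℝ] SymForms d I G W :=
  TensorProduct.map (coAd g).toLinearMap (formAction d I W g)

variable (d G)

/-- The algebra `S(g*)^G` of invariant polynomials. -/
def invPoly : Subalgebra ℝ (SymDual d G) :=
  ⨅ g : G, AlgHom.equalizer (coAd g) (AlgHom.id ℝ _)

/-- The equivariant differential forms `Ω_G(W) = (S(g*) ⊗ Ω(W))^G`. -/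
def equivForms : Submodule ℝ (SymForms d I G W) :=
  ⨅ g : G, LinearMap.eqLocus (symFormsAction I W g) LinearMap.id

variable {d G} {ι : Type*} [Fintype ι] (b : Module.Basis ι ℝ (GroupLieAlgebra (𝓡 d) G))

/-- The generators `Θ^a` of `S(g*)`, which form the basis of `g*` dual to the basis `b` of `g`. -/
def theta (a : ι) : SymDual d G := SymDual.gen d G (b.coord a)

/-- The Cartan differential `D = 1 ⊗ d - ∑_a Θ^a ⊗ ι_a`, where `ι_a` is the contraction with the
fundamental vector field of `b a`. -/
def cartanD : SymForms d I G W →ₗ[ℝ] SymForms d I G W :=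
  TensorProduct.map LinearMap.id (Form.extD ℝ) -
    ∑ a, TensorProduct.map (LinearMap.mulLeft ℝ (theta b a))
      ((Form.contract (fundField I (b a))).restrictScalars ℝ)

/-- The `D`-closed equivariant forms. -/
def cocycles : Submodule ℝ (SymForms d I G W) :=
  equivForms d I G W ⊓ LinearMap.ker (cartanD I W b)

/-- The forms `D β` with `β` equivariant. -/
def coboundaries : Submodule ℝ (SymForms d I G W) :=
  (equivForms d I G W).map (cartanD I W b)

/-- The equivariant cohomology `H_G(W)`, the cohomology of the complex `(Ω_G(W), D)`. -/
abbrev EquivCohomology := cocycles I W b ⧸ (coboundaries I W b).submoduleOf (cocycles I W b)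

/-- The map `S(g*)^G → H_G(W)` induced by a map `Φ : S(g*) → S(g*) ⊗ Ω(W)` that sends invariant
polynomials to closed equivariant forms. -/
def inducedMap (Φ : SymDual d G →ₐ[ℝ] SymForms d I G W)
    (hΦ : ∀ F ∈ invPoly d G, Φ F ∈ cocycles I W b) : invPoly d G →ₗ[ℝ] EquivCohomology I W b :=
  Submodule.mkQ _ ∘ₗ Φ.toLinearMap.restrict (p := Subalgebra.toSubmodule (invPoly d G)) hΦ

/-- The map `S(g*) → S(g*) ⊗ Ω(W)`, `F ↦ F ⊗ 1`. -/
def inclC : SymDual d G →ₐ[ℝ] SymForms d I G W := Algebra.TensorProduct.includeLeft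

/-! ### Degenerate principal bundles and the degenerate Chern-Weil map -/

variable (d G)

/-- The set `W^s` of the points whose stabilizer has positive dimension, that is, whose stabilizer
has a non-zero Lie algebra. -/
def singularSet : Set W :=
  {x | 0 < Module.finrank ℝ (LinearMap.ker (infAction (d := d) (G := G) I x))}

/-- The action of `G` on `W` is locally free on an open set that contains the boundary. -/
def IsDegeneratePrincipalBundle : Prop :=
  ∃ U : Set W, IsOpen U ∧ I.boundary W ⊆ U ∧ ∀ x ∈ U, x ∉ singularSet d I G W

/-- The `G`-invariant smooth functions `W → [0, 1]` that vanish on a neighbourhood of `W^s`. -/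
structure CutOff where
  /-- The underlying smooth function. -/
  toFn : Fn I W
  mem_Icc : ∀ x, toFn x ∈ Set.Icc (0 : ℝ) 1
  invariant : ∀ (g : G) (x : W), toFn (g • x) = toFn x
  vanish : ∃ U : Set W, IsOpen U ∧ singularSet d I G W ⊆ U ∧ ∀ x ∈ U, toFn x = 0

/-- The connections on the open subset `W \ W^s`, on which the action is locally free: the smooth
equivariant `g`-valued one-forms `ω` with `ω(X_ξ) = ξ`. Only the values of `form` at the points
outside `W^s` matter, and nothing is required of the others. -/
structure Connection where
  /-- The underlying pointwise one-form. -/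
  form : ∀ x : W, TangentSpace I x →ₗ[ℝ] GroupLieAlgebra (𝓡 d) G
  smooth : ∀ x ∉ singularSet d I G W, ∀ (X : VField I W)
    (l : Module.Dual ℝ (GroupLieAlgebra (𝓡 d) G)),
      ContMDiffAt I 𝓘(ℝ, ℝ) ∞ (fun y => l (form y (X y))) x
  equivariant : ∀ x ∉ singularSet d I G W, ∀ (g : G) (v : TangentSpace I x),
    form (g • x) (mfderiv I I (fun y : W => g • y) x v) = Ad g (form x v)
  vertical : ∀ x ∉ singularSet d I G W, ∀ ξ : GroupLieAlgebra (𝓡 d) G,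
    form x (infAction I x ξ) = ξ

variable {d I G W}

/-- The component `l(ω_f)` of `ω_f = f ω`, for `l` in `g*`, as a functional on the vector fields.
It is smooth on all of `W`, as `f` vanishes near `W^s`. -/
def cutOffForm (f : CutOff d I G W) (η : Connection d I G W)
    (l : Module.Dual ℝ (GroupLieAlgebra (𝓡 d) G)) : VField I W →ₗ[Fn I W] Fn I W where
  toFun X := ⟨fun x => f.toFn x * l (η.form x (X x)), fun x => by
    by_cases hx : x ∈ singularSet d I G W
    · obtain ⟨U, hU, hs, hf⟩ := f.vanish
      refine (contMDiffAt_const (c := (0 : ℝ))).congr_of_eventuallyEq ?_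
      filter_upwards [hU.mem_nhds (hs hx)] with y hy
      rw [hf y hy, zero_mul]
    · exact f.toFn.contMDiff.contMDiffAt.mul (η.smooth x hx X l)⟩
  map_add' X Y := ContMDiffMap.ext fun x => by
    change f.toFn x * l (η.form x (X x + Y x)) = _
    rw [map_add, map_add, mul_add]; rfl
  map_smul' φ X := ContMDiffMap.ext fun x => by
    change f.toFn x * l (η.form x (φ x • X x)) = _
    rw [map_smul, map_smul, smul_eq_mul, mul_left_comm]; rfl

variable (f : CutOff d I G W) (η : Connection d I G W)

/-- The components `ω_f^a` of `ω_f = f ω` in the basis `b`. -/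
def degConnection (a : ι) : Form (Fn I W) (VField I W) :=
  Form.ofOne (cutOffForm f η (b.coord a))

/-- The components of `dω_f + ½ [ω_f, ω_f]`, where
`[ω_f, ω_f] = ∑_{p,q} [b p, b q] ω_f^p ∧ ω_f^q`. -/
def degCurvatureForm (a : ι) : Form (Fn I W) (VField I W) :=
  Form.extD ℝ (degConnection b f η a) + (1 / 2 : ℝ) • ∑ p, ∑ q, b.repr ⁅b p, b q⁆ a •
    (degConnection b f η p * degConnection b f η q)

/-- The components of `Ω_f^G = dω_f + ½ [ω_f, ω_f] - (-1 + f) ∑_a ξ_a Θ^a`. -/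
def degCurvature (a : ι) : SymForms d I G W :=
  elem I W 1 (degCurvatureForm b f η a) - elem I W (theta b a) (Form.ofFun (-1 + f.toFn))

theorem degCurvatureForm_even (a : ι) :
    Form.sgn (degCurvatureForm b f η a) = degCurvatureForm b f η a := by
  have h : ∀ (c : ℝ) (α : Form (Fn I W) (VField I W)), Form.sgn (c • α) = c • Form.sgn α :=
    fun c α => map_smul (Form.sgn.restrictScalars ℝ) c α
  have h1 := Form.extD_sgn ℝ (degConnection b f η a)
  simp only [degCurvatureForm, degConnection, map_add, map_sum, h, Form.sgn_mul, Form.sgn_ofOne,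
    neg_mul_neg, map_neg, neg_inj] at h1 ⊢
  rw [← h1]

theorem degCurvature_mem_center (a : ι) :
    degCurvature b f η a ∈ Subalgebra.center ℝ (SymForms d I G W) := by
  have key : ∀ (s : SymDual d G) (α : DiffForm I W),
      Form.sgn (A := Fn I W) (L := VField I W) α = α →
      s ⊗ₜ[ℝ] α ∈ Subalgebra.center ℝ (SymForms d I G W) := by
    intro s α hα
    rw [Subalgebra.mem_center_iff]
    intro t
    induction t with
    | zero => rw [zero_mul, mul_zero]
    | add x y hx hy => rw [add_mul, mul_add, hx, hy]
    | tmul s' β =>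
      have h : α * β = β * α := Form.commute_of_even (A := Fn I W) (L := VField I W) hα β
      rw [Algebra.TensorProduct.tmul_mul_tmul, Algebra.TensorProduct.tmul_mul_tmul, mul_comm s, h]
  exact sub_mem (key _ _ (degCurvatureForm_even b f η a)) (key _ _ (Form.sgn_ofFun _))

/-- The degenerate Chern-Weil map `CW_f : F ↦ F(Ω_f^G)`, that is, the algebra homomorphism with
`Θ^a ↦ (Ω_f^G)^a`. These elements have even degree, so they are central, and the substitution makes
sense; see `chernWeil_theta`. -/
def chernWeil : SymDual d G →ₐ[ℝ] SymForms d I G W :=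
  (Subalgebra.center ℝ (SymForms d I G W)).val.comp <| SymDual.lift
    (∑ a, ((LinearMap.applyₗ (b a)).smulRight
      (⟨degCurvature b f η a, degCurvature_mem_center b f η a⟩ :
        Subalgebra.center ℝ (SymForms d I G W)) :
          Module.Dual ℝ (GroupLieAlgebra (𝓡 d) G) →ₗ[ℝ] _))

theorem chernWeil_theta (a : ι) : chernWeil b f η (theta b a) = degCurvature b f η a := by
  classical
  simp [chernWeil, theta, Finsupp.single_apply]

end Equivariant
end
end DegCW

/-!
The path `t ↦ Θ + t DA + ½ t² [A, A]`, where `A = ω_f`, joins the generators `Θ` to the curvature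
`Ω_f^G`, so that substituting it in an invariant polynomial `F` joins `i^c(F)` to `CW_f(F)`. The
Bianchi identity makes the substituted path `D`-closed, and its derivative in `t` is `D` of the
transgression, the polarization of `F` with one argument equal to `A`. Integrating over `[0, 1]`
exhibits `CW_f(F) - i^c(F)` as `D` of an invariant form. The geometry enters through `D²A`: by
Cartan's formula `D²` is `-∑_p Θ^p` times the Lie derivative along the fundamental field of `ξ_p`,
and equivariance of `ω` turns this Lie derivative into the coadjoint action on the components of
`A`.
-/

namespace DegCW

noncomputable section

/-! ### Polynomial paths and derivations of symmetric algebras -/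

section CoefficientwiseMaps

open Polynomial

variable {K R : Type*} [Field K] [Ring R] [Algebra K R]

/-- The coefficientwise extension to `R[X]` of a linear endomorphism of `R`: polynomials stand for
polynomial paths in `R`, and operators on `R` act on them pointwise. -/
def mapCoeff (T : R →ₗ[K] R) : R[X] →ₗ[K] R[X] :=
  Polynomial.lsum fun n => (monomial n).restrictScalars K ∘ₗ T

@[simp] theorem mapCoeff_monomial (T : R →ₗ[K] R) (n : ℕ) (r : R) :
    mapCoeff T (monomial n r) = monomial n (T r) := by
  simp [mapCoeff, Polynomial.lsum_apply, sum_monomial_index]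

@[simp] theorem coeff_mapCoeff (T : R →ₗ[K] R) (p : R[X]) (n : ℕ) :
    (mapCoeff T p).coeff n = T (p.coeff n) := by
  induction p using Polynomial.induction_on' with
  | add p q hp hq => simp only [map_add, coeff_add, hp, hq]
  | monomial k r =>
    rw [mapCoeff_monomial, coeff_monomial, coeff_monomial]
    split_ifs <;> simp

@[simp] theorem mapCoeff_C (T : R →ₗ[K] R) (r : R) : mapCoeff T (C r) = C (T r) :=
  mapCoeff_monomial T 0 r

theorem mapCoeff_toLinearMap (σ : R →ₐ[K] R) (p : R[X]) :
    mapCoeff σ.toLinearMap p = mapAlgHom σ p := by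
  ext n
  simp

theorem mapCoeff_mul {T : R →ₗ[K] R} {σ : R →ₐ[K] R}
    (hT : ∀ x y, T (x * y) = T x * y + σ x * T y) (p q : R[X]) :
    mapCoeff T (p * q) = mapCoeff T p * q + mapAlgHom σ p * mapCoeff T q := by
  ext n
  simp [coeff_mul, hT, Finset.sum_add_distrib]

/-- The value at the time `t` of a polynomial path. -/
def evalAt (t : K) : R[X] →ₐ[K] R :=
  eval₂AlgHom (AlgHom.id K R) (algebraMap K R t) fun r => Algebra.commute_algebraMap_right t r

@[simp] theorem evalAt_monomial (t : K) (n : ℕ) (r : R) : evalAt t (monomial n r) = t ^ n • r :=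
  (eval₂_monomial _ _).trans (by
    rw [← map_pow, Algebra.smul_def, Algebra.commutes]; rfl)

@[simp] theorem evalAt_C (t : K) (r : R) : evalAt t (C r) = r := by
  simpa using evalAt_monomial t 0 r

theorem evalAt_mapCoeff (t : K) (T : R →ₗ[K] R) (p : R[X]) :
    evalAt t (mapCoeff T p) = T (evalAt t p) := by
  induction p using Polynomial.induction_on' with
  | add p q hp hq => simp only [map_add, hp, hq]
  | monomial k r => simp

variable (K R) in
/-- The integral over `[0, 1]` of a polynomial path. -/
def unitIntegral : R[X] →ₗ[K] R :=
  Polynomial.lsum fun n => ((n : K) + 1)⁻¹ • LinearMap.id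

@[simp] theorem unitIntegral_monomial (n : ℕ) (r : R) :
    unitIntegral K R (monomial n r) = ((n : K) + 1)⁻¹ • r := by
  simp [unitIntegral, sum_monomial_index]

theorem unitIntegral_mapCoeff (T : R →ₗ[K] R) (p : R[X]) :
    unitIntegral K R (mapCoeff T p) = T (unitIntegral K R p) := by
  induction p using Polynomial.induction_on' with
  | add p q hp hq => simp only [map_add, hp, hq]
  | monomial k r => simp

theorem unitIntegral_derivative [CharZero K] (p : R[X]) :
    unitIntegral K R (derivative p) = evalAt (1 : K) p - evalAt (0 : K) p := by
  induction p using Polynomial.induction_on' with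
  | add p q hp hq => simp only [map_add, hp, hq]; abel
  | monomial k r =>
    cases k with
    | zero => simp
    | succ k =>
      have hk : (k : K) + 1 ≠ 0 := by exact_mod_cast k.succ_ne_zero
      have hsmul : r * (k + 1 : R) = ((k : K) + 1) • r := by
        rw [Algebra.smul_def, map_add, map_natCast, map_one]
        exact ((Nat.cast_commute k r).add_left (Commute.one_left r)).eq.symm
      simp [hsmul, smul_smul, hk]

end CoefficientwiseMaps

section DerivationsOfSymmetricAlgebra

variable {K V : Type*} [Field K] [AddCommGroup V] [Module K V]

theorem symAlgHom_ext {B : Type*} [Ring B] [Algebra K B] {P Q : SymmetricAlgebra K V →ₐ[K] B}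
    (h : ∀ v, P (SymmetricAlgebra.ι K V v) = Q (SymmetricAlgebra.ι K V v)) : P = Q := by
  refine AlgHom.ext fun F => ?_
  induction F using SymmetricAlgebra.induction with
  | algebraMap r => simp only [AlgHom.commutes]
  | ι v => exact h v
  | mul F G hF hG => rw [map_mul, map_mul, hF, hG]
  | add F G hF hG => rw [map_add, map_add, hF, hG]

/-- Leibniz' rule for a map from a symmetric algebra to a possibly noncommutative algebra `B`, in
which the values of `P` are meant to be central. -/
def IsDerivationAlong {B : Type*} [Ring B] [Algebra K B] (P : SymmetricAlgebra K V →ₐ[K] B)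
    (δ : SymmetricAlgebra K V →ₗ[K] B) : Prop :=
  ∀ F G, δ (F * G) = P F * δ G + P G * δ F

theorem IsDerivationAlong.ext {B : Type*} [Ring B] [Algebra K B]
    {P : SymmetricAlgebra K V →ₐ[K] B} {δ δ' : SymmetricAlgebra K V →ₗ[K] B}
    (hδ : IsDerivationAlong P δ) (hδ' : IsDerivationAlong P δ')
    (h : ∀ v, δ (SymmetricAlgebra.ι K V v) = δ' (SymmetricAlgebra.ι K V v)) : δ = δ' := by
  have map_one {δ : SymmetricAlgebra K V →ₗ[K] B} (hδ : IsDerivationAlong P δ) : δ 1 = 0 := by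
    simpa using hδ 1 1
  refine LinearMap.ext fun F => ?_
  induction F using SymmetricAlgebra.induction with
  | algebraMap r => simp only [Algebra.algebraMap_eq_smul_one, map_smul, map_one hδ, map_one hδ']
  | ι v => exact h v
  | mul F G hF hG => rw [hδ, hδ', hF, hG]
  | add F G hF hG => rw [map_add, map_add, hF, hG]

/-- The algebra homomorphism `F ↦ F + ε δF` to the dual numbers that corresponds to the derivation
`δ` with `ι v ↦ u v`. -/
def infinitesimalLift (u : V →ₗ[K] SymmetricAlgebra K V) :
    SymmetricAlgebra K V →ₐ[K] DualNumber (SymmetricAlgebra K V) :=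
  SymmetricAlgebra.lift ((TrivSqZeroExt.inlAlgHom K (SymmetricAlgebra K V)
    (SymmetricAlgebra K V)).toLinearMap ∘ₗ SymmetricAlgebra.ι K V +
      (TrivSqZeroExt.inrHom (SymmetricAlgebra K V) (SymmetricAlgebra K V)).restrictScalars K ∘ₗ u)

theorem fst_infinitesimalLift (u : V →ₗ[K] SymmetricAlgebra K V) (F : SymmetricAlgebra K V) :
    (infinitesimalLift u F).fst = F := by
  have h : (TrivSqZeroExt.fstHom K (SymmetricAlgebra K V) (SymmetricAlgebra K V)).comp
      (infinitesimalLift u) = AlgHom.id K _ :=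
    SymmetricAlgebra.algHom_ext (LinearMap.ext fun v => by simp [infinitesimalLift])
  exact congr($h F)

/-- The derivation of the symmetric algebra with `ι v ↦ u v`. -/
def symDerivation (u : V →ₗ[K] SymmetricAlgebra K V) :
    Derivation K (SymmetricAlgebra K V) (SymmetricAlgebra K V) :=
  Derivation.mk' ((TrivSqZeroExt.sndHom (SymmetricAlgebra K V)
      (SymmetricAlgebra K V)).restrictScalars K ∘ₗ (infinitesimalLift u).toLinearMap) fun F G => by
    simp [fst_infinitesimalLift, mul_comm]

@[simp] theorem symDerivation_ι (u : V →ₗ[K] SymmetricAlgebra K V) (v : V) :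
    symDerivation u (SymmetricAlgebra.ι K V v) = u v := by
  simp [symDerivation, infinitesimalLift]

variable {g : Type*} [LieRing g] [LieAlgebra K g]

variable (K) in
/-- The derivative of polynomials on `g` in the direction `x`. -/
def dirDeriv (x : g) : Derivation K (SymmetricAlgebra K (Module.Dual K g))
    (SymmetricAlgebra K (Module.Dual K g)) :=
  symDerivation ((Algebra.linearMap K _) ∘ₗ LinearMap.applyₗ x)

variable (K) in
/-- The infinitesimal coadjoint action of `ξ` on `S(g*)`. -/
def coad (ξ : g) : Derivation K (SymmetricAlgebra K (Module.Dual K g))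
    (SymmetricAlgebra K (Module.Dual K g)) :=
  symDerivation (SymmetricAlgebra.ι K _ ∘ₗ
    (LieModule.toEnd K g (Module.Dual K g) ξ : Module.Dual K g →ₗ[K] Module.Dual K g))

/-- The coadjoint action of an automorphism of `g` on `S(g*)`. -/
def coadAut (θ : g ≃ₗ⁅K⁆ g) :
    SymmetricAlgebra K (Module.Dual K g) →ₐ[K] SymmetricAlgebra K (Module.Dual K g) :=
  SymmetricAlgebra.lift (SymmetricAlgebra.ι K _ ∘ₗ (θ.symm : g →ₗ[K] g).dualMap)

@[simp] theorem dirDeriv_ι (x : g) (l : Module.Dual K g) :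
    dirDeriv K x (SymmetricAlgebra.ι K _ l) = algebraMap K _ (l x) := by
  simp [dirDeriv]

@[simp] theorem coad_ι (ξ : g) (l : Module.Dual K g) :
    coad K ξ (SymmetricAlgebra.ι K _ l) = SymmetricAlgebra.ι K _ ⁅ξ, l⁆ := by
  simp [coad]

@[simp] theorem coadAut_ι (θ : g ≃ₗ⁅K⁆ g) (l : Module.Dual K g) :
    coadAut θ (SymmetricAlgebra.ι K _ l) =
      SymmetricAlgebra.ι K _ ((θ.symm : g →ₗ[K] g).dualMap l) := by
  simp [coadAut]

end DerivationsOfSymmetricAlgebra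

/-! ### Chern-Weil theory of an odd connection -/

section DualBases

variable {K g R ι : Type*} [Field K] [LieRing g] [LieAlgebra K g] [Ring R] [Algebra K R]
  [Fintype ι] (b : Module.Basis ι K g)

theorem sum_dualBasis_comp (Φ : g →ₗ[K] R) (Ψ : Module.Dual K g →ₗ[K] R) (T : g →ₗ[K] g) :
    ∑ q, Φ (T (b q)) * Ψ (b.coord q) = ∑ q, Φ (b q) * Ψ (b.coord q ∘ₗ T) := by
  have hT (q : ι) : Φ (T (b q)) = ∑ p, b.coord p (T (b q)) • Φ (b p) := by
    conv_lhs => rw [← b.sum_repr (T (b q))]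
    simp only [map_sum, map_smul, Module.Basis.coord_apply]
  have hΨ (p : ι) : Ψ (b.coord p ∘ₗ T) = ∑ q, b.coord p (T (b q)) • Ψ (b.coord q) := by
    conv_lhs => rw [← b.sum_dual_apply_smul_coord (b.coord p ∘ₗ T)]
    simp only [map_sum, map_smul, LinearMap.comp_apply]
  simp only [hT, hΨ, Finset.sum_mul, Finset.mul_sum, smul_mul_assoc, mul_smul_comm]
  exact Finset.sum_comm

theorem lie_dual_eq_sum (l : Module.Dual K g) (x : g) :
    ⁅x, l⁆ = ∑ p, l ⁅b p, x⁆ • b.coord p := by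
  conv_lhs => rw [← b.sum_dual_apply_smul_coord ⁅x, l⁆]
  refine Finset.sum_congr rfl fun p _ => ?_
  rw [Module.Dual.lie_apply, ← lie_skew, map_neg, neg_neg]

theorem sum_lie_mul_dualBasis (φ ψ : Module.Dual K g →ₗ[K] R) (l : Module.Dual K g) :
    ∑ q, φ ⁅b q, l⁆ * ψ (b.coord q) = -∑ p, φ (b.coord p) * ψ ⁅b p, l⁆ := by
  simp only [lie_dual_eq_sum b l, map_sum, map_smul, Finset.sum_mul, Finset.mul_sum,
    smul_mul_assoc, mul_smul_comm, ← Finset.sum_neg_distrib]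
  rw [Finset.sum_comm]
  refine Finset.sum_congr rfl fun p _ => Finset.sum_congr rfl fun q _ => ?_
  rw [← lie_skew (b p) (b q), map_neg, neg_smul]

end DualBases

/-- An odd derivation `diff` of a supercommutative algebra, whose grading by parity is encoded by
the involution `parity`, equal to `1` on even and to `-1` on odd elements. -/
structure OddDerivation (K R : Type*) [Field K] [Ring R] [Algebra K R] where
  /-- The parity involution. -/
  parity : R →ₐ[K] R
  /-- The derivation. -/
  diff : R →ₗ[K] R
  diff_mul : ∀ x y, diff (x * y) = diff x * y + parity x * diff y
  parity_diff : ∀ x, parity (diff x) = -diff (parity x)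
  mul_comm_of_even : ∀ x, parity x = x → ∀ y, x * y = y * x
  mul_of_odd : ∀ x, parity x = -x → ∀ y, x * y = parity y * x

/-- The algebraic properties of a cut off connection form in the Cartan model: the components
`conn l`, for `l ∈ g*`, of an odd `g`-valued element, and the generators `theta l` of `S(g*)`, such
that the square of the differential is `-∑ Θ^p L_p` on the components. -/
structure OddConnection {K g ι : Type*} [Field K] [LieRing g] [LieAlgebra K g] [Fintype ι]
    (b : Module.Basis ι K g) (R : Type*) [Ring R] [Algebra K R] extends OddDerivation K R where
  /-- The generators of `S(g*)`. -/
  theta : Module.Dual K g →ₗ[K] R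
  /-- The components of the connection. -/
  conn : Module.Dual K g →ₗ[K] R
  parity_theta : ∀ l, parity (theta l) = theta l
  diff_theta : ∀ l, diff (theta l) = 0
  parity_conn : ∀ l, parity (conn l) = -conn l
  diff_diff_conn : ∀ l, diff (diff (conn l)) = -∑ p, theta (b.coord p) * conn ⁅b p, l⁆

namespace OddConnection

open Polynomial

variable {K g R ι : Type*} [Field K] [LieRing g] [LieAlgebra K g] [Ring R] [Algebra K R]
  [Fintype ι] {b : Module.Basis ι K g} (c : OddConnection b R)

/-- The components of the bracket `[A, A]` of the connection `A` with itself. -/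
def bracket : Module.Dual K g →ₗ[K] R :=
  ∑ q, LinearMap.mulRight K (c.conn (b.coord q)) ∘ₗ c.conn ∘ₗ
    (LieModule.toEnd K g (Module.Dual K g) (b q) : Module.Dual K g →ₗ[K] Module.Dual K g)

theorem bracket_apply (l : Module.Dual K g) :
    c.bracket l = ∑ q, c.conn ⁅b q, l⁆ * c.conn (b.coord q) := by
  simp [bracket]

theorem bracket_eq_sum_sum (l : Module.Dual K g) :
    c.bracket l = ∑ p, ∑ q, l ⁅b p, b q⁆ • (c.conn (b.coord p) * c.conn (b.coord q)) := by
  simp only [bracket_apply, lie_dual_eq_sum b l, map_sum, map_smul, Finset.sum_mul, smul_mul_assoc]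
  exact Finset.sum_comm

theorem parity_bracket (l : Module.Dual K g) : c.parity (c.bracket l) = c.bracket l := by
  simp only [bracket_apply, map_sum, map_mul, parity_conn, neg_mul_neg]

theorem parity_diff_conn (l : Module.Dual K g) :
    c.parity (c.diff (c.conn l)) = c.diff (c.conn l) := by
  rw [c.parity_diff, c.parity_conn, map_neg, neg_neg]

theorem conn_mul_conn (l m : Module.Dual K g) : c.conn l * c.conn m = -(c.conn m * c.conn l) := by
  rw [c.mul_of_odd _ (c.parity_conn l), c.parity_conn, neg_mul]

theorem diff_bracket (l : Module.Dual K g) :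
    c.diff (c.bracket l) = (2 : K) • ∑ q, c.diff (c.conn ⁅b q, l⁆) * c.conn (b.coord q) := by
  have hcomm (q : ι) : c.conn ⁅b q, l⁆ * c.diff (c.conn (b.coord q)) =
      c.diff (c.conn (b.coord q)) * c.conn ⁅b q, l⁆ :=
    (c.mul_comm_of_even _ (c.parity_diff_conn _) _).symm
  have hswap := sum_lie_mul_dualBasis b (c.diff ∘ₗ c.conn) c.conn l
  simp only [LinearMap.comp_apply] at hswap
  simp only [bracket_apply, map_sum, c.diff_mul, c.parity_conn, neg_mul, hcomm,
    Finset.sum_add_distrib, Finset.sum_neg_distrib, two_smul, ← hswap]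

theorem sum_conn_lie_mul_bracket (l : Module.Dual K g) :
    ∑ r, c.conn ⁅b r, l⁆ * c.bracket (b.coord r) =
      ∑ p, ∑ q, c.conn ⁅⁅b p, b q⁆, l⁆ * (c.conn (b.coord p) * c.conn (b.coord q)) := by
  have hlie (p q : ι) :
      c.conn ⁅⁅b p, b q⁆, l⁆ = ∑ r, b.coord r ⁅b p, b q⁆ • c.conn ⁅b r, l⁆ := by
    conv_lhs => rw [← b.sum_repr ⁅b p, b q⁆]
    simp only [sum_lie, smul_lie, map_sum, map_smul, Module.Basis.coord_apply]
  simp only [hlie, bracket_eq_sum_sum, Finset.mul_sum, Finset.sum_mul, mul_smul_comm,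
    smul_mul_assoc]
  rw [Finset.sum_comm]
  exact Finset.sum_congr rfl fun p _ => Finset.sum_comm

/-- By antisymmetry and the Jacobi identity, twice the left side is its own negative. -/
theorem sum_bracket_lie_mul_conn [CharZero K] (l : Module.Dual K g) :
    ∑ q, c.bracket ⁅b q, l⁆ * c.conn (b.coord q) = 0 := by
  set T := ∑ q, c.bracket ⁅b q, l⁆ * c.conn (b.coord q)
  have swap : T = -∑ r, c.conn ⁅b r, l⁆ * c.bracket (b.coord r) := by
    rw [show T = _ from sum_lie_mul_dualBasis b c.bracket c.conn l]
    simp only [c.mul_comm_of_even _ (c.parity_bracket _)]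
  have expand : T = ∑ p, ∑ q, c.conn ⁅b q, ⁅b p, l⁆⁆ *
      (c.conn (b.coord q) * c.conn (b.coord p)) := by
    simp only [T, bracket_apply, Finset.sum_mul, mul_assoc]
  have jacobi : T + T = ∑ r, c.conn ⁅b r, l⁆ * c.bracket (b.coord r) := by
    rw [sum_conn_lie_mul_bracket]
    simp only [lie_lie, map_sub, sub_mul, Finset.sum_sub_distrib]
    rw [sub_eq_add_neg]
    congr 1
    · rw [expand, Finset.sum_comm]
    · simp only [expand, ← Finset.sum_neg_distrib, ← mul_neg, ← c.conn_mul_conn]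
  have three : (3 : K) • T = 0 := by
    rw [show (3 : K) = 1 + 1 + 1 by norm_num, add_smul, add_smul, one_smul, jacobi, swap]
    simp
  exact (smul_eq_zero.mp three).resolve_left three_ne_zero

/-- The components of the path `t ↦ Θ + t DA + ½ t² [A, A]`. It starts at the generators `Θ` and
ends at the curvature. -/
def curv : Module.Dual K g →ₗ[K] R[X] :=
  (monomial 0).restrictScalars K ∘ₗ c.theta +
    (monomial 1).restrictScalars K ∘ₗ c.diff ∘ₗ c.conn +
    (monomial 2).restrictScalars K ∘ₗ ((1 / 2 : K) • c.bracket)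

theorem curv_apply (l : Module.Dual K g) : c.curv l =
    monomial 0 (c.theta l) + monomial 1 (c.diff (c.conn l)) +
      monomial 2 ((1 / 2 : K) • c.bracket l) := rfl

theorem mapAlgHom_parity_curv (l : Module.Dual K g) : mapAlgHom c.parity (c.curv l) = c.curv l := by
  simp only [← mapCoeff_toLinearMap, curv_apply, map_add, mapCoeff_monomial,
    AlgHom.toLinearMap_apply, map_smul, parity_theta, parity_diff_conn, parity_bracket]

theorem mul_comm_of_even_path {p : R[X]} (hp : mapAlgHom c.parity p = p) (q : R[X]) :
    p * q = q * p := by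
  have hcoeff (n : ℕ) : c.parity (p.coeff n) = p.coeff n := by
    simpa using congr(($hp).coeff n)
  ext n
  rw [coeff_mul, coeff_mul, ← Finset.Nat.sum_antidiagonal_swap]
  exact Finset.sum_congr rfl fun _ _ => c.mul_comm_of_even _ (hcoeff _) _

theorem C_conn_mul (l : Module.Dual K g) (p : R[X]) :
    C (c.conn l) * p = mapAlgHom c.parity p * C (c.conn l) := by
  ext n
  simpa using c.mul_of_odd _ (c.parity_conn l) (p.coeff n)

/-- The path `F ↦ F(Θ + t DA + ½ t² [A, A])` of algebra homomorphisms. -/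
def subst : SymmetricAlgebra K (Module.Dual K g) →ₐ[K] R[X] :=
  (Subalgebra.center K R[X]).val.comp <| SymmetricAlgebra.lift
    (c.curv.codRestrict (Subalgebra.center K R[X]).toSubmodule fun l =>
      (Subalgebra.mem_center_iff (R := K)).mpr fun q =>
        (c.mul_comm_of_even_path (c.mapAlgHom_parity_curv l) q).symm :
      Module.Dual K g →ₗ[K] Subalgebra.center K R[X])

@[simp] theorem subst_ι (l : Module.Dual K g) : c.subst (SymmetricAlgebra.ι K _ l) = c.curv l :=
  congrArg Subtype.val (SymmetricAlgebra.lift_ι_apply _ l)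

theorem subst_mul_comm (F : SymmetricAlgebra K (Module.Dual K g)) (p : R[X]) :
    c.subst F * p = p * c.subst F :=
  ((Subalgebra.mem_center_iff (R := K)).mp (Subtype.property _) p).symm

theorem mapAlgHom_parity_subst (F : SymmetricAlgebra K (Module.Dual K g)) :
    mapAlgHom c.parity (c.subst F) = c.subst F := by
  have h : (mapAlgHom c.parity).comp c.subst = c.subst :=
    symAlgHom_ext fun l => by
      rw [AlgHom.comp_apply, subst_ι, mapAlgHom_parity_curv]
  exact congr($h F)

/-- The terms by which `P` fails to intertwine the differentials; they vanish on the invariants. -/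
def coadTerm (P : SymmetricAlgebra K (Module.Dual K g) →ₗ[K] R[X]) :
    SymmetricAlgebra K (Module.Dual K g) →ₗ[K] R[X] :=
  ∑ q, LinearMap.mulRight K (X * C (c.conn (b.coord q))) ∘ₗ P ∘ₗ (coad K (b q)).toLinearMap

theorem coadTerm_apply (P : SymmetricAlgebra K (Module.Dual K g) →ₗ[K] R[X])
    (F : SymmetricAlgebra K (Module.Dual K g)) :
    c.coadTerm P F = ∑ q, P (coad K (b q) F) * (X * C (c.conn (b.coord q))) := by
  simp only [coadTerm, LinearMap.sum_apply, LinearMap.comp_apply, LinearMap.mulRight_apply,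
    Derivation.coeFn_coe]

theorem coadTerm_eq_zero (P : SymmetricAlgebra K (Module.Dual K g) →ₗ[K] R[X])
    {F : SymmetricAlgebra K (Module.Dual K g)} (hF : ∀ ξ : g, coad K ξ F = 0) :
    c.coadTerm P F = 0 := by
  simp [coadTerm_apply, hF]

omit [Algebra K R] in
theorem monomial_mul_X_mul_C (n : ℕ) (r s : R) :
    monomial n r * (X * C s) = monomial (n + 1) (r * s) := by
  rw [← monomial_one_one_eq_X, monomial_mul_C, monomial_mul_monomial, one_mul]

theorem bianchi_identity [CharZero K] (l : Module.Dual K g) :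
    mapCoeff c.diff (c.curv l) = ∑ q, c.curv ⁅b q, l⁆ * (X * C (c.conn (b.coord q))) := by
  have htheta := sum_lie_mul_dualBasis b c.theta c.conn l
  simp only [curv_apply, map_add, mapCoeff_monomial, c.diff_theta, c.diff_diff_conn, add_mul,
    monomial_mul_X_mul_C, Finset.sum_add_distrib, ← map_sum, ← htheta, map_smul, c.diff_bracket,
    smul_mul_assoc, ← Finset.smul_sum, sum_bracket_lie_mul_conn]
  simp [smul_smul]

theorem mapCoeff_diff_subst [CharZero K] :
    mapCoeff c.diff ∘ₗ c.subst.toLinearMap = c.coadTerm c.subst.toLinearMap := by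
  refine IsDerivationAlong.ext (P := c.subst) (fun F G => ?_) (fun F G => ?_) fun l => ?_
  · simp only [LinearMap.comp_apply, AlgHom.toLinearMap_apply, map_mul, mapCoeff_mul c.diff_mul,
      mapAlgHom_parity_subst, c.subst_mul_comm G]
    rw [add_comm]
  · simp only [coadTerm_apply, AlgHom.toLinearMap_apply, Derivation.leibniz, smul_eq_mul, map_add,
      map_mul, add_mul, Finset.sum_add_distrib, mul_assoc, Finset.mul_sum]
  · simp only [LinearMap.comp_apply, AlgHom.toLinearMap_apply, subst_ι, bianchi_identity,
      coadTerm_apply, coad_ι]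

/-- The transgression: the derivation along `subst` with `Θ ↦ A`. -/
def transgression : SymmetricAlgebra K (Module.Dual K g) →ₗ[K] R[X] :=
  ∑ a, LinearMap.mulRight K (C (c.conn (b.coord a))) ∘ₗ c.subst.toLinearMap ∘ₗ
    (dirDeriv K (b a)).toLinearMap

theorem transgression_apply (F : SymmetricAlgebra K (Module.Dual K g)) :
    c.transgression F = ∑ a, c.subst (dirDeriv K (b a) F) * C (c.conn (b.coord a)) := by
  simp [transgression]

theorem transgression_ι (l : Module.Dual K g) :
    c.transgression (SymmetricAlgebra.ι K _ l) = C (c.conn l) := by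
  conv_rhs => rw [← b.sum_dual_apply_smul_coord l]
  simp only [transgression_apply, dirDeriv_ι, AlgHom.commutes, map_sum, map_smul,
    ← Algebra.smul_def, smul_C]

theorem isDerivationAlong_transgression : IsDerivationAlong c.subst c.transgression :=
  fun F G => by
    simp only [transgression_apply, Derivation.leibniz, smul_eq_mul, map_add, map_mul, add_mul,
      Finset.sum_add_distrib, mul_assoc, Finset.mul_sum]

theorem mapAlgHom_parity_transgression (F : SymmetricAlgebra K (Module.Dual K g)) :
    mapAlgHom c.parity (c.transgression F) = -c.transgression F := by
  simp only [transgression_apply, map_sum, map_mul, mapAlgHom_parity_subst]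
  simp [parity_conn]

theorem conn_mul_transgression (l : Module.Dual K g) (F : SymmetricAlgebra K (Module.Dual K g)) :
    X * C (c.conn l) * c.transgression F = -(c.transgression F * (X * C (c.conn l))) := by
  rw [mul_assoc, C_conn_mul, mapAlgHom_parity_transgression, neg_mul, mul_neg, ← mul_assoc X,
    X_mul, mul_assoc]

theorem derivative_curv [CharZero K] (l : Module.Dual K g) :
    derivative (c.curv l) = C (c.diff (c.conn l)) + monomial 1 (c.bracket l) := by
  have htwo (r : R) : (1 / 2 : K) • r * (2 : ℕ) = r := by
    rw [Nat.cast_ofNat, mul_two, ← add_smul, add_halves, one_smul]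
  simp only [curv_apply, map_add, derivative_monomial, htwo]
  simp

theorem cartan_homotopy_formula [CharZero K] :
    derivative.restrictScalars K ∘ₗ c.subst.toLinearMap =
      mapCoeff c.diff ∘ₗ c.transgression + c.coadTerm c.transgression := by
  refine IsDerivationAlong.ext (P := c.subst) (fun F G => ?_) (fun F G => ?_) fun l => ?_
  · simp [c.subst_mul_comm G, add_comm]
  · have hdiff (F : SymmetricAlgebra K (Module.Dual K g)) : mapCoeff c.diff (c.subst F) =
        ∑ q, c.subst (coad K (b q) F) * (X * C (c.conn (b.coord q))) :=
      congr($c.mapCoeff_diff_subst F).trans (c.coadTerm_apply _ F)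
    have hcoad (F G : SymmetricAlgebra K (Module.Dual K g)) :
        c.coadTerm c.transgression (F * G) =
          c.subst F * c.coadTerm c.transgression G + c.subst G * c.coadTerm c.transgression F -
            (mapCoeff c.diff (c.subst F) * c.transgression G +
              mapCoeff c.diff (c.subst G) * c.transgression F) := by
      simp only [coadTerm_apply, Derivation.leibniz, smul_eq_mul, map_add,
        c.isDerivationAlong_transgression _ _, hdiff, Finset.mul_sum, Finset.sum_mul, mul_assoc,
        ← Finset.sum_add_distrib, ← Finset.sum_sub_distrib, add_mul]
      refine Finset.sum_congr rfl fun q _ => ?_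
      rw [← mul_assoc X, ← mul_assoc X, conn_mul_transgression, conn_mul_transgression]
      noncomm_ring
    simp only [LinearMap.add_apply, LinearMap.comp_apply, hcoad,
      c.isDerivationAlong_transgression F G, map_add, mapCoeff_mul c.diff_mul,
      mapAlgHom_parity_subst]
    noncomm_ring
  · simp only [LinearMap.add_apply, LinearMap.comp_apply, AlgHom.toLinearMap_apply, subst_ι,
      LinearMap.restrictScalars_apply, derivative_curv, coadTerm_apply, coad_ι, transgression_ι,
      mapCoeff_C, bracket_apply, ← mul_assoc, ← X_mul]
    simp only [mul_assoc, C_mul, ← C_mul_X_eq_monomial, map_sum, X_mul]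

/-- The primitive of `evalAt 1 (subst F) - evalAt 0 (subst F)` for an invariant `F`. -/
def homotopy : SymmetricAlgebra K (Module.Dual K g) →ₗ[K] R :=
  unitIntegral K R ∘ₗ c.transgression

theorem diff_evalAt_subst [CharZero K] (t : K) {F : SymmetricAlgebra K (Module.Dual K g)}
    (hF : ∀ ξ : g, coad K ξ F = 0) : c.diff (evalAt t (c.subst F)) = 0 := by
  have h : mapCoeff c.diff (c.subst F) = 0 :=
    congr($c.mapCoeff_diff_subst F).trans (c.coadTerm_eq_zero _ hF)
  rw [← evalAt_mapCoeff, h, map_zero]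

theorem evalAt_subst_sub [CharZero K] {F : SymmetricAlgebra K (Module.Dual K g)}
    (hF : ∀ ξ : g, coad K ξ F = 0) :
    evalAt (1 : K) (c.subst F) - evalAt (0 : K) (c.subst F) = c.diff (c.homotopy F) := by
  have h : derivative (c.subst F) = mapCoeff c.diff (c.transgression F) := by
    simpa [c.coadTerm_eq_zero _ hF] using congr($c.cartan_homotopy_formula F)
  rw [← unitIntegral_derivative, h, unitIntegral_mapCoeff, homotopy, LinearMap.comp_apply]

/-- The endomorphism `ρ` of `R` acts on the generators and on the connection through the coadjoint
action of the automorphism `θ`. -/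
structure IsEquivariant (ρ : R →ₐ[K] R) (θ : g ≃ₗ⁅K⁆ g) : Prop where
  map_theta : ∀ l, ρ (c.theta l) = c.theta (l ∘ₗ θ.symm)
  map_conn : ∀ l, ρ (c.conn l) = c.conn (l ∘ₗ θ.symm)
  map_diff_conn : ∀ l, ρ (c.diff (c.conn l)) = c.diff (c.conn (l ∘ₗ θ.symm))

namespace IsEquivariant

variable {c} {ρ : R →ₐ[K] R} {θ : g ≃ₗ⁅K⁆ g} (h : c.IsEquivariant ρ θ)

include h

theorem map_bracket (l : Module.Dual K g) : ρ (c.bracket l) = c.bracket (l ∘ₗ θ.symm) := by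
  have hlie (x : g) : ⁅x, l⁆ ∘ₗ (θ.symm : g →ₗ[K] g) = ⁅θ x, l ∘ₗ (θ.symm : g →ₗ[K] g)⁆ := by
    ext y
    simp [Module.Dual.lie_apply, LieEquiv.map_lie]
  have hθ (m : Module.Dual K g) : (m ∘ₗ (θ : g →ₗ[K] g)) ∘ₗ (θ.symm : g →ₗ[K] g) = m := by
    ext y
    simp
  simpa [bracket_apply, h.map_conn, hlie, hθ, LinearMap.dualMap_apply'] using sum_dualBasis_comp b
    (c.conn ∘ₗ LinearMap.applyₗ (l ∘ₗ (θ.symm : g →ₗ[K] g)) ∘ₗ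
      (LieModule.toEnd K g (Module.Dual K g) : g →ₗ[K] Module.End K (Module.Dual K g)))
    (c.conn ∘ₗ (θ.symm : g →ₗ[K] g).dualMap) θ

theorem map_curv (l : Module.Dual K g) : mapAlgHom ρ (c.curv l) = c.curv (l ∘ₗ θ.symm) := by
  simp only [← mapCoeff_toLinearMap, curv_apply, map_add, mapCoeff_monomial,
    AlgHom.toLinearMap_apply, map_smul, h.map_theta, h.map_diff_conn, h.map_bracket]

theorem map_subst (F : SymmetricAlgebra K (Module.Dual K g)) :
    mapAlgHom ρ (c.subst F) = c.subst (coadAut θ F) := by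
  have hsubst : (mapAlgHom ρ).comp c.subst = c.subst.comp (coadAut θ) :=
    symAlgHom_ext fun l => by
      simp only [AlgHom.comp_apply, subst_ι, coadAut_ι, h.map_curv]; rfl
  exact congr($hsubst F)

theorem map_evalAt_subst (t : K) (F : SymmetricAlgebra K (Module.Dual K g)) :
    ρ (evalAt t (c.subst F)) = evalAt t (c.subst (coadAut θ F)) := by
  rw [← h.map_subst, ← mapCoeff_toLinearMap, evalAt_mapCoeff, AlgHom.toLinearMap_apply]

theorem map_transgression (F : SymmetricAlgebra K (Module.Dual K g)) :
    mapAlgHom ρ (c.transgression F) = c.transgression (coadAut θ F) := by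
  have htrans : (mapAlgHom ρ).toLinearMap ∘ₗ c.transgression =
      c.transgression ∘ₗ (coadAut θ).toLinearMap := by
    refine IsDerivationAlong.ext (P := c.subst.comp (coadAut θ)) (fun F G => ?_) (fun F G => ?_)
      fun l => ?_
    · simp only [LinearMap.comp_apply, c.isDerivationAlong_transgression F G, map_add,
        AlgHom.toLinearMap_apply, map_mul, h.map_subst, AlgHom.comp_apply]
    · simp only [LinearMap.comp_apply, AlgHom.toLinearMap_apply, map_mul, AlgHom.comp_apply,
        c.isDerivationAlong_transgression _ _]
    · simp only [LinearMap.comp_apply, AlgHom.toLinearMap_apply, transgression_ι, coadAut_ι,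
        ← mapCoeff_toLinearMap, mapCoeff_C, h.map_conn]; rfl
  exact congr($htrans F)

theorem map_homotopy (F : SymmetricAlgebra K (Module.Dual K g)) :
    ρ (c.homotopy F) = c.homotopy (coadAut θ F) := by
  simp only [homotopy, LinearMap.comp_apply, ← h.map_transgression, ← mapCoeff_toLinearMap,
    unitIntegral_mapCoeff, AlgHom.toLinearMap_apply]

end IsEquivariant

end OddConnection

/-! ### Lie brackets as derivatives of pullbacks -/

section Flow

open Set Filter Topology VectorField

variable {𝕜 : Type*} [NontriviallyNormedField 𝕜]
  {E : Type*} [NormedAddCommGroup E] [NormedSpace 𝕜 E]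
  {F : Type*} [NormedAddCommGroup F] [NormedSpace 𝕜 F]

theorem hasFDerivWithinAt_comp_prodMk_right {E' : Type*} [NormedAddCommGroup E'] [NormedSpace 𝕜 E']
    {f : E' × E → F} {f' : E' × E →L[𝕜] F} {r : Set E'} {s : Set E} {x : E'} {y : E} (hx : x ∈ r)
    (h : HasFDerivWithinAt f f' (r ×ˢ s) (x, y)) :
    HasFDerivWithinAt (fun y => f (x, y)) (f' ∘L ContinuousLinearMap.inr 𝕜 E' E) s y :=
  h.comp y (hasFDerivAt_prodMk_right x y).hasFDerivWithinAt fun _ hy => ⟨hx, hy⟩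

theorem hasDerivAt_comp_prodMk_left {f : 𝕜 × E → F} {f' : 𝕜 × E →L[𝕜] F} {s : Set E} {t : 𝕜} {y : E}
    (hy : y ∈ s) (h : HasFDerivWithinAt f f' (univ ×ˢ s) (t, y)) :
    HasDerivAt (fun t => f (t, y)) (f' (1, 0)) t :=
  hasDerivWithinAt_univ.1 (h.comp_hasDerivWithinAt t
    ((hasDerivAt_id t).prodMk (hasDerivAt_const t y)).hasDerivWithinAt
    fun t _ => Set.mk_mem_prod (mem_univ t) hy)

theorem eventually_hasFDerivWithinAt_fderivWithin {f : E → F} {s : Set E} {x : E} {n : ℕ}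
    (hf : ContDiffWithinAt 𝕜 n f s x) (hn : n ≠ 0) (hx : x ∈ s) :
    ∀ᶠ y in 𝓝[s] x, HasFDerivWithinAt f (fderivWithin 𝕜 f s y) s y := by
  have h := hf.eventually (by simp)
  rw [insert_eq_of_mem hx] at h
  exact h.mono fun y hy => (hy.differentiableWithinAt (mod_cast hn)).hasFDerivWithinAt

theorem hasDerivAt_fderivWithin_comp_prodMk {s : Set E} (hs : UniqueDiffOn 𝕜 s) {t₀ : 𝕜} {y₀ : E}
    (hy₀ : y₀ ∈ s) (hy₀' : y₀ ∈ closure (interior s)) {f : 𝕜 × E → F}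
    (hf : ContDiffWithinAt 𝕜 (minSmoothness 𝕜 2) f (univ ×ˢ s) (t₀, y₀)) :
    HasDerivAt (fun t => fderivWithin 𝕜 (fun y => f (t, y)) s y₀)
      (fderivWithin 𝕜 (fun y => deriv (fun t => f (t, y)) t₀) s y₀) t₀ := by
  set S : Set (𝕜 × E) := univ ×ˢ s
  have hS : UniqueDiffOn 𝕜 S := uniqueDiffOn_univ.prod hs
  have hmem : (t₀, y₀) ∈ S := ⟨mem_univ _, hy₀⟩
  have hf₂ : ContDiffWithinAt 𝕜 2 f S (t₀, y₀) := hf.of_le le_minSmoothness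
  set D := fderivWithin 𝕜 f S
  set D' := fderivWithin 𝕜 D S (t₀, y₀)
  have hD : HasFDerivWithinAt D D' S (t₀, y₀) :=
    ((hf₂.fderivWithin_right hS (m := 1) (by norm_num) hmem).differentiableWithinAt
      one_ne_zero).hasFDerivWithinAt
  have hsymm : IsSymmSndFDerivWithinAt 𝕜 f S (t₀, y₀) := by
    refine hf.isSymmSndFDerivWithinAt le_rfl hS ?_ hmem
    rw [interior_prod_eq, closure_prod_eq]
    exact ⟨by simp, hy₀'⟩
  have hfD : ∀ᶠ p in 𝓝[S] (t₀, y₀), HasFDerivWithinAt f (D p) S p :=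
    eventually_hasFDerivWithinAt_fderivWithin hf₂ two_ne_zero hmem
  have ht : Tendsto (fun t => (t, y₀)) (𝓝 t₀) (𝓝[S] (t₀, y₀)) := by
    rw [nhdsWithin_prod_eq, nhdsWithin_univ]
    exact tendsto_id.prodMk (tendsto_const_pure.mono_right (pure_le_nhdsWithin hy₀))
  have hy : Tendsto (fun y => (t₀, y)) (𝓝[s] y₀) (𝓝[S] (t₀, y₀)) := by
    rw [nhdsWithin_prod_eq, nhdsWithin_univ]
    exact (tendsto_const_pure.mono_right (pure_le_nhds t₀)).prodMk tendsto_id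
  have hspace : (fun t => fderivWithin 𝕜 (fun y => f (t, y)) s y₀) =ᶠ[𝓝 t₀]
      fun t => D (t, y₀) ∘L ContinuousLinearMap.inr 𝕜 𝕜 E :=
    (ht.eventually hfD).mono fun t h =>
      (hasFDerivWithinAt_comp_prodMk_right (mem_univ t) h).fderivWithin (hs y₀ hy₀)
  have htime : (fun y => deriv (fun t => f (t, y)) t₀) =ᶠ[𝓝[s] y₀] fun y => D (t₀, y) (1, 0) := by
    filter_upwards [hy.eventually hfD, eventually_mem_nhdsWithin] with y h hys
    exact (hasDerivAt_comp_prodMk_left hys h).deriv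
  have hmixed : fderivWithin 𝕜 (fun y => deriv (fun t => f (t, y)) t₀) s y₀ =
      D' (1, 0) ∘L ContinuousLinearMap.inr 𝕜 𝕜 E := by
    rw [htime.fderivWithin_eq (htime.eq_of_nhdsWithin hy₀),
      ((hasFDerivWithinAt_comp_prodMk_right (mem_univ t₀) hD).clm_apply
        (hasFDerivWithinAt_const ((1 : 𝕜), (0 : E)) y₀ s)).fderivWithin (hs y₀ hy₀)]
    ext v
    simpa using hsymm (0, v) (1, 0)
  rw [hmixed]
  simpa using ((hasDerivAt_comp_prodMk_left hy₀ hD).clm_comp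
    (hasDerivAt_const t₀ (ContinuousLinearMap.inr 𝕜 𝕜 E))).congr_of_eventuallyEq hspace

theorem hasDerivAt_of_clm_apply_eventuallyEq [CompleteSpace E] {L : 𝕜 → E →L[𝕜] E} {L' : E →L[𝕜] E}
    {v Z : 𝕜 → E} {v' : E} {t₀ : 𝕜} (hL : HasDerivAt L L' t₀)
    (hL₀ : L t₀ = ContinuousLinearMap.id 𝕜 E) (hv : HasDerivAt v v' t₀)
    (hZ : ∀ᶠ t in 𝓝 t₀, L t (Z t) = v t) : HasDerivAt Z (v' - L' (v t₀)) t₀ := by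
  have hinvertible : ∀ᶠ t in 𝓝 t₀, (L t).IsInvertible := by
    refine hL.continuousAt.eventually ?_
    rw [hL₀]
    exact ContinuousLinearEquiv.nhds (ContinuousLinearEquiv.refl 𝕜 E)
  have hZ' : Z =ᶠ[𝓝 t₀] fun t => (L t).inverse (v t) := by
    filter_upwards [hZ, hinvertible] with t hLZ ⟨e, he⟩
    simp [← hLZ, ← he]
  have hinverse : DifferentiableAt 𝕜 (fun t => (L t).inverse) t₀ := by
    refine DifferentiableAt.comp (g := ContinuousLinearMap.inverse) t₀ ?_ hL.differentiableAt
    rw [hL₀]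
    exact (contDiffAt_map_inverse (n := 1) (ContinuousLinearEquiv.refl 𝕜 E)).differentiableAt
      one_ne_zero
  have hdiff : DifferentiableAt 𝕜 Z t₀ :=
    (hinverse.clm_apply hv.differentiableAt).congr_of_eventuallyEq hZ'
  have hZ₀ : Z t₀ = v t₀ := by simpa [hL₀] using hZ.self_of_nhds
  have hsum : L' (v t₀) + deriv Z t₀ = v' := by
    have := hL.clm_apply hdiff.hasDerivAt
    rw [hZ₀, hL₀] at this
    exact (this.congr_of_eventuallyEq (hZ.mono fun t h => h.symm)).unique hv
  rw [← hsum, add_sub_cancel_left]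
  exact hdiff.hasDerivAt

theorem hasDerivAt_lieBracketWithin_of_fderivWithin_apply_eq [CompleteSpace E] {s : Set E}
    (hs : UniqueDiffOn 𝕜 s) {y₀ : E} (hy₀ : y₀ ∈ s) (hy₀' : y₀ ∈ closure (interior s))
    {f : 𝕜 × E → E} (hf : ContDiffWithinAt 𝕜 (minSmoothness 𝕜 2) f (univ ×ˢ s) (0, y₀))
    (hf₀ : ∀ᶠ y in 𝓝[s] y₀, f (0, y) = y) (hfs : ∀ᶠ t in 𝓝 (0 : 𝕜), f (t, y₀) ∈ s) {X Y : E → E}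
    (hX : ∀ᶠ y in 𝓝[s] y₀, HasDerivAt (fun t => f (t, y)) (X y) 0)
    (hY : DifferentiableWithinAt 𝕜 Y s y₀) {Z : 𝕜 → E}
    (hZ : ∀ᶠ t in 𝓝 (0 : 𝕜), fderivWithin 𝕜 (fun y => f (t, y)) s y₀ (Z t) = Y (f (t, y₀))) :
    HasDerivAt Z (lieBracketWithin 𝕜 X Y s y₀) 0 := by
  have hf₀y : f (0, y₀) = y₀ := hf₀.self_of_nhdsWithin hy₀
  have hL : HasDerivAt (fun t => fderivWithin 𝕜 (fun y => f (t, y)) s y₀)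
      (fderivWithin 𝕜 X s y₀) 0 := by
    have hderiv : (fun y => deriv (fun t => f (t, y)) 0) =ᶠ[𝓝[s] y₀] X := hX.mono fun y h => h.deriv
    rw [← hderiv.fderivWithin_eq (hderiv.eq_of_nhdsWithin hy₀)]
    exact hasDerivAt_fderivWithin_comp_prodMk hs hy₀ hy₀' hf
  have hL₀ : fderivWithin 𝕜 (fun y => f (0, y)) s y₀ = ContinuousLinearMap.id 𝕜 E := by
    rw [EventuallyEq.fderivWithin_eq (f := fun y => y) hf₀ hf₀y,
      fderivWithin_fun_id (hs y₀ hy₀)]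
  have hYf : HasDerivAt (fun t => Y (f (t, y₀))) (fderivWithin 𝕜 Y s y₀ (X y₀)) 0 := by
    obtain ⟨u, hu, hus⟩ := hfs.exists_mem
    have hYy : HasFDerivWithinAt Y (fderivWithin 𝕜 Y s y₀) s (f (0, y₀)) := by
      rw [hf₀y]
      exact hY.hasFDerivWithinAt
    exact (hYy.comp_hasDerivWithinAt 0 (hX.self_of_nhdsWithin hy₀).hasDerivWithinAt hus).hasDerivAt
      hu
  simpa only [lieBracketWithin, hf₀y] using hasDerivAt_of_clm_apply_eventuallyEq hL hL₀ hYf hZ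

variable {H : Type*} [TopologicalSpace H] {I : ModelWithCorners 𝕜 E H} {M : Type*}
  [TopologicalSpace M] [ChartedSpace H M]

theorem hasDerivAt_of_hasMFDerivAt {c : 𝕜 → F} {t : 𝕜} {c' : 𝕜 →L[𝕜] F}
    (h : HasMFDerivAt 𝓘(𝕜, 𝕜) 𝓘(𝕜, F) c t c') : HasDerivAt c (c' 1) t :=
  have hc : HasFDerivAt c c' t := hasMFDerivAt_iff_hasFDerivAt.1 h
  hc.hasDerivAt

theorem contDiffWithinAt_extChartAt_comp_family {n : ℕ∞ω} [IsManifold I n M] {Φ : 𝕜 × M → M}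
    {t₀ : 𝕜} {x₀ : M} (hΦ₀ : Φ (t₀, x₀) = x₀)
    (hΦ : ContMDiffAt (𝓘(𝕜, 𝕜).prod I) I n Φ (t₀, x₀)) :
    ContDiffWithinAt 𝕜 n
      (fun p : 𝕜 × E => extChartAt I x₀ (Φ (p.1, (extChartAt I x₀).symm p.2)))
      (univ ×ˢ range I) (t₀, extChartAt I x₀ x₀) := by
  have hsymm : ContMDiffWithinAt (𝓘(𝕜, 𝕜).prod 𝓘(𝕜, E)) (𝓘(𝕜, 𝕜).prod I) n
      (fun p : 𝕜 × E => (p.1, (extChartAt I x₀).symm p.2)) (univ ×ˢ range I)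
      (t₀, extChartAt I x₀ x₀) :=
    contMDiffWithinAt_fst.prodMk
      ((contMDiffWithinAt_extChartAt_symm_range x₀ (mem_extChartAt_target x₀)).comp
        (f := Prod.snd) (t₀, extChartAt I x₀ x₀) contMDiffWithinAt_snd fun p hp => hp.2)
  have hinner := ContMDiffAt.comp_contMDiffWithinAt (g := Φ) (t₀, extChartAt I x₀ x₀)
    (by rwa [extChartAt_to_inv]) hsymm
  have hchart : ContMDiffAt I 𝓘(𝕜, E) n (extChartAt I x₀)
      (Φ (t₀, (extChartAt I x₀).symm (extChartAt I x₀ x₀))) := by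
    rw [extChartAt_to_inv, hΦ₀]
    exact contMDiffAt_extChartAt
  have hcomp := hchart.comp_contMDiffWithinAt
    (f := fun p : 𝕜 × E => Φ (p.1, (extChartAt I x₀).symm p.2)) (t₀, extChartAt I x₀ x₀) hinner
  rw [← modelWithCornersSelf_prod, chartedSpaceSelf_prod] at hcomp
  exact contMDiffWithinAt_iff_contDiffWithinAt.1 hcomp

section Chart

variable [IsManifold I 1 M]

theorem mdifferentiableAt_extChartAt_of_mem {x z : M} (hz : z ∈ (extChartAt I x).source) :
    MDifferentiableAt I 𝓘(𝕜, E) (extChartAt I x) z :=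
  mdifferentiableAt_extChartAt (by rwa [← extChartAt_source I])

theorem mpullbackWithin_extChartAt_symm_apply (V : ∀ x : M, TangentSpace I x) {x : M} {y : E}
    (hy : y ∈ (extChartAt I x).target) :
    mpullbackWithin 𝓘(𝕜, E) I (extChartAt I x).symm V (range I) y =
      mfderiv I 𝓘(𝕜, E) (extChartAt I x) ((extChartAt I x).symm y)
        (V ((extChartAt I x).symm y)) := by
  rw [mpullbackWithin_apply, ContinuousLinearMap.inverse_eq
    (mfderivWithin_extChartAt_symm_comp_mfderiv_extChartAt hy)
    (mfderiv_extChartAt_comp_mfderivWithin_extChartAt_symm hy)]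
  rfl

theorem mlieBracket_eq_lieBracketWithin_extChartAt (X Y : ∀ x : M, TangentSpace I x) (x : M) :
    mlieBracket I X Y x = lieBracketWithin 𝕜
      (mpullbackWithin 𝓘(𝕜, E) I (extChartAt I x).symm X (range I))
      (mpullbackWithin 𝓘(𝕜, E) I (extChartAt I x).symm Y (range I)) (range I)
      (extChartAt I x x) := by
  rw [← mlieBracketWithin_univ, mlieBracketWithin_apply, preimage_univ, univ_inter]
  refine (congrArg (fun A : E →L[𝕜] E => A.inverse _) mfderiv_extChartAt_self).trans ?_
  exact congrArg (fun A : E →L[𝕜] E => A _) ContinuousLinearMap.inverse_id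

theorem fderivWithin_extChartAt_comp_apply {ψ : M → M} {x : M} (hψ : MDifferentiableAt I I ψ x)
    (hx : ψ x ∈ (extChartAt I x).source) (v : E) :
    fderivWithin 𝕜 (fun y => extChartAt I x (ψ ((extChartAt I x).symm y))) (range I)
      (extChartAt I x x) v =
      mfderiv I 𝓘(𝕜, E) (extChartAt I x) (ψ x) (mfderiv I I ψ x v) := by
  have hsymm : HasMFDerivWithinAt 𝓘(𝕜, E) I (extChartAt I x).symm (range I) (extChartAt I x x)
      (ContinuousLinearMap.id 𝕜 E) := by
    have := (mdifferentiableWithinAt_extChartAt_symm (I := I)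
      (mem_extChartAt_target x)).hasMFDerivWithinAt
    rwa [mfderivWithin_range_extChartAt_symm] at this
  have hψ' : HasMFDerivAt I I ψ ((extChartAt I x).symm (extChartAt I x x)) (mfderiv I I ψ x) := by
    rw [extChartAt_to_inv]
    exact hψ.hasMFDerivAt
  have hchart : HasMFDerivAt I 𝓘(𝕜, E) (extChartAt I x)
      (ψ ((extChartAt I x).symm (extChartAt I x x)))
      (mfderiv I 𝓘(𝕜, E) (extChartAt I x) (ψ x)) := by
    rw [extChartAt_to_inv]
    exact (mdifferentiableAt_extChartAt_of_mem hx).hasMFDerivAt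
  have hcomp : HasFDerivWithinAt (fun y => extChartAt I x (ψ ((extChartAt I x).symm y)))
      (mfderiv I 𝓘(𝕜, E) (extChartAt I x) (ψ x) ∘L mfderiv I I ψ x : E →L[𝕜] E)
      (range I) (extChartAt I x x) :=
    hasMFDerivWithinAt_iff_hasFDerivWithinAt.1
      ((hchart.comp _ hψ').comp_hasMFDerivWithinAt _ hsymm)
  rw [hcomp.fderivWithin (I.uniqueDiffOn _ (mem_range_self _))]
  rfl

theorem hasDerivAt_extChartAt_comp {c : 𝕜 → M} {t : 𝕜} (hc : MDifferentiableAt 𝓘(𝕜, 𝕜) I c t)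
    {x : M} (hx : c t ∈ (extChartAt I x).source) :
    HasDerivAt (fun t => extChartAt I x (c t))
      (mfderiv I 𝓘(𝕜, E) (extChartAt I x) (c t) (mfderiv 𝓘(𝕜, 𝕜) I c t (1 : 𝕜))) t :=
  hasDerivAt_of_hasMFDerivAt
    ((mdifferentiableAt_extChartAt_of_mem hx).hasMFDerivAt.comp t hc.hasMFDerivAt)

end Chart

/-- Unlike the flow of `X`, the family `Φ` needs to have the velocity `X` at the time `0` only. -/
theorem hasDerivAt_mlieBracket_of_mfderiv_apply_eq [CompleteSpace E]
    [IsManifold I (minSmoothness 𝕜 2) M] {Φ : 𝕜 × M → M} {x₀ : M}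
    (hΦ : ∀ᶠ t in 𝓝 (0 : 𝕜), ∀ y,
      ContMDiffAt (𝓘(𝕜, 𝕜).prod I) I (minSmoothness 𝕜 2) Φ (t, y))
    (hΦ₀ : ∀ y, Φ (0, y) = y) {X Y : ∀ x : M, TangentSpace I x}
    (hX : ∀ y, (mfderiv 𝓘(𝕜, 𝕜) I (fun t => Φ (t, y)) 0 (1 : 𝕜) : E) = X y)
    (hY : MDifferentiableAt I I.tangent (fun x => (⟨x, Y x⟩ : TangentBundle I M)) x₀) {Z : 𝕜 → E}
    (hZ : ∀ᶠ t in 𝓝 (0 : 𝕜), mfderiv I I (fun y => Φ (t, y)) x₀ (Z t) = Y (Φ (t, x₀))) :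
    HasDerivAt Z (mlieBracket I X Y x₀ : E) 0 := by
  have h_ne : minSmoothness 𝕜 2 ≠ 0 := (two_pos.trans_le le_minSmoothness).ne'
  set φ := extChartAt I x₀
  have hdt (y : M) : MDifferentiableAt 𝓘(𝕜, 𝕜) I (fun t => Φ (t, y)) 0 :=
    ((hΦ.self_of_nhds y).mdifferentiableAt h_ne).comp (f := fun t : 𝕜 => (t, y)) 0
      (mdifferentiableAt_id.prodMk mdifferentiableAt_const)
  have hmem : ∀ᶠ t in 𝓝 (0 : 𝕜), Φ (t, x₀) ∈ φ.source :=
    (hdt x₀).continuousAt.eventually <|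
      show φ.source ∈ 𝓝 (Φ (0, x₀)) by rw [hΦ₀]; exact extChartAt_source_mem_nhds x₀
  rw [mlieBracket_eq_lieBracketWithin_extChartAt]
  refine hasDerivAt_lieBracketWithin_of_fderivWithin_apply_eq (s := range I) (y₀ := φ x₀)
    (f := fun p => φ (Φ (p.1, φ.symm p.2))) I.uniqueDiffOn (mem_range_self _)
    (I.range_subset_closure_interior (mem_range_self _))
    (contDiffWithinAt_extChartAt_comp_family (hΦ₀ x₀) (hΦ.self_of_nhds x₀)) ?_
    (.of_forall fun t => mem_range_self _) ?_ ?_ ?_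
  · filter_upwards [extChartAt_target_mem_nhdsWithin x₀] with y hy
    rw [hΦ₀, φ.right_inv hy]
  · filter_upwards [extChartAt_target_mem_nhdsWithin x₀] with y hy
    have hvel := hasDerivAt_extChartAt_comp (x := x₀) (hdt (φ.symm y))
      (by rw [hΦ₀]; exact φ.map_target hy)
    rw [hX, hΦ₀] at hvel
    rwa [mpullbackWithin_extChartAt_symm_apply X hy]
  · simpa only [preimage_univ, univ_inter] using
      MDifferentiableWithinAt.differentiableWithinAt_mpullbackWithin_vectorField (s := univ)
        hY.mdifferentiableWithinAt
  · filter_upwards [hZ, hmem, hΦ] with t hZt hmemt hΦt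
    have hdy : MDifferentiableAt I I (fun y => Φ (t, y)) x₀ :=
      ((hΦt x₀).mdifferentiableAt h_ne).comp (f := fun y : M => (t, y)) x₀
        (mdifferentiableAt_const.prodMk mdifferentiableAt_id)
    rw [fderivWithin_extChartAt_comp_apply hdy hmemt, hZt, extChartAt_to_inv,
      mpullbackWithin_extChartAt_symm_apply Y (φ.map_source hmemt), φ.left_inv hmemt]

end Flow

section LieGroupCurves

open Set Filter Topology VectorField

section Manifold

variable {E E' E'' : Type*} [NormedAddCommGroup E] [NormedSpace ℝ E] [NormedAddCommGroup E']
  [NormedSpace ℝ E'] [NormedAddCommGroup E''] [NormedSpace ℝ E''] {H H' H'' : Type*}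
  [TopologicalSpace H] [TopologicalSpace H'] [TopologicalSpace H''] {I : ModelWithCorners ℝ E H}
  {I' : ModelWithCorners ℝ E' H'} {I'' : ModelWithCorners ℝ E'' H''} {M M' M'' : Type*}
  [TopologicalSpace M] [ChartedSpace H M] [TopologicalSpace M'] [ChartedSpace H' M']
  [TopologicalSpace M''] [ChartedSpace H'' M'']

theorem hasMFDerivAt_extChartAt_symm [I.Boundaryless] [IsManifold I 1 M] (x : M) :
    HasMFDerivAt 𝓘(ℝ, E) I (extChartAt I x).symm (extChartAt I x x)
      (ContinuousLinearMap.id ℝ E) := by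
  have := (mdifferentiableWithinAt_extChartAt_symm (I := I)
    (mem_extChartAt_target x)).hasMFDerivWithinAt
  rw [mfderivWithin_range_extChartAt_symm, I.range_eq_univ] at this
  exact hasMFDerivWithinAt_univ.1 this

theorem exists_curve_mfderiv_eq {n : ℕ∞ω} [I.Boundaryless] [IsManifold I 1 M] [IsManifold I n M]
    (x : M) (v : E) :
    ∃ γ : ℝ → M, γ 0 = x ∧ (∀ᶠ t in 𝓝 (0 : ℝ), ContMDiffAt 𝓘(ℝ, ℝ) I n γ t) ∧
      (mfderiv 𝓘(ℝ, ℝ) I γ 0 (1 : ℝ) : E) = v := by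
  set φ := extChartAt I x
  let line : ℝ → E := fun t => φ x + t • v
  have line_zero : line 0 = φ x := by simp [line]
  have contDiff_line : ContDiff ℝ n line := contDiff_const.add (contDiff_id.smul contDiff_const)
  have hline : HasMFDerivAt 𝓘(ℝ, ℝ) 𝓘(ℝ, E) line 0 (ContinuousLinearMap.toSpanSingleton ℝ v) := by
    have h : HasDerivAt line ((1 : ℝ) • v) 0 :=
      ((hasDerivAt_id (0 : ℝ)).smul_const v).const_add (φ x)
    rw [one_smul] at h
    exact h.hasFDerivAt.hasMFDerivAt
  have hmem : ∀ᶠ t in 𝓝 (0 : ℝ), φ.target ∈ 𝓝 (line t) := by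
    have : ∀ᶠ y in 𝓝 (line 0), φ.target ∈ 𝓝 y :=
      eventually_eventually_nhds.2 (line_zero ▸ extChartAt_target_mem_nhds x)
    exact contDiff_line.continuous.continuousAt.eventually this
  refine ⟨fun t => φ.symm (line t), ?_, ?_, ?_⟩
  · exact (congrArg φ.symm line_zero).trans (extChartAt_to_inv x)
  · exact hmem.mono fun t ht => ((contMDiffOn_extChartAt_symm x).contMDiffAt ht).comp t
      contDiff_line.contMDiff.contMDiffAt
  · have hsymm : HasMFDerivAt 𝓘(ℝ, E) I φ.symm (line 0) (ContinuousLinearMap.id ℝ E) := by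
      rw [line_zero]
      exact hasMFDerivAt_extChartAt_symm x
    exact (congrArg (fun A : ℝ →L[ℝ] E => A 1) (hsymm.comp (0 : ℝ) hline).mfderiv).trans
      (one_smul ℝ v)

theorem mfderiv_mfderiv_apply {f : M → M'} {g : M' → M''} {h : M → M''} {x : M} {y : M'}
    (hy : f x = y) (hh : ∀ z, g (f z) = h z) (hg : MDifferentiableAt I' I'' g y)
    (hf : MDifferentiableAt I I' f x) (v : E) :
    (mfderiv I' I'' g y (mfderiv I I' f x v : E') : E'') = mfderiv I I'' h x v := by
  subst hy
  obtain rfl : g ∘ f = h := funext hh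
  exact (congrArg (fun A : E →L[ℝ] E'' => A v) (mfderiv_comp x hg hf)).symm

end Manifold

variable {d : ℕ} {G : Type*} [Group G] [TopologicalSpace G]
  [ChartedSpace (EuclideanSpace ℝ (Fin d)) G]

/-- `γ` is a curve through `1` that is smooth near `0` and has the velocity `ξ` at `0`. Such curves
stand in for the one-parameter subgroup `t ↦ exp(tξ)` wherever only a derivative at `0` matters. -/
structure IsCurve (γ : ℝ → G) (ξ : GroupLieAlgebra (𝓡 d) G) : Prop where
  zero : γ 0 = 1
  smooth : ∀ᶠ t in 𝓝 (0 : ℝ), ContMDiffAt 𝓘(ℝ, ℝ) (𝓡 d) ∞ γ t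
  velocity : (mfderiv 𝓘(ℝ, ℝ) (𝓡 d) γ 0 (1 : ℝ) : EuclideanSpace ℝ (Fin d)) = ξ

namespace IsCurve

variable {γ : ℝ → G} {ξ : GroupLieAlgebra (𝓡 d) G}

theorem mdifferentiableAt (hγ : IsCurve γ ξ) : MDifferentiableAt 𝓘(ℝ, ℝ) (𝓡 d) γ 0 :=
  hγ.smooth.self_of_nhds.mdifferentiableAt (by simp)

theorem mfderiv_comp_apply {E : Type*} [NormedAddCommGroup E] [NormedSpace ℝ E] {H' : Type*}
    [TopologicalSpace H'] {J : ModelWithCorners ℝ E H'} {M : Type*} [TopologicalSpace M]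
    [ChartedSpace H' M] (hγ : IsCurve γ ξ) {σ : G → M} (hσ : MDifferentiableAt (𝓡 d) J σ 1) :
    (mfderiv 𝓘(ℝ, ℝ) J (fun t => σ (γ t)) 0 (1 : ℝ) : E) = mfderiv (𝓡 d) J σ 1 ξ := by
  rw [← hγ.velocity]
  exact (mfderiv_mfderiv_apply hγ.zero (fun _ => rfl) hσ hγ.mdifferentiableAt 1).symm

end IsCurve

theorem Ad_one (ξ : GroupLieAlgebra (𝓡 d) G) : Ad (1 : G) ξ = ξ := by
  have hid : id = fun h : G => 1 * h * 1⁻¹ := by ext; simp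
  have h := mfderiv_id (I := 𝓡 d) (x := (1 : G))
  rw [hid] at h
  exact congrArg (fun A : EuclideanSpace ℝ (Fin d) →L[ℝ] EuclideanSpace ℝ (Fin d) => A ξ) h

variable [LieGroup (𝓡 d) ∞ G]

theorem exists_isCurve (ξ : GroupLieAlgebra (𝓡 d) G) : ∃ γ : ℝ → G, IsCurve γ ξ :=
  let ⟨γ, zero, smooth, velocity⟩ :=
    exists_curve_mfderiv_eq (I := 𝓡 d) (E := EuclideanSpace ℝ (Fin d)) (1 : G) ξ
  ⟨γ, zero, smooth, velocity⟩

theorem contMDiff_conj (g : G) : ContMDiff (𝓡 d) (𝓡 d) ∞ (fun h : G => g * h * g⁻¹) :=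
  (contMDiff_const.mul contMDiff_id).mul contMDiff_const

theorem mdifferentiableAt_conj (g h : G) :
    MDifferentiableAt (𝓡 d) (𝓡 d) (fun h : G => g * h * g⁻¹) h :=
  (contMDiff_conj g).mdifferentiable (by simp) h

theorem mdifferentiableAt_mul_left (g h : G) :
    MDifferentiableAt (𝓡 d) (𝓡 d) (fun h : G => g * h) h :=
  (contMDiff_mul_left (n := ∞)).mdifferentiable (by simp) h

theorem mdifferentiableAt_mul_right (g h : G) :
    MDifferentiableAt (𝓡 d) (𝓡 d) (fun h : G => h * g) h :=
  (contMDiff_mul_right (n := ∞)).mdifferentiable (by simp) h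

theorem Ad_mul (g h : G) (ξ : GroupLieAlgebra (𝓡 d) G) : Ad (g * h) ξ = Ad g (Ad h ξ) :=
  (mfderiv_mfderiv_apply (by simp) (fun z => by group) (mdifferentiableAt_conj g 1)
    (mdifferentiableAt_conj h 1) ξ).symm

theorem Ad_inv_Ad (g : G) (ξ : GroupLieAlgebra (𝓡 d) G) : Ad g⁻¹ (Ad g ξ) = ξ := by
  rw [← Ad_mul, inv_mul_cancel, Ad_one]

/-- Here `Ad (γ t) η` is the pullback of the left-invariant field of `η` under right
multiplication by `γ t`. -/
theorem IsCurve.hasDerivAt_Ad {γ : ℝ → G} {ξ : GroupLieAlgebra (𝓡 d) G} (hγ : IsCurve γ ξ)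
    (η : GroupLieAlgebra (𝓡 d) G) :
    HasDerivAt (F := EuclideanSpace ℝ (Fin d)) (fun t => Ad (γ t) η)
      (⁅ξ, η⁆ : GroupLieAlgebra (𝓡 d) G) 0 := by
  have hsmooth : minSmoothness ℝ 2 ≤ ∞ := by
    rw [minSmoothness_of_isRCLikeNormedField]
    exact ENat.LEInfty.out
  have : IsManifold (𝓡 d) (minSmoothness ℝ 2) G := .of_le hsmooth
  refine hasDerivAt_mlieBracket_of_mfderiv_apply_eq (I := 𝓡 d) (Φ := fun p : ℝ × G => p.2 * γ p.1)
    (X := mulInvariantVectorField ξ) (Y := mulInvariantVectorField η) (x₀ := (1 : G))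
    ?_ (by simp [hγ.zero]) (fun y => hγ.mfderiv_comp_apply (mdifferentiableAt_mul_left y 1))
    (mdifferentiableAt_mulInvariantVectorField η) (.of_forall fun t => ?_)
  · filter_upwards [hγ.smooth] with t ht y
    exact (contMDiffAt_snd.mul (ht.comp (f := Prod.fst) (t, y) contMDiffAt_fst)).of_le hsmooth
  · refine (mfderiv_mfderiv_apply (h := fun h => γ t * h) (by simp) (fun z => by group)
      (mdifferentiableAt_mul_right (γ t) 1) (mdifferentiableAt_conj (γ t) 1) η).trans ?_
    change (mulInvariantVectorField η (γ t) : EuclideanSpace ℝ (Fin d)) =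
      mulInvariantVectorField η (1 * γ t)
    rw [one_mul]

theorem IsCurve.conj {γ : ℝ → G} {ξ : GroupLieAlgebra (𝓡 d) G} (hγ : IsCurve γ ξ) (g : G) :
    IsCurve (fun t => g * γ t * g⁻¹) (Ad g ξ) where
  zero := by simp [hγ.zero]
  smooth := hγ.smooth.mono fun t ht => (contMDiff_conj g).contMDiffAt.comp t ht
  velocity := hγ.mfderiv_comp_apply (mdifferentiableAt_conj g 1)

theorem Ad_lie (g : G) (ξ η : GroupLieAlgebra (𝓡 d) G) : Ad g ⁅ξ, η⁆ = ⁅Ad g ξ, Ad g η⁆ := by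
  obtain ⟨γ, hγ⟩ := exists_isCurve ξ
  let A : EuclideanSpace ℝ (Fin d) →L[ℝ] EuclideanSpace ℝ (Fin d) :=
    mfderiv (𝓡 d) (𝓡 d) (fun h : G => g * h * g⁻¹) 1
  refine (A.hasFDerivAt.comp_hasDerivAt (0 : ℝ) (hγ.hasDerivAt_Ad η)).unique
    (((hγ.conj g).hasDerivAt_Ad (Ad g η)).congr_of_eventuallyEq (.of_forall fun t => ?_))
  change Ad g (Ad (γ t) η) = Ad (g * γ t * g⁻¹) (Ad g η)
  rw [← Ad_mul, ← Ad_mul, inv_mul_cancel_right]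

/-- The adjoint representation `Ad g` as an automorphism of the Lie algebra. -/
def AdEquiv (g : G) : GroupLieAlgebra (𝓡 d) G ≃ₗ⁅ℝ⁆ GroupLieAlgebra (𝓡 d) G where
  __ := Ad g
  map_lie' := Ad_lie g _ _
  invFun := Ad g⁻¹
  left_inv := Ad_inv_Ad g
  right_inv ξ := by simpa using Ad_inv_Ad g⁻¹ ξ

variable {n : ℕ} {H : Type*} [TopologicalSpace H]
  (I : ModelWithCorners ℝ (EuclideanSpace ℝ (Fin n)) H)
  {W : Type*} [TopologicalSpace W] [ChartedSpace H W] [MulAction G W] [ContMDiffSMul (𝓡 d) I ∞ G W]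

omit [LieGroup (𝓡 d) ∞ G] in
theorem mdifferentiableAt_orbit (g : G) (x : W) :
    MDifferentiableAt (𝓡 d) I (fun g : G => g • x) g := by
  have h : ContMDiff (𝓡 d) I ∞ (fun g : G => g • x) :=
    (contMDiff_smul (I := 𝓡 d) (I' := I) (G := G) (M := W) (n := ∞)).comp
      (contMDiff_id.prodMk contMDiff_const)
  exact h.mdifferentiable (by simp) g

variable [IsManifold I ∞ W]

theorem mfderiv_pullField (g : G) (X : VField I W) (x : W) :
    (mfderiv I I (fun y : W => g • y) x (pullField d I g X x) : EuclideanSpace ℝ (Fin n)) =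
      X (g • x) :=
  (isInvertible_mfderiv_smul (d := d) I g x).self_apply_inverse _

namespace IsCurve

variable {γ : ℝ → G} {ξ : GroupLieAlgebra (𝓡 d) G}

omit [LieGroup (𝓡 d) ∞ G] [IsManifold I ∞ W] in
theorem mfderiv_smul (hγ : IsCurve γ (-ξ)) (x : W) :
    (mfderiv 𝓘(ℝ, ℝ) I (fun t => γ t • x) 0 (1 : ℝ) : EuclideanSpace ℝ (Fin n)) =
      infAction I x ξ := by
  rw [hγ.mfderiv_comp_apply (σ := fun g : G => g • x) (mdifferentiableAt_orbit I 1 x)]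
  exact map_neg (mfderiv (𝓡 d) I (fun g : G => g • x) 1) ξ

theorem hasDerivAt_pullField (hγ : IsCurve γ (-ξ)) (Y : VField I W) (x : W) :
    HasDerivAt (F := EuclideanSpace ℝ (Fin n)) (fun t => pullField d I (γ t) Y x)
      (⁅(fundField I ξ : VField I W), Y⁆ x) 0 := by
  have hsmooth : minSmoothness ℝ 2 ≤ ∞ := by
    rw [minSmoothness_of_isRCLikeNormedField]
    exact ENat.LEInfty.out
  have : IsManifold I (minSmoothness ℝ 2) W := .of_le hsmooth
  refine hasDerivAt_mlieBracket_of_mfderiv_apply_eq (I := I) (Φ := fun p : ℝ × W => γ p.1 • p.2)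
    (X := fundField I ξ) (Y := Y) (x₀ := x) ?_ (by simp [hγ.zero]) (hγ.mfderiv_smul I)
    Y.mdifferentiableAt (.of_forall fun t => mfderiv_pullField I (γ t) Y x)
  filter_upwards [hγ.smooth] with t ht y
  exact ((ht.comp (f := Prod.fst) (t, y) contMDiffAt_fst).smul contMDiffAt_snd).of_le hsmooth

theorem hasDerivAt_fn_smul (hγ : IsCurve γ (-ξ)) (φ : Fn I W) (x : W) :
    HasDerivAt (fun t => φ (γ t • x)) (⁅(fundField I ξ : VField I W), φ⁆ x) 0 := by
  have horbit : MDifferentiableAt 𝓘(ℝ, ℝ) I (fun t => γ t • x) 0 :=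
    (mdifferentiableAt_orbit (d := d) I (γ 0) x).comp (0 : ℝ) hγ.mdifferentiableAt
  have hbracket : ⁅(fundField I ξ : VField I W), φ⁆ x =
      mfderiv 𝓘(ℝ, ℝ) 𝓘(ℝ, ℝ) (fun t => φ (γ t • x)) 0 (1 : ℝ) := by
    have := mfderiv_mfderiv_apply (I := 𝓘(ℝ, ℝ)) (I' := I) (I'' := 𝓘(ℝ, ℝ))
      (f := fun t => γ t • x) (x := (0 : ℝ)) (by rw [hγ.zero, one_smul]) (fun _ => rfl)
      (VField.mdiffAt φ x) horbit 1
    rwa [hγ.mfderiv_smul I] at this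
  rw [hbracket]
  exact hasDerivAt_of_hasMFDerivAt ((VField.mdiffAt φ _).comp (f := fun t => γ t • x) (0 : ℝ)
    horbit).hasMFDerivAt

end IsCurve

end LieGroupCurves

/-! ### Invariant polynomials -/

section PointEvaluation

open SymmetricAlgebra

variable {K V : Type*} [Field K] [AddCommGroup V] [Module K V]

variable (K) in
/-- The value at the point `x` of `V` of an element of `S(V*)`, regarded as a polynomial on `V`. -/
def evalPoint (x : V) : SymmetricAlgebra K (Module.Dual K V) →ₐ[K] K :=
  SymmetricAlgebra.lift (LinearMap.applyₗ x)

@[simp] theorem evalPoint_ι (x : V) (l : Module.Dual K V) : evalPoint K x (ι K _ l) = l x :=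
  SymmetricAlgebra.lift_ι_apply _ l

theorem ext_evalPoint [Infinite K] [Module.Finite K V]
    {F G : SymmetricAlgebra K (Module.Dual K V)}
    (h : ∀ x : V, evalPoint K x F = evalPoint K x G) : F = G := by
  let b := Module.finBasis K V
  have heval (t : Fin (Module.finrank K V) → K) :
      (MvPolynomial.aeval t).comp (equivMvPolynomial b.dualBasis).toAlgHom =
        evalPoint K (b.equivFun.symm t) := by
    refine SymmetricAlgebra.algHom_ext (b.dualBasis.ext fun i => ?_)
    simp only [LinearMap.coe_comp, LinearMap.coe_coe, AlgHom.coe_comp, MvPolynomial.aeval_eq_eval,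
      AlgEquiv.coe_toAlgHom, Function.comp_apply, equivMvPolynomial_ι_apply, MvPolynomial.eval_X,
      Module.Basis.equivFun_symm_apply, evalPoint_ι, map_sum, map_smul, smul_eq_mul]
    simp [Finsupp.single_apply]
  refine (equivMvPolynomial b.dualBasis).injective (MvPolynomial.funext fun t => ?_)
  exact congr($(heval t) F).trans ((h _).trans congr($(heval t) G).symm)

theorem hasDerivAt_evalPoint {𝕜 : Type*} [NontriviallyNormedField 𝕜] [Module 𝕜 V]
    {D : Derivation 𝕜 (SymmetricAlgebra 𝕜 (Module.Dual 𝕜 V))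
      (SymmetricAlgebra 𝕜 (Module.Dual 𝕜 V))} {x : 𝕜 → V} {t : 𝕜}
    (hx : ∀ l : Module.Dual 𝕜 V,
      HasDerivAt (fun s => l (x s)) (evalPoint 𝕜 (x t) (D (ι 𝕜 _ l))) t)
    (F : SymmetricAlgebra 𝕜 (Module.Dual 𝕜 V)) :
    HasDerivAt (fun s => evalPoint 𝕜 (x s) F) (evalPoint 𝕜 (x t) (D F)) t := by
  induction F using SymmetricAlgebra.induction with
  | algebraMap r => simpa using hasDerivAt_const t r
  | ι l => simpa using hx l
  | mul F G hF hG =>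
    simp only [map_mul, Derivation.leibniz, smul_eq_mul, map_add]
    exact (hF.mul hG).congr_deriv (by ring)
  | add F G hF hG =>
    simp only [map_add]
    exact hF.add hG

theorem evalPoint_coadAut {g : Type*} [LieRing g] [LieAlgebra K g] (θ : g ≃ₗ⁅K⁆ g) (x : g)
    (F : SymmetricAlgebra K (Module.Dual K g)) :
    evalPoint K x (coadAut θ F) = evalPoint K (θ.symm x) F := by
  have h : (evalPoint K x).comp (coadAut θ) = evalPoint K (θ.symm x) :=
    SymmetricAlgebra.algHom_ext (LinearMap.ext fun l => by simp)
  exact congr($h F)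

end PointEvaluation

section InvariantPolynomials

variable {d : ℕ} {G : Type*} [Group G] [TopologicalSpace G]
  [ChartedSpace (EuclideanSpace ℝ (Fin d)) G] [LieGroup (𝓡 d) ∞ G]

theorem coadAut_AdEquiv_of_mem_invPoly {F : SymDual d G} (hF : F ∈ invPoly d G) (g : G) :
    coadAut (AdEquiv g) F = F := by
  simp only [invPoly, Algebra.mem_iInf] at hF
  exact hF g

theorem coad_eq_zero_of_coadAut_eq
    {F : SymmetricAlgebra ℝ (Module.Dual ℝ (GroupLieAlgebra (𝓡 d) G))}
    (hF : ∀ g : G, coadAut (AdEquiv g) F = F) (ξ : GroupLieAlgebra (𝓡 d) G) :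
    coad ℝ ξ F = 0 := by
  have : Module.Finite ℝ (GroupLieAlgebra (𝓡 d) G) :=
    inferInstanceAs (Module.Finite ℝ (EuclideanSpace ℝ (Fin d)))
  refine ext_evalPoint fun x => ?_
  obtain ⟨γ, hγ⟩ := exists_isCurve (-ξ)
  have hconst (t : ℝ) : evalPoint ℝ (Ad (γ t) x) F = evalPoint ℝ x F := by
    conv_lhs => rw [← hF (γ t), evalPoint_coadAut]
    rw [show (AdEquiv (γ t)).symm (Ad (γ t) x) = x from Ad_inv_Ad (γ t) x]
  have hderiv : HasDerivAt (fun t => evalPoint ℝ (Ad (γ t) x) F)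
      (evalPoint ℝ (Ad (γ 0) x) (coad ℝ ξ F)) 0 := by
    refine hasDerivAt_evalPoint (fun l => ?_) F
    let l' : EuclideanSpace ℝ (Fin d) →L[ℝ] ℝ := LinearMap.toContinuousLinearMap l
    rw [coad_ι, evalPoint_ι, Module.Dual.lie_apply, ← map_neg, ← neg_lie, hγ.zero, Ad_one]
    exact l'.hasFDerivAt.comp_hasDerivAt (0 : ℝ) (hγ.hasDerivAt_Ad x)
  simp only [hconst, hγ.zero, Ad_one] at hderiv
  rw [map_zero]
  exact hderiv.unique (hasDerivAt_const 0 _)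

end InvariantPolynomials

/-! ### Cut off connection forms -/

theorem hasDerivAt_linearMap_apply {𝕜 E F : Type*} [NontriviallyNormedField 𝕜] [CompleteSpace 𝕜]
    [NormedAddCommGroup E] [NormedSpace 𝕜 E] [FiniteDimensional 𝕜 E]
    [NormedAddCommGroup F] [NormedSpace 𝕜 F] {A : 𝕜 → E →ₗ[𝕜] F} {A' : E →ₗ[𝕜] F}
    {u : 𝕜 → E} {u' : E} {t : 𝕜} (hA : ∀ e, HasDerivAt (fun s => A s e) (A' e) t)
    (hu : HasDerivAt u u' t) :
    HasDerivAt (fun s => A s (u s)) (A' (u t) + A t u') t := by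
  let b := Module.finBasis 𝕜 E
  have expand (B : E →ₗ[𝕜] F) (e : E) : B e = ∑ i, b.coord i e • B (b i) := by
    conv_lhs => rw [← b.sum_repr e, map_sum]
    simp only [map_smul, Module.Basis.coord_apply]
  have hcoord (i) : HasDerivAt (fun s => b.coord i (u s)) (b.coord i u') t :=
    (LinearMap.toContinuousLinearMap (b.coord i)).hasFDerivAt.comp_hasDerivAt t hu
  rw [expand A', expand (A t), ← Finset.sum_add_distrib]
  simp only [fun s => expand (A s) (u s)]
  exact .fun_sum fun i _ => (hcoord i).fun_smul (hA (b i))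

section ConnectionForms

variable {d n : ℕ} {H : Type*} [TopologicalSpace H]
  {I : ModelWithCorners ℝ (EuclideanSpace ℝ (Fin n)) H}
  {G : Type*} [Group G] [TopologicalSpace G] [ChartedSpace (EuclideanSpace ℝ (Fin d)) G]
  {W : Type*} [TopologicalSpace W] [ChartedSpace H W] [MulAction G W]

theorem CutOff.eq_zero (f : CutOff d I G W) {x : W} (hx : x ∈ singularSet d I G W) :
    f.toFn x = 0 := by
  obtain ⟨U, -, hs, hf⟩ := f.vanish
  exact hf x (hs hx)

theorem CutOff.pullFn_toFn [ContMDiffSMul (𝓡 d) I ∞ G W] (f : CutOff d I G W) (g : G) :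
    pullFn d I g f.toFn = f.toFn :=
  ContMDiffMap.ext fun x => f.invariant g x

variable [IsManifold I ∞ W] (f : CutOff d I G W) (η : Connection d I G W)

theorem cutOffForm_apply (l : Module.Dual ℝ (GroupLieAlgebra (𝓡 d) G)) (X : VField I W) (x : W) :
    cutOffForm f η l X x = f.toFn x * l (η.form x (X x)) := rfl

variable [LieGroup (𝓡 d) ∞ G] [ContMDiffSMul (𝓡 d) I ∞ G W]

theorem pullField_one (X : VField I W) : pullField d I (1 : G) X = X := by
  refine ContMDiffSection.ext fun x => ?_
  have hid : (fun y : W => (1 : G) • y) = id := funext (one_smul G)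
  change VectorField.mpullback I I (fun y : W => (1 : G) • y) X x = X x
  rw [hid, VectorField.mpullback_id]

theorem cutOffForm_fundField (l : Module.Dual ℝ (GroupLieAlgebra (𝓡 d) G))
    (ξ : GroupLieAlgebra (𝓡 d) G) : cutOffForm f η l (fundField I ξ) = l ξ • f.toFn := by
  refine ContMDiffMap.ext fun x => ?_
  change f.toFn x * l (η.form x (infAction I x ξ)) = l ξ * f.toFn x
  by_cases hx : x ∈ singularSet d I G W
  · rw [f.eq_zero hx, zero_mul, mul_zero]
  · rw [η.vertical x hx, mul_comm]

theorem cutOffForm_smul_apply (l : Module.Dual ℝ (GroupLieAlgebra (𝓡 d) G)) (g : G)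
    (X : VField I W) (x : W) : cutOffForm f η l X (g • x) =
      f.toFn x * l (Ad g (η.form x (pullField d I g X x))) := by
  rw [cutOffForm_apply, f.invariant]
  by_cases hx : x ∈ singularSet d I G W
  · rw [f.eq_zero hx, zero_mul, zero_mul]
  · rw [← η.equivariant x hx g]
    exact congrArg (fun v => f.toFn x * l (η.form (g • x) v)) (mfderiv_pullField I g X x).symm

theorem pullFn_cutOffForm (l : Module.Dual ℝ (GroupLieAlgebra (𝓡 d) G)) (g : G)
    (X : VField I W) : pullFn d I g (cutOffForm f η (l ∘ₗ Ad g⁻¹) X) =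
      cutOffForm f η l (pullField d I g X) := by
  refine ContMDiffMap.ext fun x => (cutOffForm_smul_apply f η _ g X x).trans ?_
  rw [cutOffForm_apply, LinearMap.comp_apply, Ad_inv_Ad]

theorem lie_fundField_cutOffForm (l : Module.Dual ℝ (GroupLieAlgebra (𝓡 d) G))
    (ξ : GroupLieAlgebra (𝓡 d) G) (Y : VField I W) :
    ⁅(fundField I ξ : VField I W), cutOffForm f η l Y⁆ =
      cutOffForm f η l ⁅(fundField I ξ : VField I W), Y⁆ + cutOffForm f η ⁅ξ, l⁆ Y := by
  refine ContMDiffMap.ext fun x => ?_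
  obtain ⟨γ, hγ⟩ := exists_isCurve (-ξ)
  let L : EuclideanSpace ℝ (Fin d) →L[ℝ] ℝ :=
    LinearMap.toContinuousLinearMap (E := EuclideanSpace ℝ (Fin d)) (F' := ℝ) l
  let N : EuclideanSpace ℝ (Fin n) →L[ℝ] EuclideanSpace ℝ (Fin d) :=
    LinearMap.toContinuousLinearMap (E := EuclideanSpace ℝ (Fin n))
      (F' := EuclideanSpace ℝ (Fin d)) (η.form x)
  have hform := N.hasFDerivAt.comp_hasDerivAt (0 : ℝ) (hγ.hasDerivAt_pullField I Y x)
  have hAd := hasDerivAt_linearMap_apply (E := EuclideanSpace ℝ (Fin d))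
    (F := EuclideanSpace ℝ (Fin d)) (A := fun t => Ad (γ t))
    (A' := (LieAlgebra.ad ℝ (GroupLieAlgebra (𝓡 d) G) (-ξ) : _ →ₗ[ℝ] _))
    hγ.hasDerivAt_Ad hform
  have hderiv := (L.hasFDerivAt.comp_hasDerivAt (0 : ℝ) hAd).const_mul (f.toFn x)
  have hfn := hγ.hasDerivAt_fn_smul I (cutOffForm f η l Y) x
  simp only [cutOffForm_smul_apply] at hfn
  refine (hfn.unique hderiv).trans ?_
  change f.toFn x * l (⁅-ξ, η.form x (pullField d I (γ 0) Y x)⁆ +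
    Ad (γ 0) (η.form x (⁅(fundField I ξ : VField I W), Y⁆ x))) = _
  rw [hγ.zero, pullField_one, Ad_one, neg_lie, neg_add_eq_sub, map_sub, sub_eq_add_neg, mul_add]
  rfl

end ConnectionForms

/-! ### Differential forms and the Cartan model -/

namespace Form

section CartanCalculus

variable {A L : Type*} [CommRing A]

theorem apply_succ [AddCommGroup L] [Module A L] (α : Form A L) (n : ℕ) (v : Fin (n + 1) → L) :
    α (n + 1) v = contract (v 0) α n (fun i => v i.succ) :=
  congrArg (α (n + 1)) (Matrix.cons_head_tail v).symm

variable [LieRing L] [Module A L] [LieRingModule L A] [LieRinehartRing A L]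

theorem lieD_sgn (x : L) (α : Form A L) : lieD x (sgn α) = sgn (lieD x α) := by
  refine ext fun n v => ?_
  rw [lieD_apply, sgn_apply, sgn_apply, lieD_apply]
  rcases neg_one_pow_eq_or A n with h | h <;> simp [h]; ring

theorem lieD_zero_apply (x : L) (α : Form A L) (v : Fin 0 → L) : lieD x α 0 v = ⁅x, α 0 v⁆ := by
  rw [Subsingleton.elim v ![]]; rfl

theorem lieD_ofFun (x : L) (a : A) : lieD x (ofFun a : Form A L) = ofFun ⁅x, a⁆ :=
  ext_contract rfl fun y => by
    rw [contract_lieD, contract_ofFun, contract_ofFun, contract_ofFun, map_zero, sub_zero]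

theorem lieD_lieD (x y : L) (α : Form A L) :
    lieD x (lieD y α) = lieD y (lieD x α) + lieD ⁅x, y⁆ α := by
  refine ext fun n v => ?_
  induction n generalizing α with
  | zero =>
    simp only [lieD_zero_apply, add_apply]
    rw [leibniz_lie x y, add_comm]
  | succ n ih =>
    simp only [apply_succ, map_add, contract_lieD, map_sub, sub_apply, add_apply, ih]
    have h := lie_lie x y (v 0)
    rw [h, sub_eq_add_neg ⁅x, ⁅y, v 0⁆⁆, contract_add_left, contract_neg_left, add_apply, neg_apply]
    ring

theorem lieD_mul (x : L) (α β : Form A L) :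
    lieD x (α * β) = lieD x α * β + α * lieD x β := by
  refine ext fun n v => ?_
  induction n generalizing α β with
  | zero =>
    simp only [lieD_zero_apply, add_apply, Subsingleton.elim v ![], mul_zero_apply]
    rw [LieRinehartRing.leibniz_mul_right, add_comm, smul_eq_mul]
  | succ n ih =>
    simp only [apply_succ, map_add, contract_lieD, contract_mul, sub_apply, add_apply, ih, lieD_sgn,
      sub_mul, mul_sub]
    ring

variable (K : Type*) [CommRing K] [Algebra K A] [LieAlgebra K L] [LieRinehartAlgebra K A L]

theorem lieD_extD (x : L) (α : Form A L) : lieD x (extD K α) = extD K (lieD x α) := by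
  refine ext fun n v => ?_
  induction n generalizing α with
  | zero => simp only [lieD_zero_apply, extD_apply_zero, lie_zero]
  | succ n ih =>
    simp only [apply_succ, contract_lieD, contract_extD, map_sub, sub_apply, ih,
      lieD_lieD x (v 0), add_apply]
    ring

theorem extD_extD (α : Form A L) : extD K (extD K α) = 0 := by
  refine ext fun n v => ?_
  induction n generalizing α with
  | zero => rfl
  | succ n ih =>
    simp only [apply_succ, contract_extD, map_sub, sub_apply, ih, lieD_extD, sub_zero, sub_self,
      map_zero, zero_apply]

theorem extD_mul (α β : Form A L) :
    extD K (α * β) = extD K α * β + sgn α * extD K β := by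
  refine ext fun n v => ?_
  induction n generalizing α β with
  | zero =>
    simp only [Subsingleton.elim v ![], extD_apply_zero, add_apply, mul_zero_apply, zero_mul,
      mul_zero, add_zero]
  | succ n ih =>
    simp only [apply_succ, map_add, contract_extD, contract_mul, sub_apply, add_apply, ih, lieD_mul,
      extD_sgn, contract_sgn, sgn_sgn, sub_mul, mul_sub, neg_mul, neg_apply]
    ring

end CartanCalculus

end Form

section FormAction

variable {d n : ℕ} {H : Type*} [TopologicalSpace H]
  {I : ModelWithCorners ℝ (EuclideanSpace ℝ (Fin n)) H}
  {G : Type*} [Group G] [TopologicalSpace G] [ChartedSpace (EuclideanSpace ℝ (Fin d)) G]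
  [LieGroup (𝓡 d) ∞ G]
  {W : Type*} [TopologicalSpace W] [ChartedSpace H W] [IsManifold I ∞ W]
  [MulAction G W] [ContMDiffSMul (𝓡 d) I ∞ G W]

theorem pullField_lie (g : G) (X Y : VField I W) :
    pullField d I g ⁅X, Y⁆ = ⁅pullField d I g X, pullField d I g Y⁆ :=
  ContMDiffSection.ext fun x => by
    exact VectorField.mpullback_mlieBracket (n := ∞) (f := fun y : W => g • y) (x₀ := x)
      X.mdifferentiableAt Y.mdifferentiableAt
      (ContMDiffSMul.contMDiff_const_smul (I := 𝓡 d) g).contMDiffAt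
      (by rw [minSmoothness_of_isRCLikeNormedField]; exact ENat.LEInfty.out)

theorem lie_pullField_pullFn (g : G) (X : VField I W) (φ : Fn I W) :
    ⁅pullField d I g X, pullFn d I g φ⁆ = pullFn d I g ⁅X, φ⁆ := by
  refine ContMDiffMap.ext fun x => ?_
  have hg : MDifferentiableAt I I (fun y : W => g • y) x :=
    (ContMDiffSMul.contMDiff_const_smul (I := 𝓡 d) (n := ∞) g).mdifferentiable (by simp) x
  have hchain := mfderiv_mfderiv_apply (f := fun y : W => g • y) (g := φ) rfl (fun _ => rfl)
    (VField.mdiffAt φ (g • x)) hg (pullField d I g X x)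
  exact hchain.symm.trans (congrArg (mfderiv I 𝓘(ℝ, ℝ) φ (g • x)) (mfderiv_pullField I g X x))

theorem lie_pullFn_inv (g : G) (X : VField I W) (φ : Fn I W) :
    ⁅X, pullFn d I g⁻¹ φ⁆ = pullFn d I g⁻¹ ⁅pullField d I g X, φ⁆ := by
  have hφ : pullFn d I g (pullFn d I g⁻¹ φ) = φ := by simpa using pullFn_inv_pullFn I g⁻¹ φ
  conv_rhs => rw [← hφ, lie_pullField_pullFn, pullFn_inv_pullFn]

theorem formAction_apply (g : G) (α : Form (Fn I W) (VField I W)) (k : ℕ)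
    (v : Fin k → VField I W) : formAction d I W g α k v =
      pullFn d I g⁻¹ (α k fun i => pullField d I g (v i)) := rfl

theorem contract_formAction (g : G) (X : VField I W) (α : Form (Fn I W) (VField I W)) :
    Form.contract X (formAction d I W g α) =
      formAction d I W g (Form.contract (pullField d I g X) α) := by
  refine Form.ext fun k v => ?_
  rw [Form.contract_apply, formAction_apply, formAction_apply, Form.contract_apply]
  congr 2
  funext i
  induction i using Fin.cases <;> rfl

theorem formAction_sgn (g : G) (α : Form (Fn I W) (VField I W)) :
    formAction d I W g (Form.sgn α) = Form.sgn (formAction d I W g α) := by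
  refine Form.ext fun k v => ?_
  rw [Form.sgn_apply, formAction_apply, formAction_apply, Form.sgn_apply]
  rcases neg_one_pow_eq_or (Fn I W) k with h | h <;> rw [h]
  · rw [one_mul, one_mul]
  · rw [neg_one_mul, neg_one_mul]; rfl

theorem formAction_mul (g : G) (α β : Form (Fn I W) (VField I W)) :
    formAction d I W g (α * β) = formAction d I W g α * formAction d I W g β := by
  refine Form.ext fun k v => ?_
  induction k generalizing α β with
  | zero =>
    have e : (fun i => pullField d I g ((![] : Fin 0 → VField I W) i)) = ![] :=
      Subsingleton.elim _ _
    rw [Subsingleton.elim v ![], Form.mul_zero_apply, formAction_apply, formAction_apply,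
      formAction_apply, e, Form.mul_zero_apply]
    rfl
  | succ k ih =>
    simp only [Form.apply_succ, contract_formAction, Form.contract_mul, map_add, Form.add_apply,
      ih, formAction_sgn]

theorem formAction_lieD (g : G) (X : VField I W) (α : Form (Fn I W) (VField I W)) :
    Form.lieD X (formAction d I W g α) = formAction d I W g (Form.lieD (pullField d I g X) α) := by
  refine Form.ext fun k v => ?_
  induction k generalizing α with
  | zero =>
    rw [Form.lieD_zero_apply, formAction_apply, formAction_apply, Form.lieD_zero_apply,
      lie_pullFn_inv]
  | succ k ih =>
    simp only [Form.apply_succ, contract_formAction, Form.contract_lieD, map_sub, Form.sub_apply,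
      ih, pullField_lie]

theorem formAction_extD (g : G) (α : Form (Fn I W) (VField I W)) :
    formAction d I W g (Form.extD ℝ α) = Form.extD ℝ (formAction d I W g α) := by
  refine Form.ext fun k v => ?_
  induction k generalizing α with
  | zero => rfl
  | succ k ih =>
    simp only [Form.apply_succ, contract_formAction, Form.contract_extD, map_sub, Form.sub_apply,
      ih, formAction_lieD]

theorem formAction_ofFun (g : G) (φ : Fn I W) :
    formAction d I W g (Form.ofFun φ) = Form.ofFun (pullFn d I g⁻¹ φ) :=
  Form.ext_contract rfl fun X => by
    rw [contract_formAction, Form.contract_ofFun, Form.contract_ofFun, map_zero]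

theorem formAction_one (g : G) : formAction d I W g 1 = 1 :=
  formAction_ofFun g 1

theorem formAction_ofOne_cutOffForm (f : CutOff d I G W) (η : Connection d I G W) (g : G)
    (l : Module.Dual ℝ (GroupLieAlgebra (𝓡 d) G)) :
    formAction d I W g (Form.ofOne (cutOffForm f η l)) =
      Form.ofOne (cutOffForm f η (l ∘ₗ Ad g⁻¹)) :=
  Form.ext_contract rfl fun X => by
    rw [contract_formAction, Form.contract_ofOne, Form.contract_ofOne, formAction_ofFun,
      ← pullFn_cutOffForm, pullFn_inv_pullFn]

theorem lieD_ofOne_cutOffForm (f : CutOff d I G W) (η : Connection d I G W)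
    (ξ : GroupLieAlgebra (𝓡 d) G) (l : Module.Dual ℝ (GroupLieAlgebra (𝓡 d) G)) :
    Form.lieD (fundField I ξ) (Form.ofOne (cutOffForm f η l)) =
      Form.ofOne (cutOffForm f η ⁅ξ, l⁆) := by
  refine Form.ext_contract (lie_zero (M := Fn I W) (fundField I ξ : VField I W)) fun Y => ?_
  rw [Form.contract_lieD, Form.contract_ofOne, Form.contract_ofOne, Form.contract_ofOne,
    Form.lieD_ofFun, lie_fundField_cutOffForm, map_add, add_sub_cancel_left]

end FormAction

section CartanModel

variable {d n : ℕ} {H : Type*} [TopologicalSpace H]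
  {I : ModelWithCorners ℝ (EuclideanSpace ℝ (Fin n)) H}
  {G : Type*} [Group G] [TopologicalSpace G] [ChartedSpace (EuclideanSpace ℝ (Fin d)) G]
  {W : Type*} [TopologicalSpace W] [ChartedSpace H W] [IsManifold I ∞ W]

variable (I W) in
/-- The exterior derivative of differential forms. -/
def dForm : DiffForm I W →ₗ[ℝ] DiffForm I W :=
  (Form.extD ℝ : Form (Fn I W) (VField I W) →ₗ[ℝ] Form (Fn I W) (VField I W))

variable (I W) in
/-- The parity involution of differential forms. -/
def sgnForm : DiffForm I W →ₐ[ℝ] DiffForm I W :=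
  AlgHom.ofLinearMap ((Form.sgn.restrictScalars ℝ :
    Form (Fn I W) (VField I W) →ₗ[ℝ] Form (Fn I W) (VField I W))) (Form.sgn_ofFun 1) Form.sgn_mul

/-- The functions as differential forms. -/
def fnForm (φ : Fn I W) : DiffForm I W := (Form.ofFun φ : Form (Fn I W) (VField I W))

theorem dForm_mul (α β : DiffForm I W) :
    dForm I W (α * β) = dForm I W α * β + sgnForm I W α * dForm I W β := Form.extD_mul ℝ α β

theorem dForm_dForm (α : DiffForm I W) : dForm I W (dForm I W α) = 0 := Form.extD_extD ℝ α

theorem dForm_one : dForm I W 1 = 0 := by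
  simpa using dForm_mul (1 : DiffForm I W) 1

theorem sgnForm_dForm (α : DiffForm I W) : sgnForm I W (dForm I W α) = -dForm I W (sgnForm I W α) :=
  (neg_eq_iff_eq_neg.2 (Form.extD_sgn ℝ α)).symm

theorem sgnForm_sgnForm (α : DiffForm I W) : sgnForm I W (sgnForm I W α) = α :=
  Form.sgn_sgn (A := Fn I W) (L := VField I W) α

theorem add_sgnForm_mul_comm (α β : DiffForm I W) :
    (α + sgnForm I W α) * β = β * (α + sgnForm I W α) := by
  have heven : sgnForm I W (α + sgnForm I W α) = α + sgnForm I W α := by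
    rw [map_add, sgnForm_sgnForm, add_comm]
  exact Form.commute_of_even (A := Fn I W) (L := VField I W) heven β

theorem sub_sgnForm_mul (α β : DiffForm I W) :
    (α - sgnForm I W α) * β = sgnForm I W β * (α - sgnForm I W α) := by
  have hodd : sgnForm I W (α - sgnForm I W α) = -(α - sgnForm I W α) := by
    rw [map_sub, sgnForm_sgnForm, neg_sub]
  exact Form.ext (A := Fn I W) (L := VField I W) fun k => (Form.mul_comm_of_even_odd k _ _).2 hodd

variable (d I G W) in
/-- The parity involution of `S(g*) ⊗ Ω(W)`. -/
def sgnSymForms : SymForms d I G W →ₐ[ℝ] SymForms d I G W :=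
  Algebra.TensorProduct.map (AlgHom.id ℝ _) (sgnForm I W)

theorem sgnSymForms_tmul (s : SymDual d G) (α : DiffForm I W) :
    sgnSymForms d I G W (s ⊗ₜ[ℝ] α) = s ⊗ₜ[ℝ] sgnForm I W α := rfl

theorem add_sgnSymForms_mul_comm (x y : SymForms d I G W) :
    (x + sgnSymForms d I G W x) * y = y * (x + sgnSymForms d I G W x) := by
  induction x using TensorProduct.induction_on with
  | zero => simp only [map_zero, add_zero, zero_mul, mul_zero]
  | add x x' hx hx' =>
    rw [map_add, add_add_add_comm, add_mul, hx, hx', mul_add y (x + _)]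
  | tmul s α =>
    induction y using TensorProduct.induction_on with
    | zero => rw [zero_mul, mul_zero]
    | add y y' hy hy' => rw [mul_add, add_mul y, hy, hy']
    | tmul s' β =>
      rw [sgnSymForms_tmul, ← TensorProduct.tmul_add, Algebra.TensorProduct.tmul_mul_tmul,
        Algebra.TensorProduct.tmul_mul_tmul, add_sgnForm_mul_comm, mul_comm s]

theorem sub_sgnSymForms_mul (x y : SymForms d I G W) :
    (x - sgnSymForms d I G W x) * y = sgnSymForms d I G W y * (x - sgnSymForms d I G W x) := by
  induction x using TensorProduct.induction_on with
  | zero => simp only [map_zero, sub_zero, zero_mul, mul_zero]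
  | add x x' hx hx' =>
    rw [map_add, add_sub_add_comm, add_mul, hx, hx', mul_add _ (x - _)]
  | tmul s α =>
    induction y using TensorProduct.induction_on with
    | zero => rw [map_zero, zero_mul, mul_zero]
    | add y y' hy hy' => rw [mul_add, map_add, add_mul, hy, hy']
    | tmul s' β =>
      rw [sgnSymForms_tmul, sgnSymForms_tmul, ← TensorProduct.tmul_sub,
        Algebra.TensorProduct.tmul_mul_tmul, Algebra.TensorProduct.tmul_mul_tmul, sub_sgnForm_mul,
        mul_comm s]

variable [LieGroup (𝓡 d) ∞ G] [MulAction G W] [ContMDiffSMul (𝓡 d) I ∞ G W]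
  {ι : Type*} [Fintype ι] (b : Module.Basis ι ℝ (GroupLieAlgebra (𝓡 d) G))

/-- The contraction of differential forms with a fundamental vector field. -/
def iotaForm (ξ : GroupLieAlgebra (𝓡 d) G) : DiffForm I W →ₗ[ℝ] DiffForm I W :=
  ((Form.contract (fundField I ξ)).restrictScalars ℝ :
    Form (Fn I W) (VField I W) →ₗ[ℝ] Form (Fn I W) (VField I W))

theorem iotaForm_mul (ξ : GroupLieAlgebra (𝓡 d) G) (α β : DiffForm I W) :
    iotaForm ξ (α * β) = iotaForm ξ α * β + sgnForm I W α * iotaForm ξ β :=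
  Form.contract_mul (fundField I ξ) α β

theorem iotaForm_fnForm (ξ : GroupLieAlgebra (𝓡 d) G) (φ : Fn I W) :
    iotaForm ξ (fnForm φ) = 0 := Form.contract_ofFun (fundField I ξ) φ

theorem sgnForm_iotaForm (ξ : GroupLieAlgebra (𝓡 d) G) (α : DiffForm I W) :
    sgnForm I W (iotaForm ξ α) = -iotaForm ξ (sgnForm I W α) :=
  (neg_eq_iff_eq_neg.2 (Form.contract_sgn (fundField I ξ) α)).symm

theorem cartanD_tmul (s : SymDual d G) (α : DiffForm I W) :
    cartanD I W b (s ⊗ₜ[ℝ] α) =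
      s ⊗ₜ[ℝ] dForm I W α - ∑ a, (theta b a * s) ⊗ₜ[ℝ] iotaForm (b a) α := by
  have h : cartanD I W b = TensorProduct.map LinearMap.id (dForm I W) -
      ∑ a, TensorProduct.map (LinearMap.mulLeft ℝ (theta b a)) (iotaForm (b a)) := rfl
  rw [h, LinearMap.sub_apply, LinearMap.sum_apply]
  rfl

theorem cartanD_tmul_one (s : SymDual d G) : cartanD I W b (s ⊗ₜ[ℝ] 1) = 0 := by
  have hiota (ξ : GroupLieAlgebra (𝓡 d) G) : iotaForm ξ (1 : DiffForm I W) = 0 :=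
    iotaForm_fnForm ξ 1
  simp only [cartanD_tmul, dForm_one, hiota, TensorProduct.tmul_zero, Finset.sum_const_zero,
    sub_zero]

theorem cartanD_mul (x y : SymForms d I G W) : cartanD I W b (x * y) =
    cartanD I W b x * y + sgnSymForms d I G W x * cartanD I W b y := by
  induction x using TensorProduct.induction_on with
  | zero => simp only [zero_mul, map_zero, add_zero]
  | add x x' hx hx' => simp only [add_mul, map_add, hx, hx']; abel
  | tmul s α =>
    induction y using TensorProduct.induction_on with
    | zero => simp only [mul_zero, map_zero, add_zero]
    | add y y' hy hy' => simp only [mul_add, map_add, hy, hy']; abel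
    | tmul s' β =>
      simp only [Algebra.TensorProduct.tmul_mul_tmul, cartanD_tmul, sgnSymForms_tmul, dForm_mul,
        iotaForm_mul, TensorProduct.tmul_add, sub_mul, mul_sub, Finset.sum_mul, Finset.mul_sum,
        Finset.sum_add_distrib, mul_assoc, mul_left_comm s]
      abel

theorem sgnSymForms_cartanD (x : SymForms d I G W) :
    sgnSymForms d I G W (cartanD I W b x) = -cartanD I W b (sgnSymForms d I G W x) := by
  induction x using TensorProduct.induction_on with
  | zero => simp only [map_zero, neg_zero]
  | add x x' hx hx' => simp only [map_add, hx, hx', neg_add]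
  | tmul s α =>
    simp only [cartanD_tmul, sgnSymForms_tmul, map_sub, map_sum, sgnForm_dForm, sgnForm_iotaForm,
      TensorProduct.tmul_neg, Finset.sum_neg_distrib]
    abel

variable (I W) in
/-- The Cartan differential as an odd derivation of `S(g*) ⊗ Ω(W)`. -/
def cartanDerivation : OddDerivation ℝ (SymForms d I G W) where
  parity := sgnSymForms d I G W
  diff := cartanD I W b
  diff_mul := cartanD_mul b
  parity_diff := sgnSymForms_cartanD b
  mul_comm_of_even x hx y := by
    have h := add_sgnSymForms_mul_comm x y
    rw [hx, ← two_smul ℝ, smul_mul_assoc, mul_smul_comm] at h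
    exact smul_right_injective _ two_ne_zero h
  mul_of_odd x hx y := by
    have h := sub_sgnSymForms_mul x y
    rw [hx, sub_neg_eq_add, ← two_smul ℝ, smul_mul_assoc, mul_smul_comm] at h
    exact smul_right_injective _ two_ne_zero h

variable (d I W) in
/-- The action of `g` on differential forms as a homomorphism of algebras. -/
def actForm (g : G) : DiffForm I W →ₐ[ℝ] DiffForm I W :=
  AlgHom.ofLinearMap (formAction d I W g) (formAction_one g) (formAction_mul g)

theorem actForm_dForm (g : G) (α : DiffForm I W) :
    actForm d I W g (dForm I W α) = dForm I W (actForm d I W g α) := formAction_extD g α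

variable (I W) in
/-- The action of `g` on `S(g*) ⊗ Ω(W)` as a homomorphism of algebras. -/
def actSymForms (g : G) : SymForms d I G W →ₐ[ℝ] SymForms d I G W :=
  Algebra.TensorProduct.map (coAd g) (actForm d I W g)

theorem actSymForms_tmul (g : G) (s : SymDual d G) (α : DiffForm I W) :
    actSymForms I W g (s ⊗ₜ[ℝ] α) = coAd g s ⊗ₜ[ℝ] actForm d I W g α := rfl

theorem mem_equivForms {x : SymForms d I G W} :
    x ∈ equivForms d I G W ↔ ∀ g : G, actSymForms I W g x = x := by
  have h (g : G) : symFormsAction (d := d) I W g = (actSymForms I W g).toLinearMap :=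
    TensorProduct.ext' fun _ _ => rfl
  simp only [equivForms, Submodule.mem_iInf, LinearMap.mem_eqLocus, h, AlgHom.toLinearMap_apply,
    LinearMap.id_apply]

theorem inclC_mem_cocycles {F : SymDual d G} (hF : F ∈ invPoly d G) :
    inclC I W F ∈ cocycles I W b := by
  refine ⟨mem_equivForms.2 fun g => ?_, cartanD_tmul_one b F⟩
  rw [inclC, Algebra.TensorProduct.includeLeft_apply, actSymForms_tmul, map_one]
  exact congrArg (· ⊗ₜ[ℝ] 1) (coadAut_AdEquiv_of_mem_invPoly hF g)

end CartanModel

section ChernWeil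

variable {d n : ℕ} {H : Type*} [TopologicalSpace H]
  {I : ModelWithCorners ℝ (EuclideanSpace ℝ (Fin n)) H}
  {G : Type*} [Group G] [TopologicalSpace G] [ChartedSpace (EuclideanSpace ℝ (Fin d)) G]
  {W : Type*} [TopologicalSpace W] [ChartedSpace H W] [IsManifold I ∞ W] [MulAction G W]
  {ι : Type*} [Fintype ι] (b : Module.Basis ι ℝ (GroupLieAlgebra (𝓡 d) G))
  (f : CutOff d I G W) (η : Connection d I G W)

/-- The components `l(ω_f)` of `ω_f` as differential forms. -/
def connForm : Module.Dual ℝ (GroupLieAlgebra (𝓡 d) G) →ₗ[ℝ] DiffForm I W where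
  toFun l := (Form.ofOne (cutOffForm f η l) : Form (Fn I W) (VField I W))
  map_add' l m := Form.ext_contract (A := Fn I W) (L := VField I W)
    (add_zero (0 : Fn I W)).symm fun X => by
      refine (Form.contract_ofOne X _).trans (Eq.trans ?_
        (map_add (Form.contract X) (Form.ofOne (cutOffForm f η l))
          (Form.ofOne (cutOffForm f η m))).symm)
      rw [Form.contract_ofOne, Form.contract_ofOne, ← map_add]
      exact congrArg Form.ofFun (ContMDiffMap.ext fun x => mul_add _ _ _)
  map_smul' c l := Form.ext_contract (A := Fn I W) (L := VField I W)
    (smul_zero (A := Fn I W) c).symm fun X => by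
      refine (Form.contract_ofOne X _).trans (Eq.trans ?_
        (map_smul ((Form.contract X).restrictScalars ℝ) c (Form.ofOne (cutOffForm f η l))).symm)
      refine Eq.trans ?_ (congrArg (c • ·) (Form.contract_ofOne X _)).symm
      refine Eq.trans ?_ (map_smul (Form.ofFun.restrictScalars ℝ) c _)
      exact congrArg Form.ofFun (ContMDiffMap.ext fun x => mul_left_comm _ _ _)

theorem sgnForm_connForm (l : Module.Dual ℝ (GroupLieAlgebra (𝓡 d) G)) :
    sgnForm I W (connForm f η l) = -connForm f η l := Form.sgn_ofOne _

theorem gen_eq_sum (l : Module.Dual ℝ (GroupLieAlgebra (𝓡 d) G)) :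
    SymDual.gen d G l = ∑ a, l (b a) • theta b a := by
  conv_lhs => rw [← b.sum_dual_apply_smul_coord l]
  simp only [map_sum, map_smul, theta]

variable [LieGroup (𝓡 d) ∞ G] [ContMDiffSMul (𝓡 d) I ∞ G W]

theorem iotaForm_connForm (ξ : GroupLieAlgebra (𝓡 d) G)
    (l : Module.Dual ℝ (GroupLieAlgebra (𝓡 d) G)) :
    iotaForm ξ (connForm f η l) = l ξ • fnForm f.toFn := by
  refine (Form.contract_ofOne _ _).trans ?_
  rw [cutOffForm_fundField]
  exact map_smul (Form.ofFun.restrictScalars ℝ) (l ξ) f.toFn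

theorem iotaForm_dForm_connForm (ξ : GroupLieAlgebra (𝓡 d) G)
    (l : Module.Dual ℝ (GroupLieAlgebra (𝓡 d) G)) :
    iotaForm ξ (dForm I W (connForm f η l)) =
      connForm f η ⁅ξ, l⁆ - l ξ • dForm I W (fnForm f.toFn) := by
  have hcartan : iotaForm ξ (dForm I W (connForm f η l)) = connForm f η ⁅ξ, l⁆ -
      dForm I W (iotaForm ξ (connForm f η l)) :=
    (Form.contract_extD ℝ (fundField I ξ) (Form.ofOne (cutOffForm f η l))).trans
      (congrArg (· - _) (lieD_ofOne_cutOffForm f η ξ l))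
  rw [hcartan, iotaForm_connForm, map_smul]

theorem actForm_connForm (g : G) (l : Module.Dual ℝ (GroupLieAlgebra (𝓡 d) G)) :
    actForm d I W g (connForm f η l) = connForm f η (l ∘ₗ Ad g⁻¹) :=
  formAction_ofOne_cutOffForm f η g l

theorem actForm_fnForm_toFn (g : G) : actForm d I W g (fnForm f.toFn) = fnForm f.toFn :=
  (formAction_ofFun g f.toFn).trans (congrArg Form.ofFun (f.pullFn_toFn g⁻¹))

theorem coAd_gen (g : G) (l : Module.Dual ℝ (GroupLieAlgebra (𝓡 d) G)) :
    coAd g (SymDual.gen d G l) = SymDual.gen d G (l ∘ₗ Ad g⁻¹) := SymDual.lift_gen _ _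

theorem cartanD_connForm (l : Module.Dual ℝ (GroupLieAlgebra (𝓡 d) G)) :
    cartanD I W b ((1 : SymDual d G) ⊗ₜ[ℝ] connForm f η l) =
      (1 : SymDual d G) ⊗ₜ[ℝ] dForm I W (connForm f η l) -
        SymDual.gen d G l ⊗ₜ[ℝ] fnForm f.toFn := by
  rw [cartanD_tmul, gen_eq_sum b l, TensorProduct.sum_tmul]
  simp only [iotaForm_connForm, mul_one, TensorProduct.tmul_smul, TensorProduct.smul_tmul']

theorem cartanD_cartanD_connForm (l : Module.Dual ℝ (GroupLieAlgebra (𝓡 d) G)) :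
    cartanD I W b (cartanD I W b ((1 : SymDual d G) ⊗ₜ[ℝ] connForm f η l)) =
      -∑ p, theta b p ⊗ₜ[ℝ] connForm f η ⁅b p, l⁆ := by
  have hgen : SymDual.gen d G l ⊗ₜ[ℝ] dForm I W (fnForm f.toFn) =
      ∑ a, l (b a) • theta b a ⊗ₜ[ℝ] dForm I W (fnForm f.toFn) := by
    rw [gen_eq_sum b l, TensorProduct.sum_tmul]
    simp only [TensorProduct.smul_tmul']
  rw [cartanD_connForm, map_sub, cartanD_tmul, cartanD_tmul, dForm_dForm, hgen]
  simp only [iotaForm_fnForm, TensorProduct.tmul_zero, Finset.sum_const_zero, sub_zero, zero_sub,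
    mul_one, iotaForm_dForm_connForm, TensorProduct.tmul_sub, Finset.sum_sub_distrib,
    TensorProduct.tmul_smul]
  abel

/-- The form `ω_f` as an odd connection in `S(g*) ⊗ Ω(W)`. -/
def oddConnection : OddConnection b (SymForms d I G W) where
  toOddDerivation := cartanDerivation I W b
  theta := (TensorProduct.mk ℝ _ _).flip 1 ∘ₗ SymDual.gen d G
  conn := TensorProduct.mk ℝ _ _ 1 ∘ₗ connForm f η
  parity_theta l := (sgnSymForms_tmul _ _).trans (congrArg _ (map_one _))
  diff_theta l := cartanD_tmul_one b _
  parity_conn l := (sgnSymForms_tmul _ _).trans <| by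
    rw [sgnForm_connForm, TensorProduct.tmul_neg]; rfl
  diff_diff_conn l := (cartanD_cartanD_connForm b f η l).trans <| by
    refine congrArg Neg.neg (Finset.sum_congr rfl fun p _ => ?_)
    refine (?_ : _ = theta b p ⊗ₜ[ℝ] 1 * 1 ⊗ₜ[ℝ] connForm f η ⁅b p, l⁆)
    rw [Algebra.TensorProduct.tmul_mul_tmul, mul_one, one_mul]

theorem isEquivariant_oddConnection (g : G) :
    (oddConnection b f η).IsEquivariant (actSymForms I W g) (AdEquiv g) where
  map_theta l := by
    refine (actSymForms_tmul _ _ _).trans ?_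
    rw [coAd_gen, map_one]
    rfl
  map_conn l := by
    refine (actSymForms_tmul _ _ _).trans ?_
    rw [actForm_connForm, map_one]
    rfl
  map_diff_conn l := by
    refine (congrArg _ (cartanD_connForm b f η l)).trans (Eq.trans ?_
      (cartanD_connForm b f η (l ∘ₗ Ad g⁻¹)).symm)
    rw [map_sub, actSymForms_tmul, actSymForms_tmul, map_one, coAd_gen, actForm_dForm,
      actForm_connForm, actForm_fnForm_toFn]

theorem degCurvature_eq (a : ι) : degCurvature b f η a =
    evalAt (1 : ℝ) ((oddConnection b f η).curv (b.coord a)) := by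
  have hdef : degCurvature b f η a =
      (1 : SymDual d G) ⊗ₜ[ℝ] (dForm I W (connForm f η (b.coord a)) +
        (1 / 2 : ℝ) • ∑ p, ∑ q, b.repr ⁅b p, b q⁆ a •
          (connForm f η (b.coord p) * connForm f η (b.coord q))) -
        theta b a ⊗ₜ[ℝ] fnForm (-1 + f.toFn) := rfl
  have hfn : (fnForm (-1 + f.toFn) : DiffForm I W) = -1 + fnForm f.toFn :=
    (map_add Form.ofFun (-1) f.toFn).trans (by rw [map_neg]; rfl)
  have hbracket : (oddConnection b f η).bracket (b.coord a) =
      (1 : SymDual d G) ⊗ₜ[ℝ] ∑ p, ∑ q, b.repr ⁅b p, b q⁆ a •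
        (connForm f η (b.coord p) * connForm f η (b.coord q)) := by
    simp only [OddConnection.bracket_eq_sum_sum, oddConnection, LinearMap.comp_apply,
      TensorProduct.mk_apply, Algebra.TensorProduct.tmul_mul_tmul, mul_one,
      TensorProduct.tmul_sum, TensorProduct.tmul_smul, Module.Basis.coord_apply]
  have hdiff : (oddConnection b f η).diff ((oddConnection b f η).conn (b.coord a)) =
      (1 : SymDual d G) ⊗ₜ[ℝ] dForm I W (connForm f η (b.coord a)) -
        theta b a ⊗ₜ[ℝ] fnForm f.toFn := cartanD_connForm b f η (b.coord a)
  have htheta : (oddConnection b f η).theta (b.coord a) =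
      theta b a ⊗ₜ[ℝ] (1 : DiffForm I W) := rfl
  simp only [OddConnection.curv_apply, map_add, evalAt_monomial, one_pow, one_smul, htheta, hdiff,
    hbracket, hdef, hfn, TensorProduct.tmul_add, TensorProduct.tmul_neg, TensorProduct.tmul_smul]
  abel

theorem chernWeil_eq_evalAt (F : SymDual d G) :
    chernWeil b f η F = evalAt (1 : ℝ) ((oddConnection b f η).subst F) := by
  have hgen (l : Module.Dual ℝ (GroupLieAlgebra (𝓡 d) G)) :
      chernWeil b f η (SymDual.gen d G l) = evalAt (1 : ℝ) ((oddConnection b f η).curv l) := by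
    conv_rhs => rw [← b.sum_dual_apply_smul_coord l]
    simp only [gen_eq_sum b l, map_sum, map_smul, chernWeil_theta, degCurvature_eq]
  refine congr($(symAlgHom_ext (P := chernWeil b f η)
    (Q := (evalAt 1).comp (oddConnection b f η).subst) fun l => (hgen l).trans ?_) F)
  rw [AlgHom.comp_apply, OddConnection.subst_ι]

theorem inclC_eq_evalAt (F : SymDual d G) :
    inclC I W F = evalAt (0 : ℝ) ((oddConnection b f η).subst F) := by
  refine congr($(symAlgHom_ext (P := inclC I W)
    (Q := (evalAt 0).comp (oddConnection b f η).subst) fun l => ?_) F)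
  rw [AlgHom.comp_apply, OddConnection.subst_ι]
  simp only [OddConnection.curv_apply, map_add, evalAt_monomial, pow_zero, one_smul, pow_one,
    zero_smul, add_zero, zero_pow two_ne_zero]
  rfl

theorem chernWeil_mem_cocycles {F : SymDual d G} (hF : F ∈ invPoly d G) :
    chernWeil b f η F ∈ cocycles I W b := by
  have hinv := coadAut_AdEquiv_of_mem_invPoly hF
  rw [chernWeil_eq_evalAt]
  refine ⟨mem_equivForms.2 fun g => ?_,
    (oddConnection b f η).diff_evalAt_subst 1 (coad_eq_zero_of_coadAut_eq hinv)⟩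
  exact ((isEquivariant_oddConnection b f η g).map_evalAt_subst 1 F).trans
    (congrArg (fun P => evalAt 1 ((oddConnection b f η).subst P)) (hinv g))

theorem chernWeil_sub_inclC_mem_coboundaries {F : SymDual d G} (hF : F ∈ invPoly d G) :
    chernWeil b f η F - inclC I W F ∈ coboundaries I W b := by
  have hinv := coadAut_AdEquiv_of_mem_invPoly hF
  rw [chernWeil_eq_evalAt, inclC_eq_evalAt b f η,
    (oddConnection b f η).evalAt_subst_sub (coad_eq_zero_of_coadAut_eq hinv)]
  refine Submodule.mem_map_of_mem (mem_equivForms.2 fun g => ?_)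
  exact ((isEquivariant_oddConnection b f η g).map_homotopy F).trans
    (congrArg (oddConnection b f η).homotopy (hinv g))

end ChernWeil

end

end DegCW

theorem theorem2p6_general {d n : ℕ} {H : Type*} [TopologicalSpace H]
    (I : ModelWithCorners ℝ (EuclideanSpace ℝ (Fin n)) H)
    (G : Type*) [Group G] [TopologicalSpace G] [ChartedSpace (EuclideanSpace ℝ (Fin d)) G]
    [LieGroup (𝓡 d) ∞ G]
    (W : Type*) [TopologicalSpace W] [ChartedSpace H W] [IsManifold I ∞ W]
    [MulAction G W] [ContMDiffSMul (𝓡 d) I ∞ G W]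
    {ι : Type*} [Fintype ι] (b : Module.Basis ι ℝ (GroupLieAlgebra (𝓡 d) G))
    (f : DegCW.CutOff d I G W) (η : DegCW.Connection d I G W) :
    ∃ (hcw : ∀ F ∈ DegCW.invPoly d G, DegCW.chernWeil b f η F ∈ DegCW.cocycles I W b)
      (hic : ∀ F ∈ DegCW.invPoly d G, DegCW.inclC I W F ∈ DegCW.cocycles I W b),
      DegCW.inducedMap I W b (DegCW.chernWeil b f η) hcw =
        DegCW.inducedMap I W b (DegCW.inclC I W) hic :=
  ⟨fun _ hF => DegCW.chernWeil_mem_cocycles b f η hF, fun _ hF => DegCW.inclC_mem_cocycles b hF,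
    LinearMap.ext fun F =>
      (Submodule.Quotient.eq _).2 (DegCW.chernWeil_sub_inclC_mem_coboundaries b f η F.2)⟩

theorem theorem2p6 {d n : ℕ} {H : Type*} [TopologicalSpace H]
    (I : ModelWithCorners ℝ (EuclideanSpace ℝ (Fin n)) H)
    (G : Type*) [Group G] [TopologicalSpace G] [ChartedSpace (EuclideanSpace ℝ (Fin d)) G]
    [LieGroup (𝓡 d) ∞ G] [T2Space G] [CompactSpace G] [ConnectedSpace G]
    (W : Type*) [TopologicalSpace W] [ChartedSpace H W] [IsManifold I ∞ W]
    [T2Space W] [CompactSpace W] [MulAction G W] [ContMDiffSMul (𝓡 d) I ∞ G W]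
    (hW : DegCW.IsDegeneratePrincipalBundle d I G W)
    {ι : Type*} [Fintype ι] (b : Module.Basis ι ℝ (GroupLieAlgebra (𝓡 d) G))
    (f : DegCW.CutOff d I G W) (η : DegCW.Connection d I G W) :
    ∃ (hcw : ∀ F ∈ DegCW.invPoly d G, DegCW.chernWeil b f η F ∈ DegCW.cocycles I W b)
      (hic : ∀ F ∈ DegCW.invPoly d G, DegCW.inclC I W F ∈ DegCW.cocycles I W b),
      DegCW.inducedMap I W b (DegCW.chernWeil b f η) hcw =
        DegCW.inducedMap I W b (DegCW.inclC I W) hic :=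
  theorem2p6_general I G W b f η
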